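/- **Setting.** Fix an integer $N\ge 1$, smooth functions $q^\alpha_i:\mathbb R\to\mathbb R$ ($0\le\alpha,i\le N$) with $E_0:=q^0_0(0)$ and $\lambda:=q^1_0(0)>0$, a number $\varphi\in\mathbb R$ and a sign $\sigma=\pm1$. Put $q^\alpha(\tau;\hbar)=\sum_{i=0}^N\hbar^i q^\alpha_i(\tau)$. On the space $L^2(\mathbb T\times\mathbb R)$ of functions with $u(s+1,x)=e^{-i\varphi/\hbar}u(s,\sigma x)$, normed by the $L^2$ norm on $(0,1]\times\mathbb R$, let $P^{(N)}$ be the closure of the Weyl quantization of the normal form symbol $\sum_{\alpha=0}^N q^\alpha(\tau;\hbar)(x\xi)^\alpha$, i.e. of the operator that maps each twisted-periodic function $e^{iks}v(x)$, $v\in\mathcal S(\mathbb R)$, to $e^{iks}\,\big(\mathrm{Op}^w_\hbar\big(\sum_\alpha q^\alpha(\hbar k;\hbar)(x\xi)^\alpha\big)v\big)(x)$. Let $\varphi_\hbar\in[0,2\pi)$ be congruent to $\varphi/\hbar$ modulo $2\pi$ and, for $n\in\mathbb Z$, let $$\psi_0(s,x)=e^{i(2\pi n-\varphi_\hbar)s}(\pi\hbar)^{-1/4}e^{-x^2/(2\hbar)},\qquad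 q^0=q^0(\hbar(2\pi n-\varphi_\hbar);\hbar),$$ and let $\psi_t=e^{-itP^{(N)}/\hbar}\psi_0$ be the solution of $i\hbar\partial_t\psi_t=P^{(N)}\psi_t$ with initial value $\psi_0$. For $\chi\in C_c^\infty((-1,1),[0,1])$, $T>0$ and $E_\hbar\in\mathbb R$ put $$\Psi=\int_{\mathbb R}\chi(t/T)\,e^{itE_\hbar/\hbar}\,\psi_t\,dt,\qquad S_1(q,\theta)=\frac{1}{q\sqrt{2\pi}}\Big|\Gamma\Big(\tfrac14+\tfrac{i\theta}{2q}\Big)\Big|^2,\qquad T_{\varepsilon'}=\frac{(1-\varepsilon')|\log\hbar|}{2\lambda}.$$ Below, $n=n(\hbar)$ is bounded, $|n|\le n_0$, and $E_\hbar=E_0+\mathcal O(\hbar)$, i.e. $|E_\hbar-E_0|\le C_E\hbar$; the implied constants, and how small $\hbar$ has to be, depend only on the normal form data, $\chi$, $n_0$, $C_E$, and on $C$ in (1) and $\varepsilon'$ in (2), (3) and (5). **Theorem.** For all $\hbar\in(0,1]$ and $n\in\mathbb Z$ the solution $\psi_t$ exists for all $t\in\mathbb R$ and is unique; $S_1(q,\theta)>0$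 for all $q>0$ and $\theta\in\mathbb R$; and: 1. For every $C$, all $\hbar\in(0,1]$ and all $T$ with $1\le T\le C|\log\hbar|$, $$\|\Psi\|^2=T\,S_1\big(\lambda,(E_\hbar-q^0)/\hbar\big)\,\|\chi\|_{L^2}^2\,\big(1+\mathcal O(1/T)\big).$$ 2. For every $\varepsilon'\in(0,1)$, all $\hbar\in(0,1/2]$ and $T=T_{\varepsilon'}$, the state $\Psi$ is in the domain of $P^{(N)}$ and $$\|(P^{(N)}-E_\hbar)\Psi\|^2=\frac{\hbar^2}{T_{\varepsilon'}}\,S_1\big(\lambda,(E_\hbar-q^0)/\hbar\big)\,\|\chi'\|_{L^2}^2\,\big(1+\mathcal O(1/|\log\hbar|)\big).$$ 3. If $\chi\ne0$, $\varepsilon'\in(0,1)$ and $T=T_{\varepsilon'}$, then for all sufficiently small $\hbar$ one has $\Psi\neq0$, and $\tilde\Psi=\Psi/\|\Psi\|$ satisfies $$\|(P^{(N)}-E_\hbar)\tilde\Psi\|=\frac{\hbar}{T_{\varepsilon'}}\,\frac{\|\chi'\|_{L^2}}{\|\chi\|_{L^2}}\,\big(1+\mathcal O(1/|\log\hbar|)\big).$$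 4. The infimum of $\|\chi'\|_{L^2}/\|\chi\|_{L^2}$ over all nonzero $\chi\in C_c^\infty((-1,1),[0,1])$ is $\pi/2$. 5. For every $\varepsilon'\in(0,1/2)$ there is a nonzero $\chi\in C_c^\infty((-1,1),[0,1])$, depending only on $\varepsilon'$, with $\|\chi'\|_{L^2}/\|\chi\|_{L^2}\le\frac\pi2(1+\varepsilon')$ for which, with $T=T_{\varepsilon'}$ and for all sufficiently small $\hbar$, $$\|(P^{(N)}-E_\hbar)\tilde\Psi\|=\pi\lambda(1+2\varepsilon')\frac{\hbar}{|\log\hbar|}\big(1+\mathcal O(1/|\log\hbar|)\big)\le\pi\lambda(1+3\varepsilon')\frac{\hbar}{|\log\hbar|}.$$ -/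

import Mathlib

open MeasureTheory Set
open scoped ContDiff SchwartzMap

noncomputable section

/-- The `h`-Weyl quantization of a symbol `a x ξ` on `T*ℝ`, applied to `u`. The integral over `y`
is performed first: for a Schwartz function `u` and a polynomial symbol `a` the inner integral
then converges absolutely and is a rapidly decreasing function of `ξ`. -/
def weylOp (h : ℝ) (a : ℝ → ℝ → ℂ) (u : ℝ → ℂ) (x : ℝ) : ℂ :=
  (1 / (2 * Real.pi * h) : ℝ) *
    ∫ ξ : ℝ, ∫ y : ℝ,
      Complex.exp (Complex.I * ((x - y) * ξ / h : ℝ)) * a ((x + y) / 2) ξ * u y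

/-- The data of a quantum Birkhoff normal form at a hyperbolic closed orbit of a Hamiltonian on a
surface: the order `N ≥ 1`, the smooth real coefficients `q^α_i(τ)` (`coeff α i τ`,
`0 ≤ α, i ≤ N`), the action of the orbit, and the sign `1` or `-1` according to whether the unstable
manifold of the orbit is orientable or not. The energy of the orbit is `E₀ = q^0_0(0)`, and its
expansion rate `λ = q^1_0(0)` is positive. -/
structure QuantumNormalForm where
  N : ℕ
  one_le_N : 1 ≤ N
  coeff : ℕ → ℕ → ℝ → ℝ
  smooth : ∀ α ≤ N, ∀ i ≤ N, ContDiff ℝ ∞ (coeff α i)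
  rate_pos : 0 < coeff 1 0 0
  action : ℝ
  orientation : ℤˣ

/-- `L²` of the model space `𝕋 × ℝ`. A twisted periodic function on `ℝ × ℝ` is represented by its
restriction to the fundamental domain `(0, 1] × ℝ`. -/
abbrev ModelL2 : Type :=
  Lp ℂ 2 ((volume : Measure (ℝ × ℝ)).restrict (Ioc (0 : ℝ) 1 ×ˢ (univ : Set ℝ)))

/-- The class `f` in `L²(𝕋 × ℝ)` is the one of the (twisted periodic) function `u`. -/
def Represents (f : ModelL2) (u : ℝ → ℝ → ℂ) : Prop :=
  (f : ℝ × ℝ → ℂ) =ᵐ[(volume : Measure (ℝ × ℝ)).restrict (Ioc (0 : ℝ) 1 ×ˢ (univ : Set ℝ))]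
    fun p => u p.1 p.2

namespace QuantumNormalForm

variable (F : QuantumNormalForm)

/-- The energy `E₀` of the orbit. -/
def energy : ℝ := F.coeff 0 0 0

/-- The expansion rate `λ` of the orbit. -/
def rate : ℝ := F.coeff 1 0 0

/-- `q^α(τ; h) = ∑_{i ≤ N} h^i q^α_i(τ)`. -/
def fullCoeff (h : ℝ) (α : ℕ) (τ : ℝ) : ℝ :=
  ∑ i ∈ Finset.range (F.N + 1), h ^ i * F.coeff α i τ

/-- The Weyl symbol `p(τ, x, ξ; h) = ∑_{α ≤ N} q^α(τ; h) (x ξ)^α` of the normal form. -/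
def symbol (h τ x ξ : ℝ) : ℂ :=
  ((∑ α ∈ Finset.range (F.N + 1), F.fullCoeff h α τ * (x * ξ) ^ α : ℝ) : ℂ)

/-- The twisted periodicity `u(s + 1, x) = e^{-iφ/h} u(s, ± x)`, with `φ` the action of the orbit,
the sign being the orientation. -/
def Twisted (h : ℝ) (u : ℝ → ℝ → ℂ) : Prop :=
  ∀ s x : ℝ, u (s + 1) x =
    Complex.exp (-Complex.I * (F.action / h : ℝ)) * u s (((F.orientation : ℤ) : ℝ) * x)

/-- The graph of the Weyl quantization of the normal form symbol on the finite linear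
combinations of the twisted periodic functions `e^{iks} v(x)`, `v` Schwartz. As the symbol does not
depend on `s`, its quantization maps `e^{iks} v(x)` to `e^{iks} (Op(p(hk, ·, ·; h)) v)(x)`. -/
def coreGraph (h : ℝ) : Submodule ℂ (ModelL2 × ModelL2) :=
  Submodule.span ℂ { fg : ModelL2 × ModelL2 | ∃ (k : ℝ) (v : 𝓢(ℝ, ℂ)),
    F.Twisted h (fun s x => Complex.exp (Complex.I * (k * s : ℝ)) * v x) ∧
    Represents fg.1 (fun s x => Complex.exp (Complex.I * (k * s : ℝ)) * v x) ∧
    Represents fg.2 (fun s x => Complex.exp (Complex.I * (k * s : ℝ)) *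
      weylOp h (F.symbol h (h * k)) v x) }

/-- The normal form operator `P^(N)` on `L²(𝕋 × ℝ)`, an unbounded operator: the closure of the Weyl
quantization of the symbol. -/
def operator (h : ℝ) : ModelL2 →ₗ.[ℂ] ModelL2 :=
  (F.coreGraph h).topologicalClosure.toLinearPMap

/-- The twist angle `φ_h ∈ [0, 2π)`, equal to `φ/h` modulo `2π`. -/
def twistAngle (h : ℝ) : ℝ := 2 * Real.pi * Int.fract (F.action / (2 * Real.pi * h))

/-- The initial Gaussian beam
`ψ₀(s, x) = e^{i(2πn - φ_h)s} (πh)^{-1/4} e^{-x²/(2h)}`. -/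
def initialState (h : ℝ) (n : ℤ) (s x : ℝ) : ℂ :=
  Complex.exp (Complex.I * ((2 * Real.pi * n - F.twistAngle h) * s : ℝ)) *
    (((Real.pi * h) ^ (-(1 / 4) : ℝ) * Real.exp (-x ^ 2 / (2 * h)) : ℝ) : ℂ)

/-- The energy `q^0 = q^0(h(2πn - φ_h); h)`. -/
def centralEnergy (h : ℝ) (n : ℤ) : ℝ :=
  F.fullCoeff h 0 (h * (2 * Real.pi * n - F.twistAngle h))

/-- `ψ_t = e^{-itP/h} ψ₀`, that is, `t ↦ ψ_t ∈ L²(𝕋 × ℝ)` takes its values in the domain of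
`P = P^(N)` and solves the Schrödinger equation `ih ∂_t ψ_t = P ψ_t` with initial value `ψ₀`. -/
def IsEvolution (h : ℝ) (n : ℤ) (ψ : ℝ → ModelL2) : Prop :=
  Represents (ψ 0) (F.initialState h n) ∧
  ∀ t : ℝ, ∃ ht : ψ t ∈ (F.operator h).domain,
    HasDerivAt ψ ((-Complex.I / (h : ℂ)) • F.operator h ⟨ψ t, ht⟩) t

end QuantumNormalForm

/-- The weight functions `χ ∈ C_c^∞((-1, 1), [0, 1])`. -/
def IsCutoff (χ : ℝ → ℝ) : Prop :=
  ContDiff ℝ ∞ χ ∧ tsupport χ ⊆ Ioo (-1) 1 ∧ ∀ t, χ t ∈ Icc (0 : ℝ) 1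

/-- The `L²(ℝ)` norm (of a continuous function with compact support). -/
def l2norm (χ : ℝ → ℝ) : ℝ := Real.sqrt (∫ t : ℝ, χ t ^ 2)

/-- The time average `Ψ = ∫ χ(t/T) e^{itE/h} ψ_t dt`, a Bochner integral in `L²(𝕋 × ℝ)`. -/
def quasimode (h : ℝ) (ψ : ℝ → ModelL2) (χ : ℝ → ℝ) (T E : ℝ) : ModelL2 :=
  ∫ t : ℝ, ((χ (t / T) : ℂ) * Complex.exp (Complex.I * (t * E / h : ℝ))) • ψ t

/-- The normalized time average `Ψ / ‖Ψ‖`. -/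
def normalizedQuasimode (h : ℝ) (ψ : ℝ → ModelL2) (χ : ℝ → ℝ) (T E : ℝ) : ModelL2 :=
  ((‖quasimode h ψ χ T E‖⁻¹ : ℝ) : ℂ) • quasimode h ψ χ T E

/-- `S₁(q, θ) = |Γ(1/4 + iθ/(2q))|² / (q √(2π))`. -/
def S1 (q θ : ℝ) : ℝ :=
  ‖Complex.Gamma (1 / 4 + Complex.I * (θ / (2 * q) : ℝ))‖ ^ 2 / (q * Real.sqrt (2 * Real.pi))

/-- The local Ehrenfest time `(1 - ε) |log h| / (2λ)`. -/
def ehrenfestTime (lam ε h : ℝ) : ℝ := (1 - ε) * |Real.log h| / (2 * lam)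

end

/-! On a sector e^{iks}v(x) the symbol is a polynomial in xξ, so its Weyl quantization is a real
polynomial p(A) in the dilation generator A = -i(x d/dx + 1/2) (`weylOp_polynomial`). On even
functions the coordinate y = log|x| turns A into -i d/dy, and a Fourier transform in y turns it into
multiplication by w = 2πη. The beam lies in one such sector, and its width √h is only a translation
in y, so its spectral density in η does not depend on h and has all moments. The evolution is
multiplication by e^{-itp(w)/h}, which gives existence. The operator is defined through the closure
of a relation; that relation is symmetric and maps its domain into itself, which makes the closure
single valued, and symmetry alone gives uniqueness of the evolution.

For bounded n the coefficients are evaluated at τ = O(h), so p(w)/h = q⁰/h + λw up to O(h) times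
polynomials in w (`exists_sectorPoly_bound`). Hence e^{itE/h}ψ_t is a stationary curve whose
autocorrelation is e^{iθs}(cosh λs)^{-1/2} up to O(h|s|), where θ = (E - q⁰)/h
(`exists_correlation_bound`). The model correlation decays exponentially, and its integral is S₁(λ,
θ) by a beta integral (`integral_exp_div_sqrt_cosh`). Thus the double time integral ‖Ψ‖² equals T S₁
‖χ‖² + O(1 + hT³) (`abs_norm_sq_timeAverage_sub_le`). For T = O(|log h|) the term hT³ is bounded,
and S₁ is bounded below since θ stays in a compact set, so the error is relative of order 1/T.

Integration by parts in t shows that (P - E)Ψ is -ih/T times the time average with weight χ'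
(`timeAverage_mem_closure`). The same norm asymptotics for χ' give the defect, and S₁ cancels in the
quotient. What remains is the Dirichlet problem on (-1, 1) with ground state cos(πt/2): the bound
π/2 comes from completing a square (`IsCutoff.mul_l2norm_le`), its optimality from smooth
truncations of the cosine. Dilating a cutoff realizes every ratio above π/2 exactly, which permits
the exact constant 1 + 2ε in the last claim. -/

noncomputable section

open scoped FourierTransform Polynomial
open SchwartzMap

/-! ### Relations compatible with a polynomial calculus -/

section Algebra

variable {R A M M' : Type*}

/-- If a relation, given as a submodule, is compatible with the endomorphisms `a` and `b`, then it
is compatible with `p(a)` and `p(b)`. -/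
theorem Polynomial.aeval_mem_of_forall_mem {S : Type*} [CommSemiring S] [Semiring R] [AddCommMonoid M]
    [AddCommMonoid M'] [Module S M] [Module S M'] [Module R M] [Module R M']
    [SMulCommClass R S M] [SMulCommClass R S M'] [SMul S R] [IsScalarTower S R M]
    [IsScalarTower S R M']
    (G : Submodule S (M × M')) (a : Module.End R M) (b : Module.End R M')
    (h : ∀ x ∈ G, (a x.1, b x.2) ∈ G) (p : S[X]) {x : M} {y : M'} (hxy : (x, y) ∈ G) :
    (Polynomial.aeval a p x, Polynomial.aeval b p y) ∈ G := by
  induction p using Polynomial.induction_on' with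
  | add p q hp hq => simpa using G.add_mem hp hq
  | monomial n c =>
    have key : ((a ^ n) x, (b ^ n) y) ∈ G := by
      induction n with
      | zero => simpa using hxy
      | succ n ih => rw [pow_succ', pow_succ']; exact h _ ih
    simpa [Polynomial.aeval_monomial, Module.algebraMap_end_apply] using G.smul_mem c key

end Algebra

/-! ### Weyl quantization of polynomials in xξ -/

/-- The polynomials `M_α` with `Op((xξ)^α) = h^α M_α(A)`, where `A = -i(x d/dx + 1/2)`. -/
def weylPoly : ℕ → ℝ[X]
  | 0 => 1
  | 1 => Polynomial.X
  | n + 2 => weylPoly (n + 1) * Polynomial.X - Polynomial.C (((n : ℝ) + 1) ^ 2 / 4) * weylPoly n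

namespace SchwartzMap

theorem hasTemperateGrowth_ofReal : (fun x : ℝ => (x : ℂ)).HasTemperateGrowth :=
  Complex.ofRealCLM.hasTemperateGrowth

/-- Differentiation on Schwartz space. -/
def derivEnd : Module.End ℂ 𝓢(ℝ, ℂ) := (derivCLM ℂ ℂ).toLinearMap

/-- Multiplication by a function of temperate growth on Schwartz space. -/
def mulEnd (g : ℝ → ℂ) : Module.End ℂ 𝓢(ℝ, ℂ) := (smulLeftCLM ℂ g).toLinearMap

theorem derivEnd_apply (v : 𝓢(ℝ, ℂ)) (x : ℝ) : derivEnd v x = deriv v x := rfl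

theorem mulEnd_apply {g : ℝ → ℂ} (hg : g.HasTemperateGrowth) (v : 𝓢(ℝ, ℂ)) (x : ℝ) :
    mulEnd g v x = g x * v x := by
  simp [mulEnd, hg]

/-- The generator `-i(x d/dx + 1/2)` of the unitary dilations. -/
def dilationGen : Module.End ℂ 𝓢(ℝ, ℂ) :=
  -Complex.I • (mulEnd (fun x => x) * derivEnd + (1 / 2 : ℂ) • 1)

theorem dilationGen_apply (v : 𝓢(ℝ, ℂ)) (x : ℝ) :
    dilationGen v x = -Complex.I * (x * deriv v x + v x / 2) := by
  simp only [dilationGen, LinearMap.smul_apply, LinearMap.add_apply, Module.End.mul_apply,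
    Module.End.one_apply, smul_apply, add_apply,
    mulEnd_apply hasTemperateGrowth_ofReal, derivEnd_apply, smul_eq_mul]
  ring

/-- Multiplication by `y ↦ (x + y) / 2`. -/
def midEnd (x : ℝ) : Module.End ℂ 𝓢(ℝ, ℂ) := mulEnd (fun y => ((x + y : ℝ) / 2 : ℂ))

theorem hasTemperateGrowth_mid (x : ℝ) :
    (fun y : ℝ => ((x + y : ℝ) / 2 : ℂ)).HasTemperateGrowth := by
  have : (fun y : ℝ => ((x + y : ℝ) / 2 : ℂ)) =
      (fun _ : ℝ => ((x / 2 : ℝ) : ℂ)) + (fun _ : ℝ => (1 / 2 : ℂ)) * (fun y : ℝ => (y : ℂ)) := by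
    ext y; simp; ring
  rw [this]
  exact (Function.HasTemperateGrowth.const _).add
    ((Function.HasTemperateGrowth.const _).mul hasTemperateGrowth_ofReal)

theorem midEnd_apply (x : ℝ) (v : 𝓢(ℝ, ℂ)) (y : ℝ) :
    midEnd x v y = ((x + y : ℝ) / 2 : ℂ) * v y :=
  mulEnd_apply (hasTemperateGrowth_mid x) v y

theorem derivEnd_midEnd (x : ℝ) (v : 𝓢(ℝ, ℂ)) :
    derivEnd (midEnd x v) = midEnd x (derivEnd v) + (1 / 2 : ℂ) • v := by
  ext y
  have h1 : HasDerivAt (fun y : ℝ => ((x + y : ℝ) / 2 : ℂ)) (1 / 2) y := by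
    have := (((hasDerivAt_id y).const_add x).ofReal_comp).div_const 2
    simpa using this
  have h2 := h1.mul (v.hasDerivAt y)
  have h3 : (⇑(midEnd x v) : ℝ → ℂ) = (fun y : ℝ => ((x + y : ℝ) / 2 : ℂ)) * ⇑v := by
    ext z; simp [midEnd_apply]
  rw [derivEnd_apply, h3, h2.deriv]
  simp only [add_apply, smul_apply, midEnd_apply, derivEnd_apply, smul_eq_mul]
  ring

theorem derivEnd_pow_midEnd (x : ℝ) (n : ℕ) (v : 𝓢(ℝ, ℂ)) :
    (derivEnd ^ (n + 1)) (midEnd x v) =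
      midEnd x ((derivEnd ^ (n + 1)) v) + ((n + 1) / 2 : ℂ) • (derivEnd ^ n) v := by
  induction n with
  | zero => simpa using derivEnd_midEnd x v
  | succ n ih =>
    rw [pow_succ' _ (n + 1), Module.End.mul_apply, ih, map_add, map_smul, derivEnd_midEnd,
      Module.End.mul_apply, pow_succ' _ n, Module.End.mul_apply]
    push_cast; module

theorem derivEnd_midEnd_pow (x : ℝ) (n : ℕ) (v : 𝓢(ℝ, ℂ)) :
    derivEnd ((midEnd x ^ (n + 1)) v) =
      (midEnd x ^ (n + 1)) (derivEnd v) + ((n + 1) / 2 : ℂ) • (midEnd x ^ n) v := by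
  induction n with
  | zero => simpa using derivEnd_midEnd x v
  | succ n ih =>
    rw [pow_succ' _ (n + 1), Module.End.mul_apply, derivEnd_midEnd, ih, map_add, map_smul,
      Module.End.mul_apply, pow_succ' _ n, Module.End.mul_apply]
    push_cast; module

/-- The Weyl ordered monomials are the polynomials `weylPoly` in the generator of dilations. -/
theorem derivEnd_pow_midEnd_pow_apply (n : ℕ) (x : ℝ) (v : 𝓢(ℝ, ℂ)) :
    (-Complex.I) ^ n * (derivEnd ^ n) ((midEnd x ^ n) v) x =
      (Polynomial.aeval dilationGen (weylPoly n)) v x := by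
  have hmid : ∀ f : 𝓢(ℝ, ℂ), midEnd x f x = x * f x := fun f => by
    rw [midEnd_apply]; push_cast; ring
  induction n using Nat.strong_induction_on generalizing v with
  | _ n ih =>
    match n with
    | 0 => simp [weylPoly]
    | 1 =>
      simp only [pow_one, weylPoly, Polynomial.aeval_X, derivEnd_midEnd, dilationGen_apply,
        add_apply, smul_apply, hmid, derivEnd_apply, smul_eq_mul]
      ring
    | n + 2 =>
      have key : Polynomial.aeval dilationGen (weylPoly (n + 2)) v x =
          Polynomial.aeval dilationGen (weylPoly (n + 1)) (dilationGen v) x -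
            (((n : ℂ) + 1) ^ 2 / 4) * Polynomial.aeval dilationGen (weylPoly n) v x := by
        simp [weylPoly, Module.algebraMap_end_apply]
      rw [key, ← ih (n + 1) (by omega), ← ih n (by omega)]
      -- The point x is frozen and y is the variable: writing y = 2·(x + y)/2 - x expresses A
      -- through the midpoint multiplication.
      have hgen : dilationGen v = (-Complex.I) • ((2 : ℂ) • midEnd x (derivEnd v) -
          (x : ℂ) • derivEnd v + (1 / 2 : ℂ) • v) := by
        ext y
        simp only [dilationGen_apply, smul_apply, add_apply, sub_apply, midEnd_apply,
          derivEnd_apply, smul_eq_mul]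
        push_cast; ring
      -- Leibniz rules for the commutator [d/dy, (x + y)/2] = 1/2, evaluated at y = x, where the
      -- midpoint multiplication is multiplication by x. The recursion of `weylPoly` is a linear
      -- combination of them.
      have e1 := congrArg (fun f : 𝓢(ℝ, ℂ) => f x)
        (derivEnd_pow_midEnd x (n + 1) ((midEnd x ^ (n + 1)) v))
      have e2 := congrArg (fun f : 𝓢(ℝ, ℂ) => f x)
        (derivEnd_pow_midEnd x n ((midEnd x ^ n) v))
      have e3 := congrArg (fun f : 𝓢(ℝ, ℂ) => f x)
        (derivEnd_pow_midEnd x n ((midEnd x ^ (n + 1)) (derivEnd v)))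
      have e4 := congrArg (fun f : 𝓢(ℝ, ℂ) => (derivEnd ^ (n + 1)) f x) (derivEnd_midEnd_pow x n v)
      have e5 := congrArg (fun f : 𝓢(ℝ, ℂ) => (derivEnd ^ n) f x) (derivEnd_midEnd_pow x n v)
      simp only [add_apply, smul_apply, hmid, map_add, map_smul, smul_eq_mul] at e1 e2 e3 e4 e5
      have a1 : ∀ f, midEnd x ((midEnd x ^ (n + 1)) f) = (midEnd x ^ (n + 2)) f := fun f => by
        rw [← Module.End.mul_apply, ← pow_succ']
      have a2 : ∀ f, midEnd x ((midEnd x ^ n) f) = (midEnd x ^ (n + 1)) f := fun f => by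
        rw [← Module.End.mul_apply, ← pow_succ']
      have a3 : ∀ f, (midEnd x ^ (n + 1)) (midEnd x f) = (midEnd x ^ (n + 2)) f := fun f => by
        rw [← Module.End.mul_apply, ← pow_succ]
      have a4 : ∀ f, (derivEnd ^ (n + 1)) (derivEnd f) = (derivEnd ^ (n + 2)) f := fun f => by
        rw [← Module.End.mul_apply, ← pow_succ]
      have a5 : ∀ f, (derivEnd ^ n) (derivEnd f) = (derivEnd ^ (n + 1)) f := fun f => by
        rw [← Module.End.mul_apply, ← pow_succ]
      rw [hgen]
      simp only [map_smul, map_add, map_sub, smul_apply, add_apply, sub_apply, smul_eq_mul]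
      simp only [a1, a2, a3, a4, a5] at e1 e2 e3 e4 e5 ⊢
      push_cast at e1 e2 e3 e4 e5 ⊢
      have hI : (-Complex.I) ^ (n + 2) = -(-Complex.I) ^ n := by
        rw [pow_add]; simp
      have hI' : (-Complex.I) ^ (n + 1) * (-Complex.I) = -(-Complex.I) ^ n := by
        rw [← pow_succ, hI]
      rw [← mul_assoc, hI', hI]
      linear_combination (-(-Complex.I) ^ n) * (e1 + x * e4 - ((n + 1) / 2 : ℂ) * e2 - 2 * e3
        + (n + 1) * e5)


theorem fourier_derivEnd (v : 𝓢(ℝ, ℂ)) (η : ℝ) :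
    𝓕 (derivEnd v) η = 2 * Real.pi * Complex.I * η * 𝓕 v η := by
  have h := Real.fourier_deriv (f := v) v.integrable v.differentiable
    ((derivEnd v).integrable (μ := volume))
  have h' := congrFun h η
  rw [fourier_coe, fourier_coe]
  change 𝓕 (deriv v) η = _
  simpa using h'

theorem fourier_derivEnd_pow (n : ℕ) (v : 𝓢(ℝ, ℂ)) (η : ℝ) :
    𝓕 ((derivEnd ^ n) v) η = (2 * Real.pi * Complex.I * η) ^ n * 𝓕 v η := by
  induction n with
  | zero => simp
  | succ n ih => rw [pow_succ', Module.End.mul_apply, fourier_derivEnd, ih]; ring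

theorem midEnd_pow_apply (x : ℝ) (n : ℕ) (v : 𝓢(ℝ, ℂ)) (y : ℝ) :
    (midEnd x ^ n) v y = ((x + y : ℝ) / 2 : ℂ) ^ n * v y := by
  induction n with
  | zero => simp
  | succ n ih => rw [pow_succ', Module.End.mul_apply, midEnd_apply, ih]; ring

end SchwartzMap


/-- The Weyl quantization of a polynomial in `xξ` is a polynomial in the generator of dilations. -/
theorem weylOp_polynomial {h : ℝ} (hh : 0 < h) (N : ℕ) (c : ℕ → ℝ) (v : 𝓢(ℝ, ℂ)) (x : ℝ) :
    weylOp h (fun x ξ => ((∑ α ∈ Finset.range N, c α * (x * ξ) ^ α : ℝ) : ℂ)) v x =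
      Polynomial.aeval dilationGen
        (∑ α ∈ Finset.range N, Polynomial.C (c α * h ^ α) * weylPoly α) v x := by
  -- With x frozen, H is Σ c_α (-ih d/dy)^α ((x + y)/2)^α v. The y-integral is the Fourier transform
  -- of H at ξ/(2πh), where -ih d/dy has the symbol ξ; the ξ-integral is then Fourier inversion at y
  -- = x.
  set H : 𝓢(ℝ, ℂ) := ∑ α ∈ Finset.range N,
    ((c α * h ^ α : ℝ) * (-Complex.I) ^ α : ℂ) • (derivEnd ^ α) ((midEnd x ^ α) v) with hH
  have hinner : ∀ ξ : ℝ, ∫ y : ℝ, Complex.exp (Complex.I * ((x - y) * ξ / h : ℝ)) *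
      ((∑ α ∈ Finset.range N, c α * ((x + y) / 2 * ξ) ^ α : ℝ) : ℂ) * v y =
      Complex.exp (2 * Real.pi * Complex.I * (x * (ξ / (2 * Real.pi * h)) : ℝ)) *
        𝓕 H (ξ / (2 * Real.pi * h)) := by
    intro ξ
    have h1 : 𝓕 H (ξ / (2 * Real.pi * h)) =
        𝓕 (∑ α ∈ Finset.range N, ((c α * ξ ^ α : ℝ) : ℂ) • (midEnd x ^ α) v)
          (ξ / (2 * Real.pi * h)) := by
      rw [← fourierTransformCLM_apply (𝕜 := ℂ), ← fourierTransformCLM_apply (𝕜 := ℂ)]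
      simp only [hH, map_sum, map_smul, fourierTransformCLM_apply, sum_apply, smul_apply,
        fourier_derivEnd_pow, smul_eq_mul]
      refine Finset.sum_congr rfl fun α _ => ?_
      rw [← mul_assoc]
      congr 1
      push_cast
      rw [mul_assoc, ← mul_pow, mul_assoc, ← mul_pow]
      congr 2
      have := Real.pi_ne_zero
      have hc : (h : ℂ) ≠ 0 := Complex.ofReal_ne_zero.2 hh.ne'
      field_simp
      rw [Complex.I_sq]; ring
    rw [h1, fourier_coe, Real.fourier_eq', ← integral_const_mul]
    congr 1
    ext y
    simp only [sum_apply, smul_apply, midEnd_pow_apply, smul_eq_mul]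
    rw [← mul_assoc (Complex.exp _), ← Complex.exp_add, mul_assoc]
    congr 1
    · congr 1
      simp only [RCLike.inner_apply, conj_trivial]
      push_cast
      have := Real.pi_ne_zero
      field_simp
      ring
    · push_cast
      rw [Finset.sum_mul]
      refine Finset.sum_congr rfl fun α _ => ?_
      rw [mul_pow]; ring
  have hpos : 0 < 2 * Real.pi * h := by positivity
  unfold weylOp
  simp_rw [hinner]
  rw [Measure.integral_comp_div (fun η : ℝ => Complex.exp (2 * Real.pi * Complex.I * (x * η : ℝ)) *
    𝓕 H η) (2 * Real.pi * h), abs_of_pos hpos]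
  have h2 : ∫ η : ℝ, Complex.exp (2 * Real.pi * Complex.I * (x * η : ℝ)) * 𝓕 H η = H x := by
    have : H x = 𝓕⁻ (𝓕 H) x := by rw [FourierTransform.fourierInv_fourier_eq]
    rw [this, fourierInv_coe, Real.fourierInv_eq']
    congr 1
    ext η
    simp only [RCLike.inner_apply, conj_trivial, smul_eq_mul]
    congr 2
    push_cast; ring
  rw [h2, Complex.real_smul, ← mul_assoc, ← Complex.ofReal_mul,
    one_div_mul_cancel hpos.ne', Complex.ofReal_one, one_mul, hH]
  simp only [sum_apply, smul_apply, smul_eq_mul, map_sum, LinearMap.sum_apply, map_mul,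
    Module.End.mul_apply, Polynomial.aeval_C, Module.algebraMap_end_apply, mul_assoc,
    derivEnd_pow_midEnd_pow_apply]
  refine Finset.sum_congr rfl fun α _ => ?_
  simp
  ring

/-! ### Closures of symmetric relations -/

section ClosureOfSymmetric

variable {H : Type*} [NormedAddCommGroup H] [InnerProductSpace ℂ H]

theorem Submodule.inner_eq_of_mem_topologicalClosure {G : Submodule ℂ (H × H)}
    (hG : ∀ a ∈ G, ∀ b ∈ G, inner ℂ a.2 b.1 = inner ℂ a.1 b.2) {a b : H × H}
    (ha : a ∈ G.topologicalClosure) (hb : b ∈ G.topologicalClosure) :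
    inner ℂ a.2 b.1 = inner ℂ a.1 b.2 := by
  have step : ∀ b ∈ G, ∀ a ∈ G.topologicalClosure, inner ℂ a.2 b.1 = inner ℂ a.1 b.2 := by
    intro b hb a ha
    have hcl : IsClosed {a : H × H | inner ℂ a.2 b.1 = inner ℂ a.1 b.2} :=
      isClosed_eq (by fun_prop) (by fun_prop)
    exact closure_minimal (fun a ha => hG a ha b hb) hcl ha
  have hcl : IsClosed {b : H × H | inner ℂ a.2 b.1 = inner ℂ a.1 b.2} :=
    isClosed_eq (by fun_prop) (by fun_prop)
  exact closure_minimal (fun b hb => step b hb a ha) hcl hb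

/-- The closure of a symmetric relation whose range lies in its domain is a graph. -/
theorem Submodule.snd_eq_zero_of_mem_topologicalClosure {G : Submodule ℂ (H × H)}
    (hG : ∀ a ∈ G, ∀ b ∈ G, inner ℂ a.2 b.1 = inner ℂ a.1 b.2)
    (hran : ∀ a ∈ G, ∃ c, (a.2, c) ∈ G) {a : H × H} (ha : a ∈ G.topologicalClosure)
    (h0 : a.1 = 0) : a.2 = 0 := by
  -- Density of the domain is not needed: the limit lies in the closure of the range, hence of the
  -- domain, and by symmetry it is orthogonal to that closure.
  have h1 : a.2 ∈ closure (Prod.fst '' (G : Set (H × H))) := by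
    have : Set.MapsTo Prod.snd (closure (G : Set (H × H)))
        (closure (Prod.fst '' (G : Set (H × H)))) := by
      refine Set.MapsTo.closure (fun b hb => ?_) continuous_snd
      obtain ⟨c, hc⟩ := hran b hb
      exact ⟨_, hc, rfl⟩
    exact this ha
  have h2 : ∀ b ∈ closure (Prod.fst '' (G : Set (H × H))), inner ℂ a.2 b = 0 := by
    have hcl : IsClosed {b : H | inner ℂ a.2 b = 0} := isClosed_eq (by fun_prop) (by fun_prop)
    refine closure_minimal ?_ hcl
    rintro _ ⟨b, hb, rfl⟩
    have := Submodule.inner_eq_of_mem_topologicalClosure hG ha (G.le_topologicalClosure hb)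
    rw [h0, inner_zero_left] at this
    exact this
  exact inner_self_eq_zero.1 (h2 _ h1)

end ClosureOfSymmetric

/-! ### Symmetry of the dilation generator -/

namespace SchwartzMap

theorem inner_toLp_eq (v w : 𝓢(ℝ, ℂ)) :
    inner ℂ (v.toLp 2) (w.toLp 2) = ∫ x, (starRingEnd ℂ) (v x) * w x := by
  rw [inner_toL2_toL2_eq v w volume]
  simp [RCLike.inner_apply, mul_comm]

theorem integrable_conj_mul (v w : 𝓢(ℝ, ℂ)) :
    Integrable (fun x => (starRingEnd ℂ) (v x) * w x) := by
  have := (pairing ((ContinuousLinearMap.mul ℝ ℂ).comp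
    (Complex.conjCLE : ℂ →L[ℝ] ℂ)) v w).integrable (μ := volume)
  refine this.congr (Filter.Eventually.of_forall fun x => ?_)
  simp [pairing_apply_apply]

/-- Integration by parts moves d/dx onto xw, and the extra term w from the product rule is balanced
by the summand 1/2 in A. -/
theorem integral_conj_dilationGen_mul (v w : 𝓢(ℝ, ℂ)) :
    ∫ x, (starRingEnd ℂ) (dilationGen v x) * w x =
      ∫ x, (starRingEnd ℂ) (v x) * dilationGen w x := by
  set X : Module.End ℂ 𝓢(ℝ, ℂ) := mulEnd (fun x => x)
  have hX : ∀ (f : 𝓢(ℝ, ℂ)) (x : ℝ), X f x = x * f x := mulEnd_apply hasTemperateGrowth_ofReal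
  have hd : ∀ x, deriv (X w) x = w x + x * deriv w x := by
    intro x
    have h1 : HasDerivAt (fun x : ℝ => (x : ℂ)) 1 x := by
      simpa using (hasDerivAt_id x).ofReal_comp
    have h2 := h1.mul (w.hasDerivAt x)
    have h3 : (⇑(X w) : ℝ → ℂ) = (fun x : ℝ => (x : ℂ)) * ⇑w := by ext z; simp [hX]
    rw [h3, h2.deriv]; ring
  have parts := integral_bilinear_deriv_right_eq_neg_left v (X w)
    ((ContinuousLinearMap.mul ℝ ℂ).comp (Complex.conjCLE : ℂ →L[ℝ] ℂ))
  simp only [ContinuousLinearMap.comp_apply, ContinuousLinearMap.mul_apply', hd, hX] at parts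
  have e1 : ∀ x, (starRingEnd ℂ) (dilationGen v x) * w x = Complex.I *
      ((starRingEnd ℂ) (deriv v x) * (x * w x)) +
      Complex.I / 2 * ((starRingEnd ℂ) (v x) * w x) := by
    intro x; rw [dilationGen_apply]; simp [map_ofNat]; ring
  have e2 : ∀ x, (starRingEnd ℂ) (v x) * dilationGen w x = -Complex.I *
      ((starRingEnd ℂ) (v x) * (w x + x * deriv w x)) +
      Complex.I / 2 * ((starRingEnd ℂ) (v x) * w x) := by
    intro x; rw [dilationGen_apply]; ring
  have i0 := integrable_conj_mul v w
  have i1 : Integrable fun x : ℝ => (starRingEnd ℂ) (deriv v x) * (x * w x) := by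
    refine (integrable_conj_mul (derivEnd v) (X w)).congr (Filter.Eventually.of_forall fun x => ?_)
    simp [hX, derivEnd_apply]
  have i2 : Integrable fun x : ℝ => (starRingEnd ℂ) (v x) * (w x + x * deriv w x) := by
    refine (integrable_conj_mul v (derivEnd (X w))).congr (Filter.Eventually.of_forall fun x => ?_)
    simp [hd, derivEnd_apply]
  simp_rw [e1, e2]
  rw [integral_add (i1.const_mul _) (i0.const_mul _), integral_add (i2.const_mul _) (i0.const_mul _),
    integral_const_mul, integral_const_mul, integral_const_mul]
  have parts' : ∫ x : ℝ, (starRingEnd ℂ) (v x) * (w x + x * deriv w x) =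
    -∫ x : ℝ, (starRingEnd ℂ) (deriv v x) * (x * w x) := parts
  rw [parts']; ring

/-- Real polynomials in the generator of dilations are symmetric. -/
theorem integral_conj_aeval_mul (p : ℝ[X]) (v w : 𝓢(ℝ, ℂ)) :
    ∫ x, (starRingEnd ℂ) (Polynomial.aeval dilationGen p v x) * w x =
      ∫ x, (starRingEnd ℂ) (v x) * Polynomial.aeval dilationGen p w x := by
  simp_rw [← inner_toLp_eq, ← toLpCLM_apply (𝕜 := ℂ)]
  have base : ∀ v w, inner ℂ (toLpCLM ℂ ℂ 2 volume (dilationGen v)) (toLpCLM ℂ ℂ 2 volume w) =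
      inner ℂ (toLpCLM ℂ ℂ 2 volume v) (toLpCLM ℂ ℂ 2 volume (dilationGen w)) := by
    intro v w
    simpa only [toLpCLM_apply, inner_toLp_eq] using integral_conj_dilationGen_mul v w
  induction p using Polynomial.induction_on' with
  | add p q hp hq => simp only [map_add, LinearMap.add_apply, inner_add_left, inner_add_right, hp, hq]
  | monomial n c =>
    have key : ∀ v w, inner ℂ (toLpCLM ℂ ℂ 2 volume ((dilationGen ^ n) v)) (toLpCLM ℂ ℂ 2 volume w) =
        inner ℂ (toLpCLM ℂ ℂ 2 volume v) (toLpCLM ℂ ℂ 2 volume ((dilationGen ^ n) w)) := by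
      induction n with
      | zero => simp
      | succ n ih =>
        intro v w
        rw [pow_succ, Module.End.mul_apply, ih, base, ← Module.End.mul_apply, ← pow_succ', pow_succ]
    have hc : ∀ u : 𝓢(ℝ, ℂ), (algebraMap ℝ (Module.End ℂ 𝓢(ℝ, ℂ)) c) u = (c : ℂ) • u := by
      intro u
      ext x
      simp [Module.algebraMap_end_apply]
    simp only [Polynomial.aeval_monomial, Module.End.mul_apply, hc, map_smul, inner_smul_left,
      inner_smul_right, key, Complex.conj_ofReal]

end SchwartzMap

/-! ### Sectors of fixed frequency in the model space -/

/-- The measure on the fundamental domain. -/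
abbrev modelMeasure : Measure (ℝ × ℝ) :=
  (volume : Measure (ℝ × ℝ)).restrict (Ioc (0 : ℝ) 1 ×ˢ (univ : Set ℝ))

theorem modelMeasure_eq : modelMeasure =
    ((volume : Measure ℝ).restrict (Ioc 0 1)).prod (volume : Measure ℝ) := by
  rw [modelMeasure, Measure.volume_eq_prod, ← Measure.prod_restrict, Measure.restrict_univ]

/-- The function `e^{iks} v(x)`. -/
def sectorFun (k : ℝ) (v : ℝ → ℂ) (s x : ℝ) : ℂ := Complex.exp (Complex.I * (k * s : ℝ)) * v x

theorem norm_sectorFun (k : ℝ) (v : ℝ → ℂ) (s x : ℝ) : ‖sectorFun k v s x‖ = ‖v x‖ := by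
  rw [sectorFun, norm_mul, mul_comm Complex.I, Complex.norm_exp_ofReal_mul_I, one_mul]

theorem memLp_sectorFun (k : ℝ) {v : ℝ → ℂ} (hv : MemLp v 2) :
    MemLp (fun p : ℝ × ℝ => sectorFun k v p.1 p.2) 2 modelMeasure := by
  rw [modelMeasure_eq]
  have h := hv.comp_snd ((volume : Measure ℝ).restrict (Ioc 0 1))
  refine h.congr_norm ?_ (Filter.Eventually.of_forall fun p => ?_)
  · refine AEStronglyMeasurable.mul (Continuous.aestronglyMeasurable (by fun_prop)) h.1
  · exact (norm_sectorFun k v p.1 p.2).symm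

/-- The class of `e^{iks} v(x)` in `L²(𝕋 × ℝ)`. -/
def sector (k : ℝ) (v : ℝ → ℂ) (hv : MemLp v 2) : ModelL2 := (memLp_sectorFun k hv).toLp

theorem represents_sector (k : ℝ) (v : ℝ → ℂ) (hv : MemLp v 2) :
    Represents (sector k v hv) (sectorFun k v) :=
  (memLp_sectorFun k hv).coeFn_toLp

theorem Represents.unique {f g : ModelL2} {u : ℝ → ℝ → ℂ} (hf : Represents f u)
    (hg : Represents g u) : f = g :=
  Lp.ext (hf.trans hg.symm)

theorem ae_modelMeasure_of_ae {p : ℝ → Prop} (h : ∀ᵐ x : ℝ, p x) :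
    ∀ᵐ z ∂modelMeasure, p z.2 := by
  rw [modelMeasure_eq]
  exact Measure.quasiMeasurePreserving_snd.ae h

theorem Represents.congr_sectorFun {f : ModelL2} {k : ℝ} {v w : ℝ → ℂ}
    (hf : Represents f (sectorFun k v)) (h : v =ᵐ[volume] w) : Represents f (sectorFun k w) := by
  refine hf.trans ?_
  filter_upwards [ae_modelMeasure_of_ae h] with z hz
  simp [sectorFun, hz]

/-- Fubini on the fundamental domain: the s-integral sees only the frequencies, the x-integral only
the profiles. -/
theorem inner_of_represents {f g : ModelL2} {k k' : ℝ} {v w : ℝ → ℂ}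
    (hf : Represents f (sectorFun k v)) (hg : Represents g (sectorFun k' w)) :
    inner ℂ f g = (∫ s : ℝ in Ioc 0 1, Complex.exp (Complex.I * ((k' - k) * s : ℝ))) *
      ∫ x : ℝ, (starRingEnd ℂ) (v x) * w x := by
  rw [L2.inner_def, ← integral_prod_mul, ← modelMeasure_eq]
  refine integral_congr_ae ?_
  filter_upwards [hf, hg] with z hz hz'
  rw [hz, hz', RCLike.inner_apply, sectorFun, sectorFun, map_mul, ← Complex.exp_conj, mul_mul_mul_comm,
    ← Complex.exp_add, mul_comm (w z.2)]
  congr 2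
  simp
  ring

theorem inner_of_represents_same {f g : ModelL2} {k : ℝ} {v w : ℝ → ℂ}
    (hf : Represents f (sectorFun k v)) (hg : Represents g (sectorFun k w)) :
    inner ℂ f g = ∫ x : ℝ, (starRingEnd ℂ) (v x) * w x := by
  rw [inner_of_represents hf hg]
  simp

/-! ### The core of the normal form operator and its closability -/

namespace QuantumNormalForm

variable (F : QuantumNormalForm)

/-- The polynomial `p` for which the normal form operator acts as `p(A)` on `e^{iks} v(x)`, where
`A` is the generator of dilations. -/
def sectorPoly (h k : ℝ) : ℝ[X] :=
  ∑ α ∈ Finset.range (F.N + 1), Polynomial.C (F.fullCoeff h α (h * k) * h ^ α) * weylPoly α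

theorem weylOp_symbol {h : ℝ} (hh : 0 < h) (k : ℝ) (v : 𝓢(ℝ, ℂ)) (x : ℝ) :
    weylOp h (F.symbol h (h * k)) v x = Polynomial.aeval dilationGen (F.sectorPoly h k) v x :=
  weylOp_polynomial hh (F.N + 1) (fun α => F.fullCoeff h α (h * k)) v x

/-- The factor e^{iks} cancels, so the twist becomes a condition on the transverse profile alone: a
parity up to a phase. -/
theorem twisted_sectorFun_iff (h k : ℝ) (v : ℝ → ℂ) :
    F.Twisted h (sectorFun k v) ↔ ∀ x, v (((F.orientation : ℤ) : ℝ) * x) =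
      Complex.exp (Complex.I * (k + F.action / h : ℝ)) * v x := by
  have key : ∀ s x : ℝ, sectorFun k v (s + 1) x = Complex.exp (-Complex.I * (F.action / h : ℝ)) *
      sectorFun k (fun _ => Complex.exp (Complex.I * (k + F.action / h : ℝ)) * v x) s x := by
    intro s x
    simp only [sectorFun]
    rw [← mul_assoc, ← mul_assoc, ← Complex.exp_add, ← Complex.exp_add]
    congr 2
    push_cast; ring
  constructor
  · intro H x
    have := H 0 x
    rw [key 0 x] at this
    have := mul_left_cancel₀ (Complex.exp_ne_zero _) this
    simpa [sectorFun] using this.symm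
  · intro H s x
    rw [key s x]
    simp only [sectorFun, H x]

/-- The operator x d/dx commutes with x ↦ σx, so the relation v(σx) = c·w(x) is compatible with A,
and therefore with real polynomials in A. -/
theorem twisted_aeval {h k : ℝ} (p : ℝ[X]) {v : 𝓢(ℝ, ℂ)} (hv : F.Twisted h (sectorFun k v)) :
    F.Twisted h (sectorFun k (Polynomial.aeval dilationGen p v)) := by
  rw [twisted_sectorFun_iff] at hv ⊢
  set c : ℂ := Complex.exp (Complex.I * (k + F.action / h : ℝ))
  set σ : ℝ := ((F.orientation : ℤ) : ℝ)
  let G : Submodule ℝ (𝓢(ℝ, ℂ) × 𝓢(ℝ, ℂ)) :=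
    { carrier := {z | ∀ x, z.1 (σ * x) = c * z.2 x}
      add_mem' := by
        intro a b ha hb x
        simp only [Prod.fst_add, Prod.snd_add, add_apply, ha x, hb x]; ring
      zero_mem' := by intro x; simp
      smul_mem' := by
        intro r a ha x
        simp only [Prod.smul_fst, Prod.smul_snd, smul_apply, ha x, Complex.real_smul]; ring }
  refine Polynomial.aeval_mem_of_forall_mem G dilationGen dilationGen ?_ p (x := v) (y := v) hv
  rintro ⟨a, b⟩ hab x
  have hd : σ * deriv a (σ * x) = c * deriv b x := by
    have h1 : HasDerivAt (fun x => a (σ * x)) (σ • deriv a (σ * x)) x := by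
      have := (a.hasDerivAt (σ * x)).scomp x ((hasDerivAt_id x).const_mul σ)
      simpa [Function.comp_def] using this
    have h2 : HasDerivAt (fun x => a (σ * x)) (c * deriv b x) x := by
      have : (fun x => a (σ * x)) = fun x => c * b x := funext hab
      rw [this]
      exact (b.hasDerivAt x).const_mul c
    simpa using h1.unique h2
  have h0 := hab x
  simp only at h0 ⊢
  rw [dilationGen_apply, dilationGen_apply, h0]
  push_cast
  linear_combination (-Complex.I * x) * hd

/-- The generators of the core of the normal form operator. -/
theorem mem_coreGraph_generators_iff {h : ℝ} (hh : 0 < h) (fg : ModelL2 × ModelL2) :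
    (∃ (k : ℝ) (v : 𝓢(ℝ, ℂ)),
      F.Twisted h (fun s x => Complex.exp (Complex.I * (k * s : ℝ)) * v x) ∧
      Represents fg.1 (fun s x => Complex.exp (Complex.I * (k * s : ℝ)) * v x) ∧
      Represents fg.2 (fun s x => Complex.exp (Complex.I * (k * s : ℝ)) *
        weylOp h (F.symbol h (h * k)) v x)) ↔
    ∃ (k : ℝ) (v : 𝓢(ℝ, ℂ)), F.Twisted h (sectorFun k v) ∧ Represents fg.1 (sectorFun k v) ∧
      Represents fg.2 (sectorFun k (Polynomial.aeval dilationGen (F.sectorPoly h k) v)) := by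
  simp only [F.weylOp_symbol hh]
  rfl

/-- Within one frequency this is the symmetry of p(A). For different frequencies both sides vanish,
because twisted functions e^{iks}v and e^{ik's}w are orthogonal. -/
theorem coreGraph_symmetric {h : ℝ} (hh : 0 < h) :
    ∀ a ∈ F.coreGraph h, ∀ b ∈ F.coreGraph h, inner ℂ a.2 b.1 = inner ℂ a.1 b.2 := by
  intro a ha b hb
  refine Submodule.span_induction₂ (p := fun a b _ _ => inner ℂ a.2 b.1 = inner ℂ a.1 b.2)
    ?_ ?_ ?_ ?_ ?_ ?_ ?_ ha hb
  · intro a b ha hb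
    obtain ⟨k, v, ht, h1, h2⟩ := (F.mem_coreGraph_generators_iff hh a).1 ha
    obtain ⟨k', w, ht', h1', h2'⟩ := (F.mem_coreGraph_generators_iff hh b).1 hb
    by_cases hk : k = k'
    · subst hk
      rw [inner_of_represents_same h2 h1', inner_of_represents_same h1 h2',
        integral_conj_aeval_mul]
    · suffices H : ∀ v w : 𝓢(ℝ, ℂ), F.Twisted h (sectorFun k v) → F.Twisted h (sectorFun k' w) →
          (∫ s : ℝ in Ioc 0 1, Complex.exp (Complex.I * ((k' - k) * s : ℝ))) *
            ∫ x : ℝ, (starRingEnd ℂ) (v x) * w x = 0 by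
        rw [inner_of_represents h2 h1', inner_of_represents h1 h2',
          H _ _ (F.twisted_aeval _ ht) ht', H _ _ ht (F.twisted_aeval _ ht')]
      intro v w hv hw
      rw [twisted_sectorFun_iff] at hv hw
      have hσ : |((F.orientation : ℤ) : ℝ)| = 1 := by
        rcases Int.units_eq_one_or F.orientation with h | h <;> simp [h]
      -- Substituting x ↦ σx multiplies the x-integral by e^{i(k'-k)}. So it vanishes, or k' - k is
      -- a nonzero multiple of 2π and the s-integral vanishes.
      have hI : ∫ x : ℝ, (starRingEnd ℂ) (v x) * w x =
          Complex.exp (Complex.I * (k' - k : ℝ)) * ∫ x : ℝ, (starRingEnd ℂ) (v x) * w x := by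
        have := Measure.integral_comp_mul_left (fun x => (starRingEnd ℂ) (v x) * w x)
          ((F.orientation : ℤ) : ℝ)
        rw [abs_inv, hσ, inv_one, one_smul] at this
        rw [← integral_const_mul, ← this]
        congr 1
        ext x
        simp only [hv x, hw x, map_mul, ← Complex.exp_conj]
        rw [mul_mul_mul_comm, ← Complex.exp_add]
        congr 2
        simp
        ring
      rcases eq_or_ne (∫ x : ℝ, (starRingEnd ℂ) (v x) * w x) 0 with h0 | h0
      · rw [h0, mul_zero]
      · have h1 : Complex.exp (Complex.I * (k' - k : ℝ)) = 1 := by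
          have := mul_right_cancel₀ h0 ((one_mul _).trans hI)
          exact this.symm
        have hne : Complex.I * (k' - k : ℝ) ≠ 0 := by
          simp [sub_eq_zero, Ne.symm hk, Complex.ofReal_sub]
        have h2 : (∫ s : ℝ in Ioc 0 1, Complex.exp (Complex.I * ((k' - k) * s : ℝ))) = 0 := by
          rw [← intervalIntegral.integral_of_le zero_le_one]
          have : ∀ s : ℝ, Complex.exp (Complex.I * ((k' - k) * s : ℝ)) =
              Complex.exp ((Complex.I * (k' - k : ℝ)) * s) := fun s => by push_cast; ring_nf
          simp_rw [this]
          rw [integral_exp_mul_complex hne]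
          simp only [Complex.ofReal_one, mul_one, h1, Complex.ofReal_zero, mul_zero,
            Complex.exp_zero, sub_self, zero_div]
        rw [h2, zero_mul]
  · intro y _; simp
  · intro y _; simp
  · intro x y z _ _ _ hx hy; simp only [Prod.fst_add, Prod.snd_add, inner_add_left, hx, hy]
  · intro x y z _ _ _ hx hy; simp only [Prod.fst_add, Prod.snd_add, inner_add_right, hx, hy]
  · intro r x y _ _ hx; simp only [Prod.smul_fst, Prod.smul_snd, inner_smul_left, hx]
  · intro r x y _ _ hx; simp only [Prod.smul_fst, Prod.smul_snd, inner_smul_right, hx]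

/-- Schwartz space and the twist are preserved by p(A), so the operator can be applied again.
Together with symmetry this yields closability. -/
theorem coreGraph_range {h : ℝ} (hh : 0 < h) : ∀ a ∈ F.coreGraph h, ∃ c, (a.2, c) ∈ F.coreGraph h := by
  intro a ha
  induction ha using Submodule.span_induction with
  | mem a ha =>
    obtain ⟨k, v, ht, h1, h2⟩ := (F.mem_coreGraph_generators_iff hh a).1 ha
    refine ⟨sector k (Polynomial.aeval dilationGen (F.sectorPoly h k)
      (Polynomial.aeval dilationGen (F.sectorPoly h k) v)) (SchwartzMap.memLp _ 2 volume), Submodule.subset_span ?_⟩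
    exact (F.mem_coreGraph_generators_iff hh _).2
      ⟨k, _, F.twisted_aeval _ ht, h2, represents_sector _ _ (SchwartzMap.memLp _ 2 volume)⟩
  | zero => exact ⟨0, Submodule.zero_mem _⟩
  | add x y _ _ hx hy =>
    obtain ⟨c, hc⟩ := hx
    obtain ⟨d, hd⟩ := hy
    exact ⟨c + d, Submodule.add_mem _ hc hd⟩
  | smul r x _ hx =>
    obtain ⟨c, hc⟩ := hx
    exact ⟨r • c, Submodule.smul_mem _ r hc⟩

theorem mem_closure_coreGraph_inner {h : ℝ} (hh : 0 < h) {a b : ModelL2 × ModelL2}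
    (ha : a ∈ (F.coreGraph h).topologicalClosure) (hb : b ∈ (F.coreGraph h).topologicalClosure) :
    inner ℂ a.2 b.1 = inner ℂ a.1 b.2 :=
  Submodule.inner_eq_of_mem_topologicalClosure (F.coreGraph_symmetric hh) ha hb

/-- This is where closability enters: `toLinearPMap` has the intended values only when the closed
relation is a graph. -/
theorem operator_mem {h : ℝ} (hh : 0 < h) (f : (F.operator h).domain) :
    ((f : ModelL2), F.operator h f) ∈ (F.coreGraph h).topologicalClosure :=
  Submodule.mem_graph_toLinearPMap (fun _ => Submodule.snd_eq_zero_of_mem_topologicalClosure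
    (F.coreGraph_symmetric hh) (F.coreGraph_range hh)) f

theorem operator_apply_of_mem {h : ℝ} (hh : 0 < h) {f g : ModelL2}
    (hfg : (f, g) ∈ (F.coreGraph h).topologicalClosure) :
    ∃ hf : f ∈ (F.operator h).domain, F.operator h ⟨f, hf⟩ = g := by
  have hf : f ∈ (F.operator h).domain := ⟨(f, g), hfg, rfl⟩
  refine ⟨hf, ?_⟩
  have h1 := (F.coreGraph h).topologicalClosure.sub_mem (F.operator_mem hh ⟨f, hf⟩) hfg
  have h2 := Submodule.snd_eq_zero_of_mem_topologicalClosure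
    (F.coreGraph_symmetric hh) (F.coreGraph_range hh) h1 (by simp)
  exact sub_eq_zero.1 h2

end QuantumNormalForm

/-! ### The logarithmic coordinate -/

theorem integrableOn_Iio_of_even {E : Type*} [NormedAddCommGroup E] {f : ℝ → E} (hf : ∀ x, f (-x) = f x)
    (h : IntegrableOn f (Ioi (0 : ℝ))) : IntegrableOn f (Iio (0 : ℝ)) := by
  have := (Measure.measurePreserving_neg (volume : Measure ℝ)).integrableOn_comp_preimage
    (Homeomorph.neg ℝ).measurableEmbedding (f := f) (s := Iio 0)
  rw [← this]
  have h2 : (f ∘ Neg.neg) = f := funext hf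
  have h3 : (Neg.neg ⁻¹' Iio (0 : ℝ)) = Ioi 0 := by ext; simp
  rw [h2, h3]
  exact h

theorem integrable_of_even {E : Type*} [NormedAddCommGroup E] {f : ℝ → E} (hf : ∀ x, f (-x) = f x)
    (h : IntegrableOn f (Ioi (0 : ℝ))) : Integrable f := by
  rw [← integrableOn_univ, ← Iic_union_Ioi (a := (0 : ℝ))]
  exact ((integrableOn_Iic_iff_integrableOn_Iio).2 (integrableOn_Iio_of_even hf h)).union h

section LogarithmicCoordinate

variable {E : Type*} [NormedAddCommGroup E] [NormedSpace ℝ E]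

theorem integral_Ioi_eq_integral_exp_smul (g : ℝ → E) :
    ∫ x in Ioi (0 : ℝ), g x = ∫ y : ℝ, Real.exp y • g (Real.exp y) := by
  have h := integral_image_eq_integral_abs_deriv_smul (MeasurableSet.univ)
    (fun x _ => (Real.hasDerivAt_exp x).hasDerivWithinAt) (Real.exp_injective.injOn) g
  rw [image_univ, Real.range_exp] at h
  simpa [abs_of_pos (Real.exp_pos _)] using h

theorem integrableOn_Ioi_iff_integrable_exp_smul (g : ℝ → E) :
    IntegrableOn g (Ioi (0 : ℝ)) ↔ Integrable fun y : ℝ => Real.exp y • g (Real.exp y) := by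
  have h := integrableOn_image_iff_integrableOn_abs_deriv_smul (MeasurableSet.univ)
    (fun x _ => (Real.hasDerivAt_exp x).hasDerivWithinAt) (Real.exp_injective.injOn) g
  rw [image_univ, Real.range_exp] at h
  simpa [abs_of_pos (Real.exp_pos _)] using h

theorem integral_of_even {f : ℝ → E} (hf : ∀ x, f (-x) = f x)
    (h : IntegrableOn f (Ioi (0 : ℝ))) : ∫ x, f x = (2 : ℝ) • ∫ x in Ioi (0 : ℝ), f x := by
  have h1 : IntegrableOn f (Iic (0 : ℝ)) :=
    (integrableOn_Iic_iff_integrableOn_Iio).2 (integrableOn_Iio_of_even hf h)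
  rw [← setIntegral_univ, ← Iic_union_Ioi (a := (0 : ℝ)),
    setIntegral_union (Set.Iic_disjoint_Ioi le_rfl) measurableSet_Ioi h1 h, two_smul]
  congr 1
  have := integral_comp_neg_Iic (0 : ℝ) f
  simp_rw [hf, neg_zero] at this
  exact this

/-- Each y is the logarithm of the two points ±e^y, which explains the factor 2 beside the Jacobian
|x|. -/
theorem integrable_and_integral_comp_log (g : ℝ → E) (hg : Integrable g) :
    Integrable (fun x : ℝ => (2 * |x|)⁻¹ • g (Real.log x)) ∧
      ∫ x : ℝ, (2 * |x|)⁻¹ • g (Real.log x) = ∫ y, g y := by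
  have hev : ∀ x : ℝ, (2 * |-x|)⁻¹ • g (Real.log (-x)) = (2 * |x|)⁻¹ • g (Real.log x) := by
    intro x; rw [abs_neg, Real.log_neg_eq_log]
  have hsub : ∀ y : ℝ, Real.exp y • (2 * |Real.exp y|)⁻¹ • g (Real.log (Real.exp y)) =
      (2 : ℝ)⁻¹ • g y := by
    intro y
    rw [Real.log_exp, smul_smul, abs_of_pos (Real.exp_pos y), mul_inv]
    congr 1
    field_simp
  have hint : IntegrableOn (fun x : ℝ => (2 * |x|)⁻¹ • g (Real.log x)) (Ioi 0) := by
    rw [integrableOn_Ioi_iff_integrable_exp_smul]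
    simp_rw [hsub]
    exact hg.smul _
  refine ⟨integrable_of_even hev hint, ?_⟩
  rw [integral_of_even hev hint, integral_Ioi_eq_integral_exp_smul]
  simp_rw [hsub]
  rw [integral_smul, smul_smul]
  norm_num

end LogarithmicCoordinate

/-- The even function `|x|^{-1/2} w(log |x|) / √2` of a function `w` of the logarithmic
coordinate. -/
def logLift (w : ℝ → ℂ) (x : ℝ) : ℂ :=
  if x = 0 then 0 else ((Real.exp (-Real.log x / 2) / Real.sqrt 2 : ℝ) : ℂ) * w (Real.log x)

theorem logLift_of_ne {w : ℝ → ℂ} {x : ℝ} (hx : x ≠ 0) :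
    logLift w x = ((Real.exp (-Real.log x / 2) / Real.sqrt 2 : ℝ) : ℂ) * w (Real.log x) := if_neg hx

theorem logLift_neg (w : ℝ → ℂ) (x : ℝ) : logLift w (-x) = logLift w x := by
  by_cases hx : x = 0
  · simp [hx]
  · rw [logLift_of_ne hx, logLift_of_ne (neg_ne_zero.2 hx), Real.log_neg_eq_log]

theorem sq_exp_neg_log {x : ℝ} (hx : x ≠ 0) :
    (Real.exp (-Real.log x / 2) / Real.sqrt 2) ^ 2 = (2 * |x|)⁻¹ := by
  rw [div_pow, Real.sq_sqrt zero_le_two, ← Real.exp_nat_mul]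
  have : ((2 : ℕ) : ℝ) * (-Real.log x / 2) = -Real.log |x| := by rw [Real.log_abs]; push_cast; ring
  rw [this, Real.exp_neg, Real.exp_log (abs_pos.2 hx), mul_inv]
  ring

theorem memLp_logLift (w : 𝓢(ℝ, ℂ)) : MemLp (logLift w) 2 := by
  have hm : Measurable (logLift w) := by
    refine Measurable.ite (measurableSet_singleton 0) measurable_const (Measurable.mul ?_ ?_)
    · exact Complex.measurable_ofReal.comp (by fun_prop)
    · exact w.continuous.measurable.comp Real.measurable_log
  rw [memLp_two_iff_integrable_sq_norm hm.aestronglyMeasurable]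
  have h2 : Integrable fun y => ‖w y‖ ^ 2 :=
    (memLp_two_iff_integrable_sq_norm w.continuous.aestronglyMeasurable).1 (w.memLp 2 volume)
  refine (integrable_and_integral_comp_log _ h2).1.congr ?_
  filter_upwards [compl_mem_ae_iff.2 (measure_singleton (0 : ℝ))] with x hx
  rw [logLift_of_ne hx, norm_mul, mul_pow, Complex.norm_real, Real.norm_eq_abs, sq_abs,
    sq_exp_neg_log hx, smul_eq_mul]

theorem integral_conj_logLift_mul (v w : 𝓢(ℝ, ℂ)) :
    ∫ x, (starRingEnd ℂ) (logLift v x) * logLift w x = ∫ y, (starRingEnd ℂ) (v y) * w y := by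
  rw [← (integrable_and_integral_comp_log _ (integrable_conj_mul v w)).2]
  refine integral_congr_ae ?_
  filter_upwards [compl_mem_ae_iff.2 (measure_singleton (0 : ℝ))] with x hx
  rw [logLift_of_ne hx, logLift_of_ne hx, map_mul, Complex.conj_ofReal, mul_mul_mul_comm,
    ← Complex.ofReal_mul, ← sq, sq_exp_neg_log hx, Complex.real_smul]

namespace SchwartzMap

/-- The generator of dilations in the logarithmic coordinate. -/
def logGen : Module.End ℂ 𝓢(ℝ, ℂ) := -Complex.I • derivEnd

theorem logGen_apply (w : 𝓢(ℝ, ℂ)) (y : ℝ) : logGen w y = -Complex.I * deriv w y := rfl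

/-- The relation between Schwartz functions of `x` and of the logarithmic coordinate. -/
def logRel : Submodule ℝ (𝓢(ℝ, ℂ) × 𝓢(ℝ, ℂ)) where
  carrier := {z | ∀ x : ℝ, x ≠ 0 → z.1 x = logLift z.2 x}
  add_mem' := by
    intro a b ha hb x hx
    have ha := ha x hx
    have hb := hb x hx
    rw [logLift_of_ne hx] at ha hb ⊢
    simp only [Prod.fst_add, Prod.snd_add, add_apply, ha, hb]; ring
  zero_mem' := by intro x hx; simp [logLift]
  smul_mem' := by
    intro r a ha x hx
    have ha := ha x hx
    rw [logLift_of_ne hx] at ha ⊢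
    simp only [Prod.smul_fst, Prod.smul_snd, smul_apply, ha, Complex.real_smul]; ring

/-- The derivative of the weight |x|^{-1/2} cancels the summand 1/2 in A, leaving -i d/dy. The
derivative of `Real.log` is 1/x on both half-lines, so no case distinction by sign is needed. -/
theorem logRel_gen : ∀ z ∈ logRel, (dilationGen z.1, logGen z.2) ∈ logRel := by
  rintro ⟨v, w⟩ h x hx
  have h1 : HasDerivAt (fun x : ℝ => Real.exp (-Real.log x / 2) / Real.sqrt 2)
      (Real.exp (-Real.log x / 2) * (-x⁻¹ / 2) / Real.sqrt 2) x :=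
    (((Real.hasDerivAt_log hx).neg.div_const 2).exp).div_const _
  have h2 : HasDerivAt (fun x : ℝ => w (Real.log x)) (x⁻¹ • deriv w (Real.log x)) x :=
    (w.hasDerivAt (Real.log x)).scomp x (Real.hasDerivAt_log hx)
  have h3 := h1.ofReal_comp.mul h2
  have h4 : (⇑v : ℝ → ℂ) =ᶠ[nhds x] (fun x => ((Real.exp (-Real.log x / 2) / Real.sqrt 2 : ℝ) : ℂ)) *
      fun x => w (Real.log x) := by
    filter_upwards [isOpen_ne.mem_nhds hx] with z hz
    exact (h z hz).trans (logLift_of_ne hz)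
  have h5 := h4.deriv_eq.trans h3.deriv
  have h6 : v x = _ := (h x hx).trans (logLift_of_ne hx)
  have hxc : (x : ℂ) ≠ 0 := Complex.ofReal_ne_zero.2 hx
  change dilationGen v x = logLift (logGen w) x
  rw [dilationGen_apply, h5, h6, logLift_of_ne hx, logGen_apply, Complex.real_smul]
  push_cast
  field_simp
  ring

theorem aeval_logRel (p : ℝ[X]) {v w : 𝓢(ℝ, ℂ)} (h : (v, w) ∈ logRel) :
    (Polynomial.aeval dilationGen p v, Polynomial.aeval logGen p w) ∈ logRel :=
  Polynomial.aeval_mem_of_forall_mem logRel _ _ logRel_gen p h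

/-- The lift of a compactly supported smooth function is a Schwartz function. -/
theorem exists_logRel_of_hasCompactSupport (w : 𝓢(ℝ, ℂ)) (hw : HasCompactSupport w) :
    ∃ v : 𝓢(ℝ, ℂ), (∀ x, v x = logLift w x) := by
  obtain ⟨R, hR⟩ := hw.isBounded.subset_closedBall (0 : ℝ)
  have hz : ∀ y : ℝ, R < |y| → w y = 0 := by
    intro y hy
    by_contra hne
    have := hR (subset_tsupport _ (Function.mem_support.2 hne))
    rw [mem_closedBall_zero_iff, Real.norm_eq_abs] at this
    linarith
  have hcs : HasCompactSupport (logLift w) := by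
    refine HasCompactSupport.of_support_subset_isCompact
      (isCompact_Icc (a := -Real.exp R) (b := Real.exp R)) ?_
    intro x hx
    by_contra hne
    have hx0 : x ≠ 0 := by rintro rfl; simp [logLift] at hx
    have : Real.exp R < |x| := by
      rw [mem_Icc, ← abs_le] at hne; exact not_le.1 hne
    have h1 : R < Real.log x := by
      rw [← Real.log_abs]; exact (Real.lt_log_iff_exp_lt (abs_pos.2 hx0)).2 this
    exact hx (by rw [logLift_of_ne hx0, hz _ (h1.trans_le (le_abs_self _)), mul_zero])
  have hsm : ContDiff ℝ ∞ (logLift w) := by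
    rw [contDiff_iff_contDiffAt]
    intro x
    by_cases hx : x = 0
    · subst hx
      -- For 0 < |x| < e^{-R} the logarithm lies outside the support of w. At x = 0 itself the
      -- prescribed value 0 of `logLift` matters, since `Real.log 0 = 0` would give a multiple of
      -- w(0).
      have : logLift w =ᶠ[nhds 0] fun _ => 0 := by
        filter_upwards [Metric.ball_mem_nhds (0 : ℝ) (Real.exp_pos (-R))] with z hz'
        by_cases hz0 : z = 0
        · simp [logLift, hz0]
        · rw [mem_ball_zero_iff, Real.norm_eq_abs] at hz'
          have h1 : Real.log z < -R := by
            rw [← Real.log_abs]; exact (Real.log_lt_iff_lt_exp (abs_pos.2 hz0)).2 hz'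
          rw [logLift_of_ne hz0, hz _ (by rw [lt_abs]; right; linarith), mul_zero]
      exact contDiffAt_const.congr_of_eventuallyEq this
    · have : logLift w =ᶠ[nhds x] fun x =>
          ((Real.exp (-Real.log x / 2) / Real.sqrt 2 : ℝ) : ℂ) * w (Real.log x) := by
        filter_upwards [isOpen_ne.mem_nhds hx] with z hz
        exact logLift_of_ne hz
      refine ContDiffAt.congr_of_eventuallyEq ?_ this
      have hl : ContDiffAt ℝ ∞ Real.log x := Real.contDiffAt_log.2 hx
      refine ContDiffAt.mul ?_ ?_
      · exact Complex.ofRealCLM.contDiff.contDiffAt.comp x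
          ((Real.contDiff_exp.contDiffAt.comp x (hl.neg.div_const 2)).div_const _)
      · exact (w.smooth ⊤).contDiffAt.comp x hl
  exact ⟨hcs.toSchwartzMap hsm, fun x => rfl⟩

theorem hasTemperateGrowth_comp_mul (η : 𝓢(ℝ, ℂ)) (c : ℝ) :
    (fun y : ℝ => η (c * y)).HasTemperateGrowth := by
  have h : (fun y : ℝ => c * y).HasTemperateGrowth :=
    (c • ContinuousLinearMap.id ℝ ℝ).hasTemperateGrowth
  exact η.hasTemperateGrowth.comp h

/-- Multiplication by cutoffs of increasing width converges together with all derivatives. -/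
theorem tendsto_derivEnd_pow_cutoff (n : ℕ) (η w : 𝓢(ℝ, ℂ)) :
    Filter.Tendsto (fun m : ℕ => toLpCLM ℂ ℂ 2 volume
      ((derivEnd ^ n) (mulEnd (fun y => η ((1 / (m + 1) : ℝ) * y)) w))) Filter.atTop
      (nhds (η 0 • toLpCLM ℂ ℂ 2 volume ((derivEnd ^ n) w))) := by
  have hlim : Filter.Tendsto (fun m : ℕ => (1 / (m + 1) : ℝ)) Filter.atTop (nhds 0) :=
    tendsto_one_div_add_atTop_nhds_zero_nat
  induction n generalizing η w with
  | zero =>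
    -- A Lipschitz bound for η: the difference η(y/(m+1)) - η(0) costs |y|/(m+1), and the factor |y|
    -- is absorbed by the Schwartz function w.
    obtain ⟨L, hL⟩ : ∃ L : ℝ, ∀ y, ‖η y - η 0‖ ≤ L * |y| := by
      refine ⟨SchwartzMap.seminorm ℂ 0 0 (derivEnd η), fun y => ?_⟩
      have := Convex.norm_image_sub_le_of_norm_deriv_le (f := η) (s := univ) (x := 0) (y := y)
        (C := SchwartzMap.seminorm ℂ 0 0 (derivEnd η)) (fun x _ => η.differentiableAt)
        (fun x _ => norm_le_seminorm ℂ (derivEnd η) x) convex_univ (mem_univ _) (mem_univ _)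
      simpa using this
    set X : 𝓢(ℝ, ℂ) := mulEnd (fun x => x) w
    rw [tendsto_iff_norm_sub_tendsto_zero]
    refine squeeze_zero (fun _ => norm_nonneg _) (g := fun m : ℕ => (L * (1 / (m + 1) : ℝ)) *
      ‖X.toLp 2 volume‖) (fun m => ?_) ?_
    · rw [← map_smul, ← map_sub, toLpCLM_apply]
      refine Lp.norm_le_mul_norm_of_ae_le_mul ?_
      filter_upwards [coeFn_toLp X 2 volume, coeFn_toLp ((derivEnd ^ 0) (mulEnd (fun y => η
        ((1 / (m + 1) : ℝ) * y)) w) - η 0 • (derivEnd ^ 0) w) 2 volume] with y h1 h2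
      rw [h1, h2]
      simp only [pow_zero, Module.End.one_apply, sub_apply, smul_apply, smul_eq_mul, X,
        mulEnd_apply (hasTemperateGrowth_comp_mul η _), mulEnd_apply hasTemperateGrowth_ofReal]
      rw [← sub_mul, norm_mul, norm_mul, Complex.norm_real, Real.norm_eq_abs, ← mul_assoc]
      refine mul_le_mul_of_nonneg_right ((hL _).trans_eq ?_) (norm_nonneg _)
      rw [abs_mul, abs_of_pos (by positivity : (0 : ℝ) < 1 / (m + 1)), mul_assoc]
    · simpa using (hlim.const_mul L).mul_const ‖X.toLp 2 volume‖
  | succ n ih =>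
    -- Differentiating the cutoff brings out 1/(m+1) and replaces η by η'. The induction runs over
    -- all η for this reason: the new term converges, and its prefactor tends to zero.
    have hd : ∀ m : ℕ, derivEnd (mulEnd (fun y => η ((1 / (m + 1) : ℝ) * y)) w) =
        mulEnd (fun y => η ((1 / (m + 1) : ℝ) * y)) (derivEnd w) + ((1 / (m + 1) : ℝ) : ℂ) •
        mulEnd (fun y => derivEnd η ((1 / (m + 1) : ℝ) * y)) w := by
      intro m
      ext y
      have h1 : HasDerivAt (fun y : ℝ => η ((1 / (m + 1) : ℝ) * y))
          ((1 / (m + 1) : ℝ) • deriv η ((1 / (m + 1) : ℝ) * y)) y := by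
        have := (η.hasDerivAt ((1 / (m + 1) : ℝ) * y)).scomp y
          ((hasDerivAt_id y).const_mul (1 / (m + 1) : ℝ))
        simpa only [mul_one, Function.comp_def, id] using this
      have h2 := h1.mul (w.hasDerivAt y)
      have h3 : (⇑(mulEnd (fun y => η ((1 / (m + 1) : ℝ) * y)) w) : ℝ → ℂ) =
          (fun y : ℝ => η ((1 / (m + 1) : ℝ) * y)) * ⇑w := by
        ext z; simp only [mulEnd_apply (hasTemperateGrowth_comp_mul η _), Pi.mul_apply]
      rw [derivEnd_apply, h3, h2.deriv, add_apply, smul_apply,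
        mulEnd_apply (hasTemperateGrowth_comp_mul η _),
        mulEnd_apply (hasTemperateGrowth_comp_mul (derivEnd η) _), derivEnd_apply, derivEnd_apply,
        Complex.real_smul, smul_eq_mul]
      ring
    have h1 := ih η (derivEnd w)
    have h2 := ((Complex.continuous_ofReal.tendsto _).comp hlim).smul (ih (derivEnd η) w)
    have h3 := h1.add h2
    simp only [Complex.ofReal_zero, zero_smul, add_zero] at h3
    simp only [pow_succ, Module.End.mul_apply, hd, map_add, map_smul]
    exact h3

theorem tendsto_aeval_cutoff (p : ℝ[X]) (η w : 𝓢(ℝ, ℂ)) :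
    Filter.Tendsto (fun m : ℕ => toLpCLM ℂ ℂ 2 volume
      (Polynomial.aeval logGen p (mulEnd (fun y => η ((1 / (m + 1) : ℝ) * y)) w))) Filter.atTop
      (nhds (η 0 • toLpCLM ℂ ℂ 2 volume (Polynomial.aeval logGen p w))) := by
  induction p using Polynomial.induction_on' with
  | add p q hp hq => simpa only [map_add, LinearMap.add_apply, smul_add] using hp.add hq
  | monomial n c =>
    have hc : ∀ u : 𝓢(ℝ, ℂ), (algebraMap ℝ (Module.End ℂ 𝓢(ℝ, ℂ)) c) u = (c : ℂ) • u := by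
      intro u
      ext x
      simp [Module.algebraMap_end_apply]
    have := (tendsto_derivEnd_pow_cutoff n η w).const_smul ((c : ℂ) * (-Complex.I) ^ n)
    simp only [Polynomial.aeval_monomial, Module.End.mul_apply, hc, logGen, smul_pow, map_smul,
      LinearMap.smul_apply]
    rw [smul_comm (η 0), smul_comm (η 0), smul_smul]
    simpa only [smul_smul] using this

end SchwartzMap

/-- The isometry from functions of the logarithmic coordinate to functions on the model space with
frequency `k`. -/
def logSector (k : ℝ) : 𝓢(ℝ, ℂ) →ₗ[ℂ] ModelL2 where
  toFun w := sector k (logLift w) (memLp_logLift w)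
  map_add' v w := by
    refine (represents_sector k _ _).unique ?_
    refine (Lp.coeFn_add _ _).trans ?_
    filter_upwards [represents_sector k _ (memLp_logLift v),
      represents_sector k _ (memLp_logLift w)] with z h1 h2
    simp only [Pi.add_apply, h1, h2, sectorFun, logLift]
    split_ifs
    · simp
    · simp only [add_apply]; ring
  map_smul' c v := by
    refine (represents_sector k _ _).unique ?_
    refine (Lp.coeFn_smul _ _).trans ?_
    filter_upwards [represents_sector k _ (memLp_logLift v)] with z h1
    simp only [Pi.smul_apply, RingHom.id_apply, h1, sectorFun, logLift, smul_eq_mul]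
    split_ifs
    · simp
    · simp only [smul_apply, smul_eq_mul]; ring

theorem represents_logSector (k : ℝ) (w : 𝓢(ℝ, ℂ)) :
    Represents (logSector k w) (sectorFun k (logLift w)) :=
  represents_sector k _ (memLp_logLift w)

theorem inner_logSector (k : ℝ) (v w : 𝓢(ℝ, ℂ)) :
    inner ℂ (logSector k v) (logSector k w) = inner ℂ (v.toLp 2 volume) (w.toLp 2 volume) := by
  rw [inner_of_represents_same (represents_logSector k v) (represents_logSector k w),
    integral_conj_logLift_mul, inner_toLp_eq]

theorem norm_logSector (k : ℝ) (w : 𝓢(ℝ, ℂ)) : ‖logSector k w‖ = ‖w.toLp 2 volume‖ := by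
  rw [@norm_eq_sqrt_re_inner ℂ, @norm_eq_sqrt_re_inner ℂ, inner_logSector]

/-- The frequencies `k` of even twisted periodic functions. -/
def QuantumNormalForm.IsFrequency (F : QuantumNormalForm) (h k : ℝ) : Prop :=
  Complex.exp (Complex.I * (k + F.action / h : ℝ)) = 1

namespace QuantumNormalForm

variable (F : QuantumNormalForm)

/-- The lift is even, hence invariant under x ↦ σx for both signs; the choice of k disposes of the
remaining phase. -/
theorem logSector_mem_coreGraph {h k : ℝ} (hh : 0 < h) (hk : F.IsFrequency h k) (w : 𝓢(ℝ, ℂ))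
    (hw : HasCompactSupport w) :
    (logSector k w, logSector k (Polynomial.aeval logGen (F.sectorPoly h k) w)) ∈
      F.coreGraph h := by
  obtain ⟨v, hv⟩ := exists_logRel_of_hasCompactSupport w hw
  have hrel : (v, w) ∈ logRel := fun x _ => hv x
  refine Submodule.subset_span ((F.mem_coreGraph_generators_iff hh _).2 ⟨k, v, ?_, ?_, ?_⟩)
  · rw [twisted_sectorFun_iff, show Complex.exp _ = 1 from hk]
    intro x
    rw [hv, hv, one_mul]
    rcases Int.units_eq_one_or F.orientation with h | h
    · simp [h]
    · simp [h, logLift_neg]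
  · have : (v : ℝ → ℂ) = logLift w := funext hv
    rw [this]
    exact represents_logSector k w
  · refine (represents_logSector k _).congr_sectorFun ?_
    filter_upwards [compl_mem_ae_iff.2 (measure_singleton (0 : ℝ))] with x hx
    exact (aeval_logRel _ hrel x hx).symm

/-- The lift of a general Schwartz function of y may be singular at x = 0 and decay too slowly in x,
so it need not belong to the core. Compactly supported cutoffs in y do, and they converge together
with their images under p(-i d/dy). -/
theorem logSector_mem_closure {h k : ℝ} (hh : 0 < h) (hk : F.IsFrequency h k) (w : 𝓢(ℝ, ℂ)) :
    (logSector k w, logSector k (Polynomial.aeval logGen (F.sectorPoly h k) w)) ∈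
      (F.coreGraph h).topologicalClosure := by
  let b : ContDiffBump (0 : ℝ) := ⟨1, 2, one_pos, one_lt_two⟩
  have hbc : HasCompactSupport fun y => (b y : ℂ) := b.hasCompactSupport.comp_left Complex.ofReal_zero
  have hbs : ContDiff ℝ ∞ fun y => (b y : ℂ) := Complex.ofRealCLM.contDiff.comp b.contDiff
  let η : 𝓢(ℝ, ℂ) := hbc.toSchwartzMap hbs
  have hη0 : η 0 = 1 := by
    change ((b 0 : ℝ) : ℂ) = 1
    rw [b.one_of_mem_closedBall (by simp [b])]; simp
  have key : ∀ p : ℝ[X], Filter.Tendsto (fun m : ℕ => logSector k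
      (Polynomial.aeval logGen p (mulEnd (fun y => η ((1 / (m + 1) : ℝ) * y)) w))) Filter.atTop
      (nhds (logSector k (Polynomial.aeval logGen p w))) := by
    intro p
    have := tendsto_aeval_cutoff p η w
    rw [hη0, one_smul, tendsto_iff_norm_sub_tendsto_zero] at this
    rw [tendsto_iff_norm_sub_tendsto_zero]
    refine this.congr fun m => ?_
    rw [← map_sub (toLpCLM ℂ ℂ 2 volume), ← map_sub (logSector k), toLpCLM_apply, norm_logSector]
  have h1 := key 1
  simp only [map_one, Module.End.one_apply] at h1
  refine mem_closure_of_tendsto (h1.prodMk_nhds (key (F.sectorPoly h k)))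
    (Filter.Eventually.of_forall fun m => F.logSector_mem_coreGraph hh hk _ ?_)
  have : (⇑(mulEnd (fun y => η ((1 / (m + 1) : ℝ) * y)) w) : ℝ → ℂ) =
      (fun y : ℝ => η ((1 / (m + 1) : ℝ) * y)) * ⇑w := by
    ext z; simp only [mulEnd_apply (hasTemperateGrowth_comp_mul η _), Pi.mul_apply]
  rw [this]
  refine HasCompactSupport.mul_right ?_
  have hpos : (1 / (m + 1) : ℝ) ≠ 0 := by positivity
  exact hbc.comp_homeomorph (Homeomorph.mulLeft₀ _ hpos)

end QuantumNormalForm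

/-! ### The spectral representation -/

namespace SchwartzMap

/-- Multiplication by the angular frequency `2πη`. -/
def freqMul : Module.End ℂ 𝓢(ℝ, ℂ) := mulEnd (fun η => ((2 * Real.pi * η : ℝ) : ℂ))

theorem hasTemperateGrowth_freq : (fun η : ℝ => ((2 * Real.pi * η : ℝ) : ℂ)).HasTemperateGrowth :=
  hasTemperateGrowth_ofReal.comp ((2 * Real.pi) • ContinuousLinearMap.id ℝ ℝ).hasTemperateGrowth

theorem freqMul_apply (f : 𝓢(ℝ, ℂ)) (η : ℝ) : freqMul f η = ((2 * Real.pi * η : ℝ) : ℂ) * f η :=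
  mulEnd_apply hasTemperateGrowth_freq f η

theorem aeval_freqMul_apply (p : ℝ[X]) (f : 𝓢(ℝ, ℂ)) (η : ℝ) :
    Polynomial.aeval freqMul p f η = ((p.eval (2 * Real.pi * η) : ℝ) : ℂ) * f η := by
  induction p using Polynomial.induction_on' with
  | add p q hp hq =>
    simp only [map_add, LinearMap.add_apply, add_apply, hp, hq, Polynomial.eval_add,
      Complex.ofReal_add]
    ring
  | monomial n c =>
    have key : (freqMul ^ n) f η = ((2 * Real.pi * η : ℝ) : ℂ) ^ n * f η := by
      induction n with
      | zero => simp
      | succ n ih => rw [pow_succ', Module.End.mul_apply, freqMul_apply, ih]; ring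
    simp only [Polynomial.aeval_monomial, Module.End.mul_apply, Module.algebraMap_end_apply,
      smul_apply, key, Polynomial.eval_monomial, Complex.real_smul]
    push_cast; ring

/-- The graph of the Fourier transform is a relation compatible with the pair (2πη, -i d/dy), so it
is compatible with polynomials in them. -/
theorem fourierInv_aeval_freqMul (p : ℝ[X]) (f : 𝓢(ℝ, ℂ)) :
    𝓕⁻ (Polynomial.aeval freqMul p f) = Polynomial.aeval logGen p (𝓕⁻ f) := by
  let G : Submodule ℝ (𝓢(ℝ, ℂ) × 𝓢(ℝ, ℂ)) :=
    { carrier := {z | 𝓕 z.2 = z.1}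
      add_mem' := by
        rintro ⟨a1, a2⟩ ⟨b1, b2⟩ ha hb
        change 𝓕 (a2 + b2) = a1 + b1
        rw [FourierTransform.fourier_add, show 𝓕 a2 = a1 from ha, show 𝓕 b2 = b1 from hb]
      zero_mem' := FourierTransform.fourier_zero
      smul_mem' := by
        rintro r ⟨a1, a2⟩ ha
        change 𝓕 (r • a2) = r • a1
        rw [FourierTransform.fourier_smul, show 𝓕 a2 = a1 from ha] }
  have hG : ∀ z ∈ G, (freqMul z.1, logGen z.2) ∈ G := by
    rintro ⟨a, b⟩ (hab : 𝓕 b = a)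
    change 𝓕 (logGen b) = freqMul a
    ext η
    rw [logGen, LinearMap.smul_apply, FourierTransform.fourier_smul, smul_apply, fourier_derivEnd,
      freqMul_apply, hab, smul_eq_mul]
    push_cast
    linear_combination (-2 * Real.pi * η * a η) * Complex.I_mul_I
  have h0 : (f, 𝓕⁻ f) ∈ G := FourierTransform.fourier_fourierInv_eq f
  have h1 : 𝓕 (Polynomial.aeval logGen p (𝓕⁻ f)) = Polynomial.aeval freqMul p f :=
    Polynomial.aeval_mem_of_forall_mem G _ _ hG p h0
  rw [← h1, FourierTransform.fourierInv_fourier_eq]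

end SchwartzMap

/-- The isometry from functions of the frequency dual to the logarithmic coordinate. -/
def spectralSector (k : ℝ) : 𝓢(ℝ, ℂ) →ₗ[ℂ] ModelL2 where
  toFun f := logSector k (𝓕⁻ f)
  map_add' f g := by rw [FourierTransform.fourierInv_add, map_add]
  map_smul' c f := by rw [FourierTransform.fourierInv_smul, map_smul]; rfl

theorem spectralSector_apply (k : ℝ) (f : 𝓢(ℝ, ℂ)) :
    spectralSector k f = logSector k (𝓕⁻ f) := rfl

theorem inner_spectralSector (k : ℝ) (f g : 𝓢(ℝ, ℂ)) :
    inner ℂ (spectralSector k f) (spectralSector k g) = ∫ η, (starRingEnd ℂ) (f η) * g η := by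
  rw [spectralSector_apply, spectralSector_apply, inner_logSector, ← inner_fourier_toL2_eq,
    FourierTransform.fourier_fourierInv_eq, FourierTransform.fourier_fourierInv_eq, inner_toLp_eq]

theorem QuantumNormalForm.spectralSector_mem_closure (F : QuantumNormalForm) {h k : ℝ} (hh : 0 < h)
    (hk : F.IsFrequency h k) (f : 𝓢(ℝ, ℂ)) :
    (spectralSector k f, spectralSector k (Polynomial.aeval freqMul (F.sectorPoly h k) f)) ∈
      (F.coreGraph h).topologicalClosure := by
  rw [spectralSector_apply, spectralSector_apply, fourierInv_aeval_freqMul]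
  exact F.logSector_mem_closure hh hk _

/-! ### The Gaussian beam in the logarithmic coordinate -/

section GaussianProfile

/-- The function `exp(βy - a e^{2y})`. -/
def expProfile (a β y : ℝ) : ℝ := Real.exp (β * y - a * Real.exp (2 * y))

theorem contDiff_expProfile (a β : ℝ) : ContDiff ℝ ∞ (expProfile a β) := by
  unfold expProfile; fun_prop

/-- Differentiation stays within the family and only raises β by 2, so bounds on all derivatives
reduce to bounds on the profiles themselves. -/
theorem deriv_expProfile (a β : ℝ) :
    deriv (expProfile a β) = fun y => β * expProfile a β y - 2 * a * expProfile a (β + 2) y := by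
  ext y
  have h1 : HasDerivAt (fun y => β * y - a * Real.exp (2 * y)) (β * 1 - a * (Real.exp (2 * y) * (2 * 1))) y :=
    ((hasDerivAt_id y).const_mul β).sub ((((hasDerivAt_id y).const_mul 2).exp).const_mul a)
  have h2 : expProfile a (β + 2) y = Real.exp (2 * y) * expProfile a β y := by
    rw [expProfile, expProfile, ← Real.exp_add]; ring_nf
  have h3 : HasDerivAt (expProfile a β) _ y := h1.exp
  rw [h3.deriv, h2, expProfile]; ring

theorem expProfile_decay {a β : ℝ} (ha : 0 < a) (hβ : 0 < β) (k : ℕ) :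
    ∃ C : ℝ, ∀ y, |y| ^ k * |expProfile a β y| ≤ C := by
  -- For y ≤ 0 the constant comes from (β|y|)^k/k! ≤ e^{β|y|}. For y ≥ 0 the bound e^{2y} ≥ 2y²
  -- leaves (β + 1)y - 2ay², whose maximum is (β + 1)²/(8a).
  refine ⟨max (k.factorial / β ^ k) (k.factorial * Real.exp ((β + 1) ^ 2 / (8 * a))), fun y => ?_⟩
  rw [abs_of_pos (show 0 < expProfile a β y from Real.exp_pos _)]
  rcases le_total y 0 with hy | hy
  · refine le_max_of_le_left ?_
    have h1 := Real.pow_div_factorial_le_exp (x := β * |y|) (by positivity) k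
    have h2 : expProfile a β y ≤ Real.exp (-(β * |y|)) := by
      rw [expProfile, abs_of_nonpos hy]
      refine Real.exp_le_exp.2 ?_
      have : 0 < a * Real.exp (2 * y) := by positivity
      linarith
    rw [div_le_iff₀ (by positivity), mul_pow] at h1
    rw [le_div_iff₀ (by positivity)]
    calc |y| ^ k * expProfile a β y * β ^ k = (β ^ k * |y| ^ k) * expProfile a β y := by ring
      _ ≤ (Real.exp (β * |y|) * k.factorial) * Real.exp (-(β * |y|)) := by gcongr; exact (Real.exp_pos _).le
      _ = k.factorial := by
        rw [mul_right_comm, ← Real.exp_add, add_neg_cancel, Real.exp_zero, one_mul]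
  · refine le_max_of_le_right ?_
    have h1 := Real.pow_div_factorial_le_exp (x := y) hy k
    rw [div_le_iff₀ (by positivity)] at h1
    rw [abs_of_nonneg hy]
    have h3 := Real.quadratic_le_exp_of_nonneg (x := 2 * y) (by positivity)
    calc y ^ k * expProfile a β y ≤ (Real.exp y * k.factorial) * expProfile a β y := by
          gcongr; exact (Real.exp_pos _).le
      _ = k.factorial * Real.exp (y + (β * y - a * Real.exp (2 * y))) := by
          rw [Real.exp_add, expProfile]; ring
      _ ≤ k.factorial * Real.exp ((β + 1) ^ 2 / (8 * a)) := by
          gcongr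
          rw [le_div_iff₀ (by positivity)]
          have h4 : a * (2 * y ^ 2) ≤ a * Real.exp (2 * y) := by
            refine mul_le_mul_of_nonneg_left ?_ ha.le
            nlinarith
          nlinarith [sq_nonneg (β + 1 - 4 * a * y), mul_le_mul_of_nonneg_left h4 ha.le]

theorem expProfile_iteratedDeriv_decay {a : ℝ} (ha : 0 < a) (k n : ℕ) {β : ℝ} (hβ : 0 < β) :
    ∃ C : ℝ, ∀ y, |y| ^ k * |iteratedDeriv n (expProfile a β) y| ≤ C := by
  induction n generalizing β with
  | zero => simpa using expProfile_decay ha hβ k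
  | succ n ih =>
    obtain ⟨C₁, h₁⟩ := ih hβ
    obtain ⟨C₂, h₂⟩ := ih (β := β + 2) (by linarith)
    refine ⟨β * C₁ + 2 * a * C₂, fun y => ?_⟩
    have hc : ∀ β' : ℝ, ContDiffAt ℝ n (expProfile a β') y := fun β' =>
      (contDiff_expProfile a β').contDiffAt.of_le (mod_cast le_top)
    rw [iteratedDeriv_succ', deriv_expProfile, iteratedDeriv_fun_sub (contDiffAt_const.mul (hc _))
      (contDiffAt_const.mul (hc _)), iteratedDeriv_const_mul_field, iteratedDeriv_const_mul_field]
    have h3 := abs_sub (β * iteratedDeriv n (expProfile a β) y)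
      (2 * a * iteratedDeriv n (expProfile a (β + 2)) y)
    rw [abs_mul, abs_mul, abs_of_pos hβ, abs_of_pos (by positivity : 0 < 2 * a)] at h3
    have h4 := mul_le_mul_of_nonneg_left h3 (by positivity : 0 ≤ |y| ^ k)
    have h5 := mul_le_mul_of_nonneg_left (h₁ y) hβ.le
    have h6 := mul_le_mul_of_nonneg_left (h₂ y) (by positivity : 0 ≤ 2 * a)
    linarith

/-- The profile `exp(βy - a e^{2y})` as a Schwartz function. -/
def expProfileSchwartz {a β : ℝ} (ha : 0 < a) (hβ : 0 < β) : 𝓢(ℝ, ℂ) :=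
  postcompCLM (𝕜 := ℝ) Complex.ofRealCLM
    { toFun := expProfile a β
      smooth' := contDiff_expProfile a β
      decay' := fun k n => by
        simpa only [norm_iteratedFDeriv_eq_norm_iteratedDeriv, Real.norm_eq_abs] using
          expProfile_iteratedDeriv_decay ha k n hβ }

theorem expProfileSchwartz_apply {a β : ℝ} (ha : 0 < a) (hβ : 0 < β) (y : ℝ) :
    expProfileSchwartz ha hβ y = (expProfile a β y : ℂ) := rfl

/-- The Gaussian `π^{-1/4} e^{-x²/2}` in the logarithmic coordinate. -/
def gaussianProfile : 𝓢(ℝ, ℂ) :=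
  ((Real.sqrt 2 * Real.pi ^ (-(1 / 4) : ℝ) : ℝ) : ℂ) •
    expProfileSchwartz (a := 1 / 2) (β := 1 / 2) (by norm_num) (by norm_num)

theorem gaussianProfile_apply (y : ℝ) : gaussianProfile y =
    ((Real.sqrt 2 * Real.pi ^ (-(1 / 4) : ℝ) * Real.exp (y / 2 - Real.exp (2 * y) / 2) : ℝ) : ℂ) := by
  rw [gaussianProfile, smul_apply, expProfileSchwartz_apply, expProfile, smul_eq_mul,
    ← Complex.ofReal_mul]
  ring_nf

/-- The Gaussian `(πh)^{-1/4} e^{-x²/(2h)}` in the logarithmic coordinate. -/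
def beamProfile (h : ℝ) : 𝓢(ℝ, ℂ) := compSubConstCLM ℂ (Real.log h / 2) gaussianProfile

/-- Rescaling x by √h is translation of y by (log h)/2; the normalization h^{-1/4} comes from the
weight |x|^{-1/2}. -/
theorem logLift_beamProfile {h : ℝ} (hh : 0 < h) {x : ℝ} (hx : x ≠ 0) : logLift (beamProfile h) x =
    (((Real.pi * h) ^ (-(1 / 4) : ℝ) * Real.exp (-x ^ 2 / (2 * h)) : ℝ) : ℂ) := by
  rw [logLift_of_ne hx, beamProfile, compSubConstCLM_apply, gaussianProfile_apply,
    ← Complex.ofReal_mul]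
  congr 1
  have h1 : Real.exp (2 * (Real.log x - Real.log h / 2)) = x ^ 2 / h := by
    have : 2 * (Real.log x - Real.log h / 2) = Real.log (x ^ 2) - Real.log h := by
      rw [Real.log_pow]; push_cast; ring
    rw [this, Real.exp_sub, Real.exp_log (by positivity), Real.exp_log hh]
  rw [h1, Real.mul_rpow Real.pi_pos.le hh.le, Real.rpow_def_of_pos hh]
  have h2 : Real.sqrt 2 ≠ 0 := by positivity
  have h3 : Real.exp (-Real.log x / 2) * Real.exp ((Real.log x - Real.log h / 2) / 2 - x ^ 2 / h / 2) =
      Real.exp (Real.log h * -(1 / 4)) * Real.exp (-x ^ 2 / (2 * h)) := by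
    rw [← Real.exp_add, ← Real.exp_add]
    congr 1
    field_simp
    ring
  calc _ = (Real.sqrt 2 / Real.sqrt 2) * Real.pi ^ (-(1 / 4) : ℝ) * (Real.exp (-Real.log x / 2) *
        Real.exp ((Real.log x - Real.log h / 2) / 2 - x ^ 2 / h / 2)) := by ring
    _ = _ := by rw [h3, div_self h2]; ring

end GaussianProfile

/-! ### The Schrödinger evolution of the beam -/

namespace QuantumNormalForm

variable (F : QuantumNormalForm)

/-- The frequency of the initial state. -/
def frequency (h : ℝ) (n : ℤ) : ℝ := 2 * Real.pi * n - F.twistAngle h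

theorem isFrequency (h : ℝ) (n : ℤ) : F.IsFrequency h (F.frequency h n) := by
  rw [IsFrequency, Complex.exp_eq_one_iff]
  -- The fractional part in the twist angle cancels that of φ/(2πh), leaving its integer part.
  refine ⟨n + ⌊F.action / (2 * Real.pi * h)⌋, ?_⟩
  have h1 : F.action / h = 2 * Real.pi * (F.action / (2 * Real.pi * h)) := by
    have := Real.pi_ne_zero
    rcases eq_or_ne h 0 with rfl | hh
    · simp
    · field_simp
  rw [frequency, twistAngle, h1, Int.fract]
  push_cast
  ring

theorem represents_initialState {h : ℝ} (hh : 0 < h) (n : ℤ) :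
    Represents (logSector (F.frequency h n) (beamProfile h)) (F.initialState h n) := by
  refine (represents_logSector _ _).trans ?_
  have : ∀ᵐ x : ℝ, x ≠ 0 := compl_mem_ae_iff.2 (measure_singleton (0 : ℝ))
  filter_upwards [ae_modelMeasure_of_ae this] with z hz
  rw [sectorFun, logLift_beamProfile hh hz]
  rfl

end QuantumNormalForm

namespace SchwartzMap

theorem hasTemperateGrowth_exp_mul_I :
    (fun x : ℝ => Complex.exp (x * Complex.I)).HasTemperateGrowth := by
  have hcd : ContDiff ℝ ∞ fun x : ℝ => Complex.exp (x * Complex.I) :=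
    Complex.contDiff_exp.comp (Complex.ofRealCLM.contDiff.mul contDiff_const)
  have hit : ∀ n : ℕ, iteratedDeriv n (fun x : ℝ => Complex.exp (x * Complex.I)) =
      fun x : ℝ => Complex.I ^ n * Complex.exp (x * Complex.I) := by
    intro n
    induction n with
    | zero => simp
    | succ n ih =>
      rw [iteratedDeriv_succ, ih]
      ext x
      have : HasDerivAt (fun x : ℝ => Complex.exp (x * Complex.I))
          (Complex.exp (x * Complex.I) * ((1 : ℝ) * Complex.I)) x :=
        (((hasDerivAt_id x).ofReal_comp).mul_const Complex.I).cexp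
      rw [(this.const_mul _).deriv]
      push_cast; ring
  refine ⟨hcd, fun n => ⟨0, 1, fun x => ?_⟩⟩
  rw [norm_iteratedFDeriv_eq_norm_iteratedDeriv, hit, norm_mul, norm_pow, Complex.norm_I,
    Complex.norm_exp_ofReal_mul_I]
  simp

theorem hasTemperateGrowth_polynomial (p : ℝ[X]) : (fun x : ℝ => p.eval x).HasTemperateGrowth := by
  induction p using Polynomial.induction_on' with
  | add p q hp hq => simp only [Polynomial.eval_add]; exact hp.add hq
  | monomial n c =>
    simp only [Polynomial.eval_monomial]
    exact (Function.HasTemperateGrowth.const c).mul (Function.HasTemperateGrowth.id'.pow n)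

/-- The factor `e^{-is p(2πη)}`. -/
def phase (p : ℝ[X]) (s η : ℝ) : ℂ := Complex.exp ((-(s * p.eval (2 * Real.pi * η)) : ℝ) * Complex.I)

theorem norm_phase (p : ℝ[X]) (s η : ℝ) : ‖phase p s η‖ = 1 := Complex.norm_exp_ofReal_mul_I _

theorem phase_zero (p : ℝ[X]) (η : ℝ) : phase p 0 η = 1 := by simp [phase]

theorem conj_phase (p : ℝ[X]) (s η : ℝ) : (starRingEnd ℂ) (phase p s η) = phase p (-s) η := by
  rw [phase, phase, ← Complex.exp_conj]
  congr 1
  simp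

theorem phase_add (p : ℝ[X]) (s t η : ℝ) : phase p (s + t) η = phase p s η * phase p t η := by
  rw [phase, phase, phase, ← Complex.exp_add]
  congr 1
  push_cast; ring

theorem hasTemperateGrowth_phase (p : ℝ[X]) (s : ℝ) : (phase p s).HasTemperateGrowth := by
  have h1 : (fun η : ℝ => 2 * Real.pi * η).HasTemperateGrowth :=
    ((2 * Real.pi) • ContinuousLinearMap.id ℝ ℝ).hasTemperateGrowth
  have h2 : (fun η : ℝ => -(s * p.eval (2 * Real.pi * η))).HasTemperateGrowth := by
    have := ((Function.HasTemperateGrowth.const (E := ℝ) (-s)).mul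
      ((hasTemperateGrowth_polynomial p).comp h1))
    simpa [Function.comp_def, Pi.mul_def] using this
  exact hasTemperateGrowth_exp_mul_I.comp h2

/-- The unitary group generated by the multiplication by `p(2πη)`. -/
def phaseMul (p : ℝ[X]) (s : ℝ) : Module.End ℂ 𝓢(ℝ, ℂ) := mulEnd (phase p s)

theorem phaseMul_apply (p : ℝ[X]) (s : ℝ) (f : 𝓢(ℝ, ℂ)) (η : ℝ) :
    phaseMul p s f η = phase p s η * f η := mulEnd_apply (hasTemperateGrowth_phase p s) f η

end SchwartzMap

theorem ModelL2.real_smul_eq (r : ℝ) (f : ModelL2) : r • f = (r : ℂ) • f := by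
  refine Lp.ext ?_
  filter_upwards [Lp.coeFn_smul r f, Lp.coeFn_smul (r : ℂ) f] with z h1 h2
  rw [h1, h2]
  simp

theorem norm_spectralSector (k : ℝ) (f : 𝓢(ℝ, ℂ)) : ‖spectralSector k f‖ = ‖f.toLp 2 volume‖ := by
  rw [spectralSector_apply, norm_logSector, ← norm_fourier_toL2_eq,
    FourierTransform.fourier_fourierInv_eq]

theorem norm_spectralSector_le (k : ℝ) {f g : 𝓢(ℝ, ℂ)} {c : ℝ} (h : ∀ η, ‖f η‖ ≤ c * ‖g η‖) :
    ‖spectralSector k f‖ ≤ c * ‖spectralSector k g‖ := by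
  rw [norm_spectralSector, norm_spectralSector]
  refine Lp.norm_le_mul_norm_of_ae_le_mul ?_
  filter_upwards [coeFn_toLp f 2 volume, coeFn_toLp g 2 volume] with y h1 h2
  rw [h1, h2]
  exact h y

theorem Complex.norm_exp_mul_I_sub_one_sub_le (x : ℝ) :
    ‖Complex.exp (x * Complex.I) - 1 - x * Complex.I‖ ≤ 2 * x ^ 2 := by
  rcases le_total |x| 1 with hx | hx
  · have hn : ‖(x * Complex.I : ℂ)‖ = |x| := by simp
    have := Complex.norm_exp_sub_one_sub_id_le (x := x * Complex.I) (by rw [hn]; exact hx)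
    rw [hn, sq_abs] at this
    nlinarith [sq_nonneg x]
  · have h1 := Real.norm_exp_I_mul_ofReal_sub_one_le (x := x)
    rw [mul_comm Complex.I] at h1
    have h2 := norm_sub_le (Complex.exp (x * Complex.I) - 1) (x * Complex.I)
    have hn : ‖(x * Complex.I : ℂ)‖ = |x| := by simp
    rw [hn] at h2
    rw [Real.norm_eq_abs] at h1
    nlinarith [sq_abs x]

/-- The Taylor remainder of the phase is at most 2δ²p(2πη)². Since p²f is again Schwartz, the
difference quotient converges in L², although p is unbounded. -/
theorem hasDerivAt_spectralSector_phaseMul (k : ℝ) (p : ℝ[X]) (f : 𝓢(ℝ, ℂ)) (s : ℝ) :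
    HasDerivAt (fun s => spectralSector k (phaseMul p s f))
      (-Complex.I • spectralSector k (Polynomial.aeval freqMul p (phaseMul p s f))) s := by
  rw [hasDerivAt_iff_isLittleO_nhds_zero]
  refine (Asymptotics.IsBigO.of_bound
    (2 * ‖spectralSector k (Polynomial.aeval freqMul (p * p) f)‖)
    (Filter.Eventually.of_forall fun δ => ?_)).trans_isLittleO
    (Asymptotics.isLittleO_pow_id (n := 2) one_lt_two)
  have hcoe : ∀ g : 𝓢(ℝ, ℂ), δ • spectralSector k g = spectralSector k ((δ : ℂ) • g) := by
    intro g; rw [map_smul, ModelL2.real_smul_eq]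
  rw [← map_smul, hcoe, ← map_sub, ← map_sub, mul_right_comm]
  refine (norm_spectralSector_le k (c := 2 * ‖δ ^ 2‖)
    (g := Polynomial.aeval freqMul (p * p) f) fun η => ?_)
  simp only [sub_apply, smul_apply, aeval_freqMul_apply, phaseMul_apply, phase_add, smul_eq_mul,
    Polynomial.eval_mul]
  set P : ℝ := p.eval (2 * Real.pi * η)
  have h1 : phase p δ η = Complex.exp ((-(δ * P) : ℝ) * Complex.I) := rfl
  have h2 : phase p s η * phase p δ η * f η - phase p s η * f η -
      δ * (-Complex.I * (P * (phase p s η * f η))) =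
      phase p s η * ((Complex.exp ((-(δ * P) : ℝ) * Complex.I) - 1 - (-(δ * P) : ℝ) * Complex.I) *
        f η) := by
    rw [h1]; push_cast; ring
  rw [h2, norm_mul, norm_phase, one_mul, norm_mul, norm_mul, ← mul_assoc]
  refine mul_le_mul_of_nonneg_right ((Complex.norm_exp_mul_I_sub_one_sub_le _).trans_eq ?_)
    (norm_nonneg _)
  rw [Complex.norm_real, Real.norm_eq_abs, Real.norm_eq_abs, abs_of_nonneg (sq_nonneg δ),
    abs_of_nonneg (mul_self_nonneg P)]
  ring

namespace QuantumNormalForm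

variable (F : QuantumNormalForm)

/-- The spectral representation of the evolved state. -/
def evolution (h : ℝ) (n : ℤ) (t : ℝ) : ModelL2 :=
  spectralSector (F.frequency h n)
    (phaseMul (F.sectorPoly h (F.frequency h n)) (t / h) (𝓕 (beamProfile h)))

/-- The spectral representation of the operator applied to the evolved state. -/
def operatorEvolution (h : ℝ) (n : ℤ) (t : ℝ) : ModelL2 :=
  spectralSector (F.frequency h n) (Polynomial.aeval freqMul (F.sectorPoly h (F.frequency h n))
    (phaseMul (F.sectorPoly h (F.frequency h n)) (t / h) (𝓕 (beamProfile h))))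

theorem evolution_mem_closure {h : ℝ} (hh : 0 < h) (n : ℤ) (t : ℝ) :
    (F.evolution h n t, F.operatorEvolution h n t) ∈ (F.coreGraph h).topologicalClosure :=
  F.spectralSector_mem_closure hh (F.isFrequency h n) _

theorem hasDerivAt_evolution (h : ℝ) (n : ℤ) (t : ℝ) :
    HasDerivAt (F.evolution h n) ((-Complex.I / (h : ℂ)) • F.operatorEvolution h n t) t := by
  have h1 := (hasDerivAt_spectralSector_phaseMul (F.frequency h n)
    (F.sectorPoly h (F.frequency h n)) (𝓕 (beamProfile h)) (t / h)).scomp t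
    ((hasDerivAt_id t).div_const h)
  have h2 : (-Complex.I / (h : ℂ)) • F.operatorEvolution h n t =
      (1 / h : ℝ) • (-Complex.I • F.operatorEvolution h n t) := by
    rw [ModelL2.real_smul_eq, smul_smul]
    congr 1
    push_cast; ring
  rw [h2]
  exact h1

theorem isEvolution_evolution {h : ℝ} (hh : 0 < h) (n : ℤ) :
    F.IsEvolution h n (F.evolution h n) := by
  constructor
  · have h0 : F.evolution h n 0 = logSector (F.frequency h n) (beamProfile h) := by
      have : phaseMul (F.sectorPoly h (F.frequency h n)) (0 / h) (𝓕 (beamProfile h)) =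
          𝓕 (beamProfile h) := by
        ext η; rw [phaseMul_apply, zero_div, phase_zero, one_mul]
      rw [evolution, this, spectralSector_apply, FourierTransform.fourierInv_fourier_eq]
    rw [h0]
    exact F.represents_initialState hh n
  · intro t
    obtain ⟨ht, hop⟩ := F.operator_apply_of_mem hh (F.evolution_mem_closure hh n t)
    refine ⟨ht, ?_⟩
    rw [hop]
    exact F.hasDerivAt_evolution h n t

/-- The difference of two solutions solves the equation as well, and symmetry on the closed graph
makes its norm constant in time. Self-adjointness is not needed. -/
theorem IsEvolution.eq {h : ℝ} (hh : 0 < h) {n : ℤ} {ψ φ : ℝ → ModelL2}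
    (hψ : F.IsEvolution h n ψ) (hφ : F.IsEvolution h n φ) : ψ = φ := by
  have h0 : ψ 0 = φ 0 := hψ.1.unique hφ.1
  have key : ∀ t, ∃ g, (ψ t - φ t, g) ∈ (F.coreGraph h).topologicalClosure ∧
      HasDerivAt (fun t => ψ t - φ t) ((-Complex.I / (h : ℂ)) • g) t := by
    intro t
    obtain ⟨h1, h2⟩ := hψ.2 t
    obtain ⟨h3, h4⟩ := hφ.2 t
    refine ⟨F.operator h ⟨ψ t, h1⟩ - F.operator h ⟨φ t, h3⟩, ?_, ?_⟩
    · exact Submodule.sub_mem _ (F.operator_mem hh ⟨ψ t, h1⟩) (F.operator_mem hh ⟨φ t, h3⟩)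
    · rw [smul_sub]; exact h2.sub h4
  have hd : ∀ t, HasDerivAt (fun t => inner ℂ (ψ t - φ t) (ψ t - φ t)) 0 t := by
    intro t
    obtain ⟨g, hg, hder⟩ := key t
    have h5 := hder.inner ℂ hder
    have h6 : inner ℂ g (ψ t - φ t) = inner ℂ (ψ t - φ t) g := F.mem_closure_coreGraph_inner hh hg hg
    convert! h5 using 1
    rw [inner_smul_left, inner_smul_right, h6]
    simp
    ring
  ext1 t
  have hc := is_const_of_deriv_eq_zero (fun t => (hd t).differentiableAt) (fun t => (hd t).deriv) t 0
  simp only [h0, sub_self, inner_zero_left] at hc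
  exact sub_eq_zero.1 (inner_self_eq_zero.1 hc)

theorem existsUnique_evolution {h : ℝ} (hh : 0 < h) (n : ℤ) :
    ∃! ψ : ℝ → ModelL2, F.IsEvolution h n ψ :=
  ⟨F.evolution h n, F.isEvolution_evolution hh n,
    fun _ hψ => IsEvolution.eq F hh hψ (F.isEvolution_evolution hh n)⟩

theorem IsEvolution.eq_evolution {h : ℝ} (hh : 0 < h) {n : ℤ} {ψ : ℝ → ModelL2}
    (hψ : F.IsEvolution h n ψ) : ψ = F.evolution h n :=
  IsEvolution.eq F hh hψ (F.isEvolution_evolution hh n)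

end QuantumNormalForm

/-! ### The beta integral behind S₁ -/

section BetaIntegral

theorem Real.log_sigmoid_add (z : ℝ) :
    Real.log (Real.sigmoid (2 * z)) + Real.log (1 - Real.sigmoid (2 * z)) =
      -2 * Real.log (2 * Real.cosh z) := by
  have h0 := Real.sigmoid_pos (2 * z)
  have h1 : 0 < 1 - Real.sigmoid (2 * z) := sub_pos.2 (Real.sigmoid_lt_one _)
  have hc : 0 < 2 * Real.cosh z := by have := Real.cosh_pos z; positivity
  rw [← Real.log_mul h0.ne' h1.ne']
  have : Real.sigmoid (2 * z) * (1 - Real.sigmoid (2 * z)) = ((2 * Real.cosh z) ^ 2)⁻¹ := by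
    rw [← Real.sigmoid_neg, Real.sigmoid_def, Real.sigmoid_def, ← mul_inv]
    congr 1
    rw [Real.cosh_eq]
    have e1 : Real.exp (-(2 * z)) = Real.exp (-z) ^ 2 := by
      rw [← Real.exp_nat_mul]; congr 1; push_cast; ring
    have e2 : Real.exp (- -(2 * z)) = Real.exp z ^ 2 := by
      rw [← Real.exp_nat_mul]; congr 1; push_cast; ring
    have e3 : Real.exp z * Real.exp (-z) = 1 := by rw [← Real.exp_add, add_neg_cancel, Real.exp_zero]
    rw [e1, e2]
    linear_combination (Real.exp z * Real.exp (-z) - 1) * e3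
  rw [this, Real.log_inv, Real.log_pow]
  push_cast; ring

theorem Real.log_sigmoid_sub (z : ℝ) :
    Real.log (Real.sigmoid z) - Real.log (1 - Real.sigmoid z) = z := by
  have h0 := Real.sigmoid_pos z
  rw [← Real.sigmoid_neg, ← Real.sigmoid_mul_rexp_neg, Real.log_mul h0.ne' (Real.exp_ne_zero _),
    Real.log_exp]
  ring

theorem Complex.re_quarter_add_I_mul (x : ℝ) : (1 / 4 + Complex.I * (x : ℂ)).re = 1 / 4 := by
  simp

/-- The Fourier transform of `(cosh λs)^{-1/2}`. -/
theorem integral_exp_div_sqrt_cosh {lam : ℝ} (hlam : 0 < lam) (θ : ℝ) :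
    ∫ s : ℝ, Complex.exp ((θ * s : ℝ) * Complex.I) * ((Real.sqrt (Real.cosh (lam * s)))⁻¹ : ℝ) =
      (S1 lam θ : ℂ) := by
  set u : ℂ := 1 / 4 + Complex.I * (θ / (2 * lam) : ℝ) with hu
  have hconj : (starRingEnd ℂ) u = 1 / 4 - Complex.I * (θ / (2 * lam) : ℝ) := by
    rw [hu]; simp [map_ofNat]; ring
  -- As u + ū = 1/2, the identity Γ(u)Γ(ū) = Γ(1/2)B(u, ū) expresses |Γ(u)|² as √π times a beta
  -- integral.
  have hbeta := Complex.Gamma_mul_Gamma_eq_betaIntegral (s := u) (t := (starRingEnd ℂ) u)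
    (by rw [hu, Complex.re_quarter_add_I_mul]; norm_num)
    (by rw [Complex.conj_re, hu, Complex.re_quarter_add_I_mul]; norm_num)
  have hsum : u + (starRingEnd ℂ) u = 1 / 2 := by rw [hconj, hu]; ring
  rw [hsum, Complex.Gamma_one_half_eq, Complex.Gamma_conj, Complex.mul_conj,
    Complex.normSq_eq_norm_sq] at hbeta
  have hder : ∀ s ∈ (univ : Set ℝ), HasDerivWithinAt (fun s => Real.sigmoid (2 * (lam * s)))
      (Real.sigmoid (2 * (lam * s)) * (1 - Real.sigmoid (2 * (lam * s))) * (2 * (lam * 1))) univ s :=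
    fun s _ => ((Real.hasDerivAt_sigmoid _).comp s
      (((hasDerivAt_id s).const_mul lam).const_mul 2)).hasDerivWithinAt
  have hinj : InjOn (fun s => Real.sigmoid (2 * (lam * s))) univ := by
    intro s _ t _ hst
    have := Real.sigmoid_injective hst
    simpa [hlam.ne'] using this
  have himg : (fun s => Real.sigmoid (2 * (lam * s))) '' univ = Ioo 0 1 := by
    rw [image_univ, ← Real.range_sigmoid]
    ext x
    constructor
    · rintro ⟨s, rfl⟩; exact ⟨_, rfl⟩
    · rintro ⟨s, rfl⟩
      refine ⟨s / (2 * lam), ?_⟩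
      simp only
      congr 1; field_simp
  -- The substitution x = sigmoid(2λs) has x(1 - x) = (2 cosh λs)^{-2} and log(x/(1 - x)) = 2λs. The
  -- real parts 1/4 of the exponents produce (2 cosh λs)^{-1/2}, the imaginary parts e^{iθs}.
  have hsub := integral_image_eq_integral_abs_deriv_smul MeasurableSet.univ hder hinj
    (fun x : ℝ => (x : ℂ) ^ (u - 1) * (1 - (x : ℂ)) ^ ((starRingEnd ℂ) u - 1))
  rw [himg, ← integral_Ioc_eq_integral_Ioo, ← intervalIntegral.integral_of_le zero_le_one,
    Measure.restrict_univ] at hsub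
  change Complex.betaIntegral u ((starRingEnd ℂ) u) = _ at hsub
  have hint : ∀ s : ℝ, |Real.sigmoid (2 * (lam * s)) * (1 - Real.sigmoid (2 * (lam * s))) *
      (2 * (lam * 1))| • ((Real.sigmoid (2 * (lam * s)) : ℂ) ^ (u - 1) *
        (1 - (Real.sigmoid (2 * (lam * s)) : ℂ)) ^ ((starRingEnd ℂ) u - 1)) =
      ((Real.sqrt 2 * lam : ℝ) : ℂ) * (Complex.exp ((θ * s : ℝ) * Complex.I) *
        ((Real.sqrt (Real.cosh (lam * s)))⁻¹ : ℝ)) := by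
    intro s
    have h0 := Real.sigmoid_pos (2 * (lam * s))
    have h1 : 0 < 1 - Real.sigmoid (2 * (lam * s)) := sub_pos.2 (Real.sigmoid_lt_one _)
    have hA := Real.log_sigmoid_add (lam * s)
    have hB := Real.log_sigmoid_sub (2 * (lam * s))
    set a := Real.log (Real.sigmoid (2 * (lam * s))) with ha
    set b := Real.log (1 - Real.sigmoid (2 * (lam * s))) with hb
    have hc : 0 < Real.cosh (lam * s) := Real.cosh_pos _
    have ea : Real.sigmoid (2 * (lam * s)) = Real.exp a := (Real.exp_log h0).symm
    have eb : 1 - Real.sigmoid (2 * (lam * s)) = Real.exp b := (Real.exp_log h1).symm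
    have hsq : Real.exp ((a + b) / 4) = (Real.sqrt 2)⁻¹ * (Real.sqrt (Real.cosh (lam * s)))⁻¹ := by
      rw [hA, ← mul_inv, ← Real.sqrt_mul zero_le_two,
        show -2 * Real.log (2 * Real.cosh (lam * s)) / 4 = -(Real.log (2 * Real.cosh (lam * s)) / 2)
          by ring, Real.exp_neg, Real.exp_half, Real.exp_log (by positivity)]
    have hcpow : ∀ (r : ℝ) (z : ℂ), ((Real.exp r : ℝ) : ℂ) ^ z = Complex.exp (r * z) := by
      intro r z
      rw [Complex.cpow_def_of_ne_zero (Complex.ofReal_ne_zero.2 (Real.exp_ne_zero r)),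
        ← Complex.ofReal_log (Real.exp_pos r).le, Real.log_exp]
    rw [abs_of_pos (by positivity), Complex.real_smul,
      show (1 - (Real.sigmoid (2 * (lam * s)) : ℂ)) =
        ((1 - Real.sigmoid (2 * (lam * s)) : ℝ) : ℂ) by push_cast; ring, eb, ea, hcpow, hcpow]
    have hexp : Complex.exp a * Complex.exp b * (Complex.exp (a * (u - 1)) *
        Complex.exp (b * ((starRingEnd ℂ) u - 1))) =
        Complex.exp ((θ * s : ℝ) * Complex.I) * ((Real.exp ((a + b) / 4) : ℝ) : ℂ) := by
      rw [← Complex.exp_add, ← Complex.exp_add, ← Complex.exp_add, Complex.ofReal_exp,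
        ← Complex.exp_add]
      congr 1
      rw [hconj, hu]
      have hB' : (a : ℂ) - b = 2 * (lam * s) := by exact_mod_cast hB
      have hl : (lam : ℂ) ≠ 0 := Complex.ofReal_ne_zero.2 hlam.ne'
      push_cast
      have : (θ : ℂ) * s = θ / (2 * lam) * (a - b) := by rw [hB']; field_simp
      rw [this]; ring
    have h2 : ((Real.sqrt 2 : ℝ) : ℂ) ^ 2 = 2 := by
      rw [← Complex.ofReal_pow, Real.sq_sqrt zero_le_two]; simp
    have h3 : ((Real.sqrt 2 : ℝ) : ℂ) ≠ 0 := by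
      intro h; rw [h] at h2; norm_num at h2
    calc _ = 2 * lam * (Complex.exp a * Complex.exp b * (Complex.exp (a * (u - 1)) *
        Complex.exp (b * ((starRingEnd ℂ) u - 1)))) := by push_cast; ring
      _ = _ := by
        rw [hexp, hsq]
        push_cast
        field_simp
        rw [h2]; ring
  simp_rw [hint] at hsub
  rw [integral_const_mul] at hsub
  rw [hsub] at hbeta
  have hpi : (Real.pi : ℂ) ^ (1 / 2 : ℂ) = ((Real.sqrt Real.pi : ℝ) : ℂ) := by
    rw [Real.sqrt_eq_rpow, Complex.ofReal_cpow Real.pi_pos.le]; simp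
  rw [hpi] at hbeta
  have hne : ((Real.sqrt Real.pi : ℝ) : ℂ) * ((Real.sqrt 2 * lam : ℝ) : ℂ) ≠ 0 := by
    rw [← Complex.ofReal_mul]
    exact Complex.ofReal_ne_zero.2 (by positivity)
  rw [← mul_assoc, mul_comm] at hbeta
  rw [eq_div_of_mul_eq hne hbeta.symm, S1, Real.sqrt_mul zero_le_two]
  rw [← hu]
  push_cast
  ring

theorem S1_pos {q : ℝ} (hq : 0 < q) (θ : ℝ) : 0 < S1 q θ := by
  have h : Complex.Gamma (1 / 4 + Complex.I * (θ / (2 * q) : ℝ)) ≠ 0 :=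
    Complex.Gamma_ne_zero_of_re_pos (by rw [Complex.re_quarter_add_I_mul]; norm_num)
  have := norm_pos_iff.2 h
  unfold S1
  positivity

theorem continuous_S1 (q : ℝ) : Continuous (S1 q) := by
  have h : Continuous fun θ : ℝ => Complex.Gamma (1 / 4 + Complex.I * (θ / (2 * q) : ℝ)) := by
    rw [continuous_iff_continuousAt]
    intro θ
    refine ContinuousAt.comp (f := fun θ : ℝ => (1 / 4 + Complex.I * (θ / (2 * q) : ℝ) : ℂ))
      (Complex.differentiableAt_Gamma _ fun m hm => ?_).continuousAt (by fun_prop)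
    have := congrArg Complex.re hm
    rw [Complex.re_quarter_add_I_mul, Complex.neg_re, Complex.natCast_re] at this
    have hm : (0 : ℝ) ≤ m := m.cast_nonneg
    linarith
  unfold S1
  fun_prop

/-- Continuity and positivity on a compact interval. The uniform lower bound later turns absolute
errors into relative ones. -/
theorem S1_bounds {q : ℝ} (hq : 0 < q) (Θ : ℝ) : ∃ c : ℝ, 0 < c ∧ ∀ θ, |θ| ≤ Θ → c ≤ S1 q θ := by
  rcases lt_or_ge Θ 0 with hΘ | hΘ
  · exact ⟨1, one_pos, fun θ hθ => absurd (abs_nonneg θ) (by linarith)⟩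
  · obtain ⟨x, _, hx⟩ := isCompact_Icc.exists_isMinOn (s := Icc (-Θ) Θ) ⟨0, by simp [hΘ]⟩
      (continuous_S1 q).continuousOn
    exact ⟨S1 q x, S1_pos hq x, fun θ hθ => hx (abs_le.1 hθ)⟩

end BetaIntegral

/-! ### Autocorrelation of the Gaussian under dilations -/

namespace SchwartzMap

theorem fourier_compSubConst (c : ℝ) (w : 𝓢(ℝ, ℂ)) (η : ℝ) :
    𝓕 (compSubConstCLM ℂ c w) η = Complex.exp ((-(2 * Real.pi * (c * η)) : ℝ) * Complex.I) * 𝓕 w η := by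
  rw [fourier_coe, fourier_coe, Real.fourier_eq', Real.fourier_eq', ← integral_const_mul,
    ← integral_add_right_eq_self _ c]
  congr 1
  ext y
  simp only [compSubConstCLM_apply, add_sub_cancel_right, smul_eq_mul, RCLike.inner_apply, conj_trivial]
  rw [← mul_assoc (Complex.exp _), ← Complex.exp_add]
  congr 2
  push_cast; ring

/-- A translation changes only the phase of the Fourier transform; this removes h from the spectral
density. -/
theorem norm_fourier_beamProfile (h η : ℝ) : ‖𝓕 (beamProfile h) η‖ = ‖𝓕 gaussianProfile η‖ := by
  rw [beamProfile, fourier_compSubConst, norm_mul, Complex.norm_exp_ofReal_mul_I, one_mul]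

/-- The autocorrelation of the Gaussian under dilations. -/
theorem integral_gaussianProfile_mul_translate (c : ℝ) :
    ∫ y, (starRingEnd ℂ) (gaussianProfile y) * gaussianProfile (y - c) =
      ((Real.sqrt (Real.cosh c))⁻¹ : ℝ) := by
  -- With this b the product of the two profiles is a multiple of e^y exp(-b e^{2y}), a Gaussian
  -- integral over the half-line in x = e^y. The value follows from cosh c = e^c b.
  set b : ℝ := (1 + Real.exp (-2 * c)) / 2 with hb
  have hbpos : 0 < b := by positivity
  have h1 : ∀ y : ℝ, (starRingEnd ℂ) (gaussianProfile y) * gaussianProfile (y - c) =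
      ((2 * (Real.sqrt Real.pi)⁻¹ * Real.exp (-c / 2) *
        (Real.exp y • Real.exp (-b * Real.exp y ^ 2)) : ℝ) : ℂ) := by
    intro y
    rw [gaussianProfile_apply, gaussianProfile_apply, Complex.conj_ofReal, ← Complex.ofReal_mul]
    congr 1
    have hp : Real.pi ^ (-(1 / 4) : ℝ) * Real.pi ^ (-(1 / 4) : ℝ) = (Real.sqrt Real.pi)⁻¹ := by
      rw [← Real.rpow_add Real.pi_pos, Real.sqrt_eq_rpow, ← Real.rpow_neg Real.pi_pos.le]
      norm_num
    have he : Real.exp (y / 2 - Real.exp (2 * y) / 2) *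
        Real.exp ((y - c) / 2 - Real.exp (2 * (y - c)) / 2) =
        Real.exp (-c / 2) * (Real.exp y * Real.exp (-b * Real.exp y ^ 2)) := by
      rw [← Real.exp_add, ← Real.exp_add, ← Real.exp_add]
      congr 1
      have e1 : Real.exp (2 * y) = Real.exp y ^ 2 := by rw [← Real.exp_nat_mul]; norm_num
      have e2 : Real.exp (2 * (y - c)) = Real.exp y ^ 2 * Real.exp (-2 * c) := by
        rw [← e1, ← Real.exp_add]; ring_nf
      rw [e1, e2, hb]; ring
    have h2 : Real.sqrt 2 * Real.sqrt 2 = 2 := Real.mul_self_sqrt zero_le_two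
    calc _ = (Real.sqrt 2 * Real.sqrt 2) * (Real.pi ^ (-(1 / 4) : ℝ) * Real.pi ^ (-(1 / 4) : ℝ)) *
          (Real.exp (y / 2 - Real.exp (2 * y) / 2) *
        Real.exp ((y - c) / 2 - Real.exp (2 * (y - c)) / 2)) := by ring
      _ = _ := by rw [h2, hp, he, smul_eq_mul]; ring
  simp_rw [h1]
  rw [integral_complex_ofReal, integral_const_mul,
    ← integral_Ioi_eq_integral_exp_smul (fun x => Real.exp (-b * x ^ 2)), integral_gaussian_Ioi]
  congr 1
  have hcosh : Real.cosh c = Real.exp c * b := by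
    rw [Real.cosh_eq, hb]
    have : Real.exp (-c) = Real.exp c * Real.exp (-2 * c) := by rw [← Real.exp_add]; ring_nf
    rw [this]; ring
  rw [hcosh, Real.sqrt_mul (Real.exp_pos c).le, Real.sqrt_div Real.pi_pos.le, ← Real.exp_half,
    neg_div, Real.exp_neg]
  have : Real.sqrt Real.pi ≠ 0 := by positivity
  have : Real.sqrt b ≠ 0 := by positivity
  field_simp

/-- Plancherel applied to the profile and its translate: the characteristic function of the spectral
density is the autocorrelation. -/
theorem integral_exp_mul_norm_fourier_gaussianProfile_sq (c : ℝ) :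
    ∫ η : ℝ, Complex.exp ((-(c * (2 * Real.pi * η)) : ℝ) * Complex.I) *
      ((‖𝓕 gaussianProfile η‖ ^ 2 : ℝ) : ℂ) = ((Real.sqrt (Real.cosh c))⁻¹ : ℝ) := by
  rw [← integral_gaussianProfile_mul_translate]
  have h := inner_fourier_toL2_eq gaussianProfile (compSubConstCLM ℂ c gaussianProfile)
  rw [inner_toLp_eq, inner_toLp_eq] at h
  simp only [compSubConstCLM_apply] at h
  rw [← h]
  congr 1
  ext η
  rw [fourier_compSubConst, mul_left_comm ((starRingEnd ℂ) _), ← Complex.normSq_eq_conj_mul_self,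
    Complex.normSq_eq_norm_sq]
  congr 3
  push_cast; ring

end SchwartzMap

/-! ### Time averages of stationary curves -/

section TimeAverage

variable {H : Type*} [NormedAddCommGroup H] [InnerProductSpace ℂ H]

theorem hasCompactSupport_comp_div {c : ℝ → ℝ} (hc : HasCompactSupport c) {T : ℝ} (hT : 0 < T) :
    HasCompactSupport fun t => c (t / T) := by
  have := hc.comp_homeomorph (Homeomorph.mulRight₀ T⁻¹ (inv_ne_zero hT.ne'))
  simpa [Function.comp_def, div_eq_mul_inv] using this

theorem integral_smul_eq_inner [CompleteSpace H] {F : ℝ → H} (hF : Integrable F) :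
    ((‖∫ t, F t‖ ^ 2 : ℝ) : ℂ) = ∫ t', inner ℂ (F t') (∫ t, F t) ∧
      ∀ t', inner ℂ (F t') (∫ t, F t) = ∫ t, inner ℂ (F t') (F t) := by
  have h1 : ∀ x : H, ∫ t, inner ℂ x (F t) = inner ℂ x (∫ t, F t) := fun x =>
    (innerSL ℂ x).integral_comp_comm hF
  refine ⟨?_, fun t' => (h1 _).symm⟩
  have h2 : ∀ t', inner ℂ (F t') (∫ t, F t) = (starRingEnd ℂ) (inner ℂ (∫ t, F t) (F t')) :=
    fun t' => (inner_conj_symm _ _).symm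
  simp_rw [h2]
  rw [integral_conj, h1, inner_conj_symm, inner_self_eq_norm_sq_to_K]
  simp

/-- The square norm of the time average of a stationary curve, in terms of an approximation `κ` of
its autocorrelation. -/
theorem abs_norm_sq_timeAverage_sub_le [CompleteSpace H] {Φ : ℝ → H} {g κ : ℝ → ℂ} {S δ : ℝ}
    (hΦ : Continuous Φ) (hg : ∀ t t', inner ℂ (Φ t') (Φ t) = g (t - t')) (hκ : Integrable κ)
    (hκ1 : Integrable fun s => |s| * ‖κ s‖) (hS : ∫ s, κ s = S) (hgκ : ∀ s, ‖g s - κ s‖ ≤ δ * |s|)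
    {c : ℝ → ℝ} {M L : ℝ} (hcont : Continuous c) (hsupp : ∀ x, 1 < |x| → c x = 0)
    (hM : ∀ x, |c x| ≤ M) (hL : ∀ x y, |c x - c y| ≤ L * |x - y|) {T : ℝ} (hT : 0 < T) :
    |‖∫ t, (c (t / T) : ℂ) • Φ t‖ ^ 2 - T * S * ∫ x, c x ^ 2| ≤
      2 * M * L * (∫ s, |s| * ‖κ s‖) + 16 * M ^ 2 * δ * T ^ 3 := by
  set A := ∫ s, |s| * ‖κ s‖ with hA
  have hM0 : 0 ≤ M := (abs_nonneg _).trans (hM 0)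
  have hδ0 : 0 ≤ δ := by simpa using (norm_nonneg _).trans (hgκ 1)
  have hL0 : 0 ≤ L := by simpa using (abs_nonneg _).trans (hL 1 0)
  have hcs : HasCompactSupport c := by
    refine HasCompactSupport.of_support_subset_isCompact (isCompact_Icc (a := -1) (b := 1)) ?_
    intro x hx
    by_contra hne
    rw [mem_Icc, ← abs_le, not_le] at hne
    exact hx (hsupp x hne)
  have hcT := hasCompactSupport_comp_div hcs hT
  have hsuppT : ∀ t, T < |t| → c (t / T) = 0 := by
    intro t ht
    refine hsupp _ ?_
    rwa [abs_div, abs_of_pos hT, one_lt_div hT]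
  set F : ℝ → H := fun t => (c (t / T) : ℂ) • Φ t with hF
  have hFc : Continuous F := by
    have : Continuous fun t => c (t / T) := by fun_prop
    fun_prop
  have hFs : HasCompactSupport F :=
    HasCompactSupport.smul_right (hcT.comp_left (g := fun x : ℝ => (x : ℂ)) Complex.ofReal_zero)
  have hFi : Integrable F := hFc.integrable_of_hasCompactSupport hFs
  obtain ⟨hn1, hn2⟩ := integral_smul_eq_inner hFi
  have hgc : Continuous g := by
    have : g = fun s => inner ℂ (Φ 0) (Φ s) := by ext s; rw [hg]; simp
    rw [this]; fun_prop
  have hinner : ∀ t', inner ℂ (F t') (∫ t, F t) =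
      (c (t' / T) : ℂ) * ∫ s, (c ((s + t') / T) : ℂ) * g s := by
    intro t'
    rw [hn2, ← integral_const_mul, ← integral_add_right_eq_self _ t']
    congr 1
    ext s
    simp only [hF, inner_smul_left, inner_smul_right, hg, Complex.conj_ofReal, add_sub_cancel_right]
    ring
  -- For |t'| ≤ T the weight restricts s to |s| ≤ 2T; replacing g by κ there costs M · 2δT on length
  -- 4T. Then c((s + t')/T) is replaced by c(t'/T), at the cost L|s|/T integrated against ‖κ‖.
  have hbound : ∀ t', |t'| ≤ T → ‖(∫ s, (c ((s + t') / T) : ℂ) * g s) - c (t' / T) * S‖ ≤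
      8 * M * δ * T ^ 2 + L * A / T := by
    intro t' ht'
    have hi : Integrable fun s => (c ((s + t') / T) : ℂ) * g s := by
      refine Continuous.integrable_of_hasCompactSupport ?_ ?_
      · have : Continuous fun s => c ((s + t') / T) := by fun_prop
        fun_prop
      · have h1 : HasCompactSupport fun s => c ((s + t') / T) :=
          hcT.comp_homeomorph (Homeomorph.addRight t')
        exact HasCompactSupport.mul_right
          (h1.comp_left (g := fun x : ℝ => (x : ℂ)) Complex.ofReal_zero)
    rw [← hS, ← integral_const_mul, ← integral_sub hi (hκ.const_mul _)]
    have hind : Integrable ((Icc (-(2 * T)) (2 * T)).indicator fun _ => 2 * M * δ * T) :=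
      (integrable_indicator_iff measurableSet_Icc).2 (integrableOn_const (by simp))
    refine (norm_integral_le_of_norm_le (hind.add (hκ1.const_mul (L / T)))
      (Filter.Eventually.of_forall fun s => ?_)).trans_eq ?_
    · have e : (c ((s + t') / T) : ℂ) * g s - c (t' / T) * κ s = c ((s + t') / T) * (g s - κ s) +
          ((c ((s + t') / T) - c (t' / T) : ℝ) : ℂ) * κ s := by push_cast; ring
      rw [e]
      refine (norm_add_le _ _).trans (add_le_add ?_ ?_)
      · rw [norm_mul, Complex.norm_real, Real.norm_eq_abs]
        by_cases hs : s ∈ Icc (-(2 * T)) (2 * T)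
        · rw [indicator_of_mem hs]
          have hs' : |s| ≤ 2 * T := abs_le.2 hs
          calc _ ≤ M * (δ * (2 * T)) := by
                gcongr
                · exact hM _
                · exact (hgκ s).trans (by gcongr)
            _ = _ := by ring
        · rw [indicator_of_notMem hs, hsuppT, abs_zero, zero_mul]
          rw [mem_Icc, ← abs_le, not_le] at hs
          have := abs_sub_abs_le_abs_sub s (-t')
          rw [abs_neg, sub_neg_eq_add] at this
          linarith
      · rw [norm_mul, Complex.norm_real, Real.norm_eq_abs]
        change _ ≤ L / T * (|s| * ‖κ s‖)
        rw [← mul_assoc]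
        refine mul_le_mul_of_nonneg_right ((hL _ _).trans_eq ?_) (norm_nonneg _)
        rw [← sub_div, add_sub_cancel_right, abs_div, abs_of_pos hT]; ring
    · simp only [Pi.add_apply]
      rw [integral_add hind (hκ1.const_mul _), integral_indicator measurableSet_Icc,
        setIntegral_const, integral_const_mul, Real.volume_real_Icc_of_le (by linarith), ← hA,
        smul_eq_mul]
      ring
  have hJi : Integrable fun t' => inner ℂ (F t') (∫ t, F t) := hFi.inner_const _
  have hcc : Integrable fun x => c x ^ 2 := by
    refine (hcont.pow 2).integrable_of_hasCompactSupport ?_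
    simp only [sq]
    exact hcs.mul_right
  have hccT : Integrable fun t' => (((c (t' / T)) ^ 2 : ℝ) : ℂ) * S := by
    have h0 : Integrable fun t' => c (t' / T) ^ 2 := by
      refine Continuous.integrable_of_hasCompactSupport (by fun_prop) ?_
      simp only [sq]
      exact hcT.mul_right
    exact h0.ofReal.mul_const _
  have hmain : ((‖∫ t, F t‖ ^ 2 - T * S * ∫ x, c x ^ 2 : ℝ) : ℂ) =
      ∫ t', (inner ℂ (F t') (∫ t, F t) - (((c (t' / T)) ^ 2 : ℝ) : ℂ) * S) := by
    rw [integral_sub hJi hccT, ← hn1, integral_mul_const, integral_complex_ofReal,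
      Measure.integral_comp_div (fun x => c x ^ 2), abs_of_pos hT, smul_eq_mul]
    push_cast; ring
  rw [← Real.norm_eq_abs, ← Complex.norm_real, hmain]
  -- The outer integral multiplies the previous error by M and by the length 2T, which yields the
  -- two terms 2MLA and 16M²δT³.
  have hind : Integrable ((Icc (-T) T).indicator fun _ => M * (8 * M * δ * T ^ 2 + L * A / T)) :=
    (integrable_indicator_iff measurableSet_Icc).2 (integrableOn_const (by simp))
  refine (norm_integral_le_of_norm_le hind (Filter.Eventually.of_forall fun t' => ?_)).trans_eq ?_
  · have e : inner ℂ (F t') (∫ t, F t) - (((c (t' / T)) ^ 2 : ℝ) : ℂ) * S =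
        c (t' / T) * ((∫ s, (c ((s + t') / T) : ℂ) * g s) - c (t' / T) * S) := by
      rw [hinner]; push_cast; ring
    rw [e, norm_mul, Complex.norm_real, Real.norm_eq_abs]
    by_cases ht : t' ∈ Icc (-T) T
    · rw [indicator_of_mem ht]
      exact mul_le_mul (hM _) (hbound t' (abs_le.2 ht)) (norm_nonneg _) hM0
    · rw [indicator_of_notMem ht]
      rw [mem_Icc, ← abs_le, not_le] at ht
      rw [hsuppT t' ht, abs_zero, zero_mul]
  · rw [integral_indicator measurableSet_Icc, setIntegral_const,
      Real.volume_real_Icc_of_le (by linarith), smul_eq_mul]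
    field_simp
    ring

end TimeAverage

/-! ### The model correlation and the spectral density -/

theorem Real.exp_abs_le_two_mul_cosh (x : ℝ) : Real.exp |x| ≤ 2 * Real.cosh x := by
  rw [← Real.cosh_abs, Real.cosh_eq]
  have := Real.exp_pos (-|x|)
  linarith

theorem integrable_exp_neg_mul_abs {b : ℝ} (hb : 0 < b) :
    Integrable fun s : ℝ => Real.exp (-b * |s|) := by
  refine integrable_of_even (fun x => by rw [abs_neg]) ?_
  refine (exp_neg_integrableOn_Ioi 0 hb).congr_fun (fun x hx => ?_) measurableSet_Ioi
  simp only
  rw [abs_of_pos hx]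

theorem inv_sqrt_cosh_le (x : ℝ) : (Real.sqrt (Real.cosh x))⁻¹ ≤ 2 * Real.exp (-(1 / 2) * |x|) := by
  have h1 := Real.exp_abs_le_two_mul_cosh x
  have hc : 0 < Real.cosh x := Real.cosh_pos x
  have h2 : Real.exp (1 / 2 * |x|) / 2 ≤ Real.sqrt (Real.cosh x) := by
    refine Real.le_sqrt_of_sq_le ?_
    have : Real.exp (1 / 2 * |x|) ^ 2 = Real.exp |x| := by
      rw [← Real.exp_nat_mul]; congr 1; push_cast; ring
    rw [div_pow, this]
    linarith
  calc (Real.sqrt (Real.cosh x))⁻¹ ≤ (Real.exp (1 / 2 * |x|) / 2)⁻¹ := inv_anti₀ (by positivity) h2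
    _ = 2 * Real.exp (-(1 / 2) * |x|) := by
      rw [neg_mul, Real.exp_neg]; field_simp

/-- The autocorrelation `e^{iθs} (cosh λs)^{-1/2}` of the beam in the linear approximation. -/
def beamCorrelation (lam θ s : ℝ) : ℂ :=
  Complex.exp ((θ * s : ℝ) * Complex.I) * ((Real.sqrt (Real.cosh (lam * s)))⁻¹ : ℝ)

theorem norm_beamCorrelation (lam θ s : ℝ) :
    ‖beamCorrelation lam θ s‖ = (Real.sqrt (Real.cosh (lam * s)))⁻¹ := by
  rw [beamCorrelation, norm_mul, Complex.norm_exp_ofReal_mul_I, one_mul, Complex.norm_real,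
    Real.norm_eq_abs, abs_of_nonneg (by positivity)]

theorem continuous_beamCorrelation (lam θ : ℝ) : Continuous (beamCorrelation lam θ) := by
  have h : Continuous fun s : ℝ => (Real.sqrt (Real.cosh (lam * s)))⁻¹ := by
    refine Continuous.inv₀ (Real.continuous_sqrt.comp (Real.continuous_cosh.comp
      (continuous_const.mul continuous_id))) fun s => ?_
    exact (Real.sqrt_pos.2 (Real.cosh_pos _)).ne'
  unfold beamCorrelation
  fun_prop

theorem integrable_abs_mul_norm_beamCorrelation {lam : ℝ} (hlam : 0 < lam) (θ : ℝ) :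
    Integrable fun s => |s| * ‖beamCorrelation lam θ s‖ := by
  refine ((integrable_exp_neg_mul_abs (b := lam / 4) (by positivity)).const_mul (8 / lam)).mono'
    (continuous_abs.mul (continuous_beamCorrelation lam θ).norm).aestronglyMeasurable
    (Filter.Eventually.of_forall fun s => ?_)
  rw [norm_beamCorrelation, Real.norm_eq_abs, abs_of_nonneg (by positivity)]
  have h1 := inv_sqrt_cosh_le (lam * s)
  have h2 := Real.add_one_le_exp (lam / 4 * |s|)
  rw [abs_mul, abs_of_pos hlam] at h1
  have h3 : |s| ≤ 4 / lam * Real.exp (lam / 4 * |s|) := by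
    rw [div_mul_eq_mul_div, le_div_iff₀ hlam]; linarith
  calc |s| * (Real.sqrt (Real.cosh (lam * s)))⁻¹
      ≤ (4 / lam * Real.exp (lam / 4 * |s|)) * (2 * Real.exp (-(1 / 2) * (lam * |s|))) := by gcongr
    _ = 8 / lam * (Real.exp (lam / 4 * |s|) * Real.exp (-(1 / 2) * (lam * |s|))) := by ring
    _ = _ := by rw [← Real.exp_add]; ring_nf

theorem integrable_beamCorrelation {lam : ℝ} (hlam : 0 < lam) (θ : ℝ) :
    Integrable (beamCorrelation lam θ) := by
  refine ((integrable_exp_neg_mul_abs (b := lam / 2) (by positivity)).const_mul 2).mono'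
    (continuous_beamCorrelation lam θ).aestronglyMeasurable
    (Filter.Eventually.of_forall fun s => ?_)
  rw [norm_beamCorrelation]
  refine (inv_sqrt_cosh_le (lam * s)).trans_eq ?_
  rw [abs_mul, abs_of_pos hlam]
  ring_nf

theorem integral_beamCorrelation {lam : ℝ} (hlam : 0 < lam) (θ : ℝ) :
    ∫ s, beamCorrelation lam θ s = (S1 lam θ : ℂ) := integral_exp_div_sqrt_cosh hlam θ

theorem Complex.norm_exp_mul_I_sub_exp_mul_I_le (a b : ℝ) :
    ‖Complex.exp (a * Complex.I) - Complex.exp (b * Complex.I)‖ ≤ |a - b| := by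
  have h : Complex.exp (a * Complex.I) - Complex.exp (b * Complex.I) =
      Complex.exp (b * Complex.I) * (Complex.exp (Complex.I * (a - b : ℝ)) - 1) := by
    rw [mul_sub, mul_one, ← Complex.exp_add]
    congr 2
    push_cast; ring
  rw [h, norm_mul, Complex.norm_exp_ofReal_mul_I, one_mul]
  exact Real.norm_exp_I_mul_ofReal_sub_one_le

/-- The spectral density of the Gaussian beam with respect to the generator of dilations. -/
def beamDensity (η : ℝ) : ℝ := ‖𝓕 gaussianProfile η‖ ^ 2

theorem beamDensity_nonneg (η : ℝ) : 0 ≤ beamDensity η := sq_nonneg _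

/-- The Fourier transform of the profile is Schwartz, so all moments of the density are finite; they
control the nonlinear part of the symbol. -/
theorem integrable_polynomial_mul_beamDensity (p : ℝ[X]) :
    Integrable fun η => |p.eval (2 * Real.pi * η)| * beamDensity η := by
  refine (integrable_conj_mul (𝓕 gaussianProfile)
    (Polynomial.aeval freqMul p (𝓕 gaussianProfile))).norm.congr
    (Filter.Eventually.of_forall fun η => ?_)
  simp only [aeval_freqMul_apply, norm_mul, RCLike.norm_conj, Complex.norm_real, Real.norm_eq_abs,
    beamDensity]
  ring

theorem integrable_beamDensity : Integrable beamDensity := by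
  simpa using integrable_polynomial_mul_beamDensity 1

/-- This is the correlation produced by the affine symbol q⁰/h + λw, written over the same density
as the true one so that the phases can be compared. -/
theorem beamCorrelation_eq (lam θ s : ℝ) : beamCorrelation lam θ s =
    ∫ η : ℝ, Complex.exp ((θ * s - lam * s * (2 * Real.pi * η) : ℝ) * Complex.I) *
      (beamDensity η : ℂ) := by
  rw [beamCorrelation, ← integral_exp_mul_norm_fourier_gaussianProfile_sq, ← integral_const_mul]
  congr 1
  ext η
  rw [← mul_assoc, ← Complex.exp_add]
  congr 2
  push_cast; ring

/-! ### Linearization of the normal form -/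

namespace QuantumNormalForm

variable (F : QuantumNormalForm)

theorem abs_frequency_le (h : ℝ) {n : ℤ} {n₀ : ℕ} (hn : n.natAbs ≤ n₀) :
    |F.frequency h n| ≤ 2 * Real.pi * (n₀ + 1) := by
  have h1 : |(n : ℝ)| ≤ n₀ := by
    rw [← Int.cast_abs, Int.abs_eq_natAbs]
    exact_mod_cast hn
  have h2 := Int.fract_nonneg (F.action / (2 * Real.pi * h))
  have h3 := (Int.fract_lt_one (F.action / (2 * Real.pi * h))).le
  have : F.frequency h n = 2 * Real.pi * (n - Int.fract (F.action / (2 * Real.pi * h))) := by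
    rw [frequency, twistAngle]; ring
  rw [this, abs_mul, abs_of_pos Real.two_pi_pos]
  refine mul_le_mul_of_nonneg_left ?_ Real.two_pi_pos.le
  refine (abs_sub _ _).trans ?_
  rw [abs_of_nonneg h2]
  linarith

/-- The leading coefficient is Lipschitz near 0 and is evaluated at τ = O(h); every later term
carries a factor h. -/
theorem exists_fullCoeff_sub_le (B : ℝ) (hB : 0 ≤ B) {α : ℕ} (hα : α ≤ F.N) :
    ∃ C : ℝ, 0 ≤ C ∧ ∀ h : ℝ, 0 < h → h ≤ 1 → ∀ τ : ℝ, |τ| ≤ B * h →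
      |F.fullCoeff h α τ - F.coeff α 0 0| ≤ C * h := by
  have hbd : ∀ i ≤ F.N, ∃ K : ℝ, ∀ τ ∈ Icc (-B) B, |F.coeff α i τ| ≤ K := fun i hi =>
    isCompact_Icc.exists_bound_of_continuousOn (F.smooth α hα i hi).continuous.continuousOn
  have hbd' : ∀ i : ℕ, ∃ K : ℝ, i ≤ F.N → ∀ τ ∈ Icc (-B) B, |F.coeff α i τ| ≤ K := fun i => by
    by_cases hi : i ≤ F.N
    · obtain ⟨K, hK⟩ := hbd i hi; exact ⟨K, fun _ => hK⟩
    · exact ⟨0, fun h => absurd h hi⟩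
  choose K hK using hbd'
  have hd0 : ContDiff ℝ ∞ (F.coeff α 0) := F.smooth α hα 0 (Nat.zero_le _)
  obtain ⟨D, hD⟩ : ∃ D : ℝ, ∀ τ ∈ Icc (-B) B, ‖deriv (F.coeff α 0) τ‖ ≤ D :=
    isCompact_Icc.exists_bound_of_continuousOn (hd0.continuous_deriv (by simp)).continuousOn
  have h0mem : (0 : ℝ) ∈ Icc (-B) B := by simp [hB]
  have hD0 : 0 ≤ D := (norm_nonneg _).trans (hD 0 h0mem)
  refine ⟨D * B + ∑ i ∈ Finset.range F.N, |K (i + 1)|, by positivity, fun h hh h1 τ hτ => ?_⟩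
  have hτB : τ ∈ Icc (-B) B := abs_le.1 (hτ.trans (by nlinarith))
  rw [fullCoeff, Finset.sum_range_succ', pow_zero, one_mul, add_sub_assoc, add_comm]
  refine (abs_add_le _ _).trans ?_
  rw [add_mul, Finset.sum_mul]
  refine add_le_add ?_ ((Finset.abs_sum_le_sum_abs _ _).trans (Finset.sum_le_sum fun i hi => ?_))
  · have := Convex.norm_image_sub_le_of_norm_deriv_le (f := F.coeff α 0) (s := Icc (-B) B)
      (fun x _ => (hd0.differentiable (by simp)).differentiableAt) hD (convex_Icc _ _) h0mem hτB
    rw [Real.norm_eq_abs, Real.norm_eq_abs, sub_zero] at this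
    calc _ ≤ D * |τ| := this
      _ ≤ D * (B * h) := by gcongr
      _ = _ := by ring
  · rw [abs_mul, abs_of_pos (by positivity), mul_comm]
    have hi' : i + 1 ≤ F.N := Finset.mem_range.1 hi
    have e1 : h ^ (i + 1) ≤ h := by
      simpa using pow_le_pow_of_le_one hh.le h1 (Nat.succ_le_succ (Nat.zero_le i))
    exact mul_le_mul ((hK _ hi' τ hτB).trans (le_abs_self _)) e1 (by positivity) (abs_nonneg _)

theorem exists_fullCoeff_bound (n₀ : ℕ) : ∃ C : ℝ, 0 ≤ C ∧ ∀ h : ℝ, 0 < h → h ≤ 1 →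
    ∀ n : ℤ, n.natAbs ≤ n₀ → ∀ α ≤ F.N,
      |F.fullCoeff h α (h * F.frequency h n) - F.coeff α 0 0| ≤ C * h ∧
      |F.fullCoeff h α (h * F.frequency h n)| ≤ C := by
  have hB : (0 : ℝ) ≤ 2 * Real.pi * (n₀ + 1) := by positivity
  have h' : ∀ α : ℕ, ∃ C : ℝ, 0 ≤ C ∧ (α ≤ F.N → ∀ h : ℝ, 0 < h → h ≤ 1 → ∀ τ : ℝ,
      |τ| ≤ 2 * Real.pi * (n₀ + 1) * h → |F.fullCoeff h α τ - F.coeff α 0 0| ≤ C * h) := fun α => by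
    by_cases hα : α ≤ F.N
    · obtain ⟨C, hC, hC'⟩ := F.exists_fullCoeff_sub_le _ hB hα; exact ⟨C, hC, fun _ => hC'⟩
    · exact ⟨0, le_rfl, fun h => absurd h hα⟩
  choose C hC hC' using h'
  refine ⟨∑ α ∈ Finset.range (F.N + 1), (C α + |F.coeff α 0 0|),
    Finset.sum_nonneg fun α _ => add_nonneg (hC α) (abs_nonneg _), fun h hh h1 n hn α hα => ?_⟩
  have hle : C α + |F.coeff α 0 0| ≤ ∑ α ∈ Finset.range (F.N + 1), (C α + |F.coeff α 0 0|) :=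
    Finset.single_le_sum (f := fun α => C α + |F.coeff α 0 0|)
      (fun α _ => add_nonneg (hC α) (abs_nonneg _)) (Finset.mem_range.2 (Nat.lt_succ_of_le hα))
  have hτ : |h * F.frequency h n| ≤ 2 * Real.pi * (n₀ + 1) * h := by
    rw [abs_mul, abs_of_pos hh, mul_comm]
    exact mul_le_mul_of_nonneg_right (F.abs_frequency_le h hn) hh.le
  have h2 := hC' α hα h hh h1 _ hτ
  have h3 := abs_nonneg (F.coeff α 0 0)
  constructor
  · refine h2.trans (mul_le_mul_of_nonneg_right ?_ hh.le)
    linarith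
  · have h4 := abs_sub_abs_le_abs_sub (F.fullCoeff h α (h * F.frequency h n)) (F.coeff α 0 0)
    have h5 : C α * h ≤ C α := mul_le_of_le_one_right (hC α) h1
    linarith

/-- The symbol of the normal form operator is affine up to `O(h)`. -/
theorem exists_sectorPoly_bound (n₀ : ℕ) : ∃ C : ℝ, 0 ≤ C ∧ ∀ h : ℝ, 0 < h → h ≤ 1 →
    ∀ n : ℤ, n.natAbs ≤ n₀ → ∀ w : ℝ,
      |(F.sectorPoly h (F.frequency h n)).eval w / h - F.centralEnergy h n / h - F.rate * w| ≤
        h * C * ∑ α ∈ Finset.range (F.N + 1), |(weylPoly α).eval w| := by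
  obtain ⟨C, hC, hb⟩ := F.exists_fullCoeff_bound n₀
  refine ⟨C, hC, fun h hh h1 n hn w => ?_⟩
  -- What is left of each coefficient after division by h and subtraction of q⁰/h + λw: nothing for
  -- α = 0, q¹ - λ = O(h) for α = 1, and h^{α-1}q^α for α ≥ 2. The truncated subtraction α - 1
  -- occurs only in the last case.
  set d : ℕ → ℝ := fun α => if α = 0 then 0 else if α = 1 then
    F.fullCoeff h 1 (h * F.frequency h n) - F.rate else
    F.fullCoeff h α (h * F.frequency h n) * h ^ (α - 1) with hd
  have hsum : (F.sectorPoly h (F.frequency h n)).eval w / h - F.centralEnergy h n / h - F.rate * w =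
      ∑ α ∈ Finset.range (F.N + 1), d α * (weylPoly α).eval w := by
    -- N ≥ 1 guarantees that the linear term is present, so that α = 0 and α = 1 can both be split
    -- off.
    obtain ⟨m, hm⟩ : ∃ m, F.N = m + 1 := ⟨F.N - 1, by have := F.one_le_N; omega⟩
    have hc : F.centralEnergy h n = F.fullCoeff h 0 (h * F.frequency h n) := rfl
    rw [sectorPoly, hm, hc, Finset.sum_range_succ', Finset.sum_range_succ', Finset.sum_range_succ',
      Finset.sum_range_succ']
    have w0 : (weylPoly 0).eval w = 1 := by simp [weylPoly]
    have w1 : (weylPoly 1).eval w = w := by simp [weylPoly]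
    have e : ∀ i : ℕ, i + 1 + 1 - 1 = i + 1 := fun i => by omega
    simp only [Polynomial.eval_add, Polynomial.eval_finsetSum, Polynomial.eval_mul,
      Polynomial.eval_C, hd, zero_add, pow_zero, mul_one, one_ne_zero, if_false, if_true,
      add_zero, pow_one, w0, w1, e, Nat.add_eq_zero_iff, and_false, Nat.add_eq_right]
    have e2 : (∑ i ∈ Finset.range m, F.fullCoeff h (i + 1 + 1) (h * F.frequency h n) *
        h ^ (i + 1) * (weylPoly (i + 1 + 1)).eval w) * h =
        ∑ i ∈ Finset.range m, F.fullCoeff h (i + 1 + 1) (h * F.frequency h n) *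
          h ^ (i + 1 + 1) * (weylPoly (i + 1 + 1)).eval w := by
      rw [Finset.sum_mul]
      exact Finset.sum_congr rfl fun i _ => by ring
    rw [sub_sub, sub_eq_iff_eq_add, div_eq_iff hh.ne', add_mul, add_mul, e2]
    field_simp
    ring
  rw [hsum, Finset.mul_sum]
  refine (Finset.abs_sum_le_sum_abs _ _).trans (Finset.sum_le_sum fun α hα => ?_)
  rw [abs_mul]
  refine mul_le_mul_of_nonneg_right ?_ (abs_nonneg _)
  have hα' : α ≤ F.N := Nat.lt_succ_iff.1 (Finset.mem_range.1 hα)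
  obtain ⟨b1, b2⟩ := hb h hh h1 n hn α hα'
  simp only [hd]
  rw [mul_comm h C]
  split_ifs with h2 h3
  · rw [abs_zero]; positivity
  · subst h3
    exact b1
  · rw [abs_mul, abs_of_pos (pow_pos hh (α - 1)), mul_comm, mul_comm C]
    have e1 : h ^ (α - 1) ≤ h := by
      simpa using pow_le_pow_of_le_one hh.le h1 (show 1 ≤ α - 1 by omega)
    exact mul_le_mul e1 b2 (abs_nonneg _) hh.le

/-- Both E and q⁰ lie within O(h) of E₀, so their difference divided by h stays in a fixed compact
set. -/
theorem exists_theta_bound (n₀ : ℕ) (CE : ℝ) : ∃ Θ : ℝ, ∀ h : ℝ, 0 < h → h ≤ 1 →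
    ∀ n : ℤ, n.natAbs ≤ n₀ → ∀ E : ℝ, |E - F.energy| ≤ CE * h →
      |(E - F.centralEnergy h n) / h| ≤ Θ := by
  obtain ⟨C, hC, hb⟩ := F.exists_fullCoeff_bound n₀
  refine ⟨CE + C, fun h hh h1 n hn E hE => ?_⟩
  have h2 : |F.centralEnergy h n - F.energy| ≤ C * h := (hb h hh h1 n hn 0 (Nat.zero_le _)).1
  rw [abs_div, abs_of_pos hh, div_le_iff₀ hh]
  have : E - F.centralEnergy h n = (E - F.energy) - (F.centralEnergy h n - F.energy) := by ring
  rw [this]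
  refine (abs_sub _ _).trans ?_
  linarith

/-- The evolved state with the phase `e^{itE/h}`. -/
def phasedEvolution (h : ℝ) (n : ℤ) (E t : ℝ) : ModelL2 :=
  Complex.exp (Complex.I * (t * E / h : ℝ)) • F.evolution h n t

/-- The evolution is a unitary phase in the spectral variable, so only the time difference and the
squared modulus of the initial amplitude survive. -/
theorem inner_phasedEvolution (h : ℝ) (n : ℤ) (E t t' : ℝ) :
    inner ℂ (F.phasedEvolution h n E t') (F.phasedEvolution h n E t) =
      ∫ η : ℝ, Complex.exp (((t - t') * E / h - (t - t') / h *
        (F.sectorPoly h (F.frequency h n)).eval (2 * Real.pi * η) : ℝ) * Complex.I) *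
          (beamDensity η : ℂ) := by
  rw [phasedEvolution, phasedEvolution, evolution, evolution, inner_smul_left, inner_smul_right,
    inner_spectralSector, ← integral_const_mul, ← integral_const_mul]
  congr 1
  ext η
  rw [phaseMul_apply, phaseMul_apply, map_mul, conj_phase, ← Complex.exp_conj]
  have h1 : (beamDensity η : ℂ) = (starRingEnd ℂ) (𝓕 (beamProfile h) η) * 𝓕 (beamProfile h) η := by
    rw [beamDensity, ← norm_fourier_beamProfile h, ← Complex.normSq_eq_conj_mul_self,
      Complex.normSq_eq_norm_sq]
  rw [h1]
  set P := (F.sectorPoly h (F.frequency h n)).eval (2 * Real.pi * η) with hP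
  have h2 : Complex.exp (((t - t') * E / h - (t - t') / h * P : ℝ) * Complex.I) =
      Complex.exp ((starRingEnd ℂ) (Complex.I * (t' * E / h : ℝ))) *
      Complex.exp (Complex.I * (t * E / h : ℝ)) *
      (phase (F.sectorPoly h (F.frequency h n)) (-(t' / h)) η *
      phase (F.sectorPoly h (F.frequency h n)) (t / h) η) := by
    rw [phase, phase, ← hP, ← Complex.exp_add, ← Complex.exp_add, ← Complex.exp_add]
    congr 1
    rw [map_mul, Complex.conj_I, Complex.conj_ofReal]
    push_cast; ring
  rw [h2]
  ring

/-- Compare the true and the affine phase under the integral by |e^{ia} - e^{ib}| ≤ |a - b|. Their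
difference is O(h|s|) times polynomials in w, which are integrable against the density. -/
theorem exists_correlation_bound (n₀ : ℕ) : ∃ D : ℝ, 0 ≤ D ∧ ∀ h : ℝ, 0 < h → h ≤ 1 →
    ∀ n : ℤ, n.natAbs ≤ n₀ → ∀ E s : ℝ,
      ‖(∫ η : ℝ, Complex.exp ((s * E / h - s / h *
        (F.sectorPoly h (F.frequency h n)).eval (2 * Real.pi * η) : ℝ) * Complex.I) *
          (beamDensity η : ℂ)) - beamCorrelation F.rate ((E - F.centralEnergy h n) / h) s‖ ≤
        h * D * |s| := by
  obtain ⟨C, hC, hb⟩ := F.exists_sectorPoly_bound n₀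
  set W : ℝ → ℝ := fun η => ∑ α ∈ Finset.range (F.N + 1),
    |(weylPoly α).eval (2 * Real.pi * η)| * beamDensity η with hW
  have hWi : Integrable W := integrable_finsetSum _ fun α _ =>
    integrable_polynomial_mul_beamDensity _
  have hW0 : 0 ≤ ∫ η, W η := integral_nonneg fun η => Finset.sum_nonneg fun α _ =>
    mul_nonneg (abs_nonneg _) (beamDensity_nonneg η)
  refine ⟨C * ∫ η, W η, mul_nonneg hC hW0, fun h hh h1 n hn E s => ?_⟩
  have hint : ∀ f : ℝ → ℝ, Continuous f →
      Integrable fun η => Complex.exp ((f η : ℝ) * Complex.I) * (beamDensity η : ℂ) := by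
    intro f hf
    refine (integrable_beamDensity.ofReal (𝕜 := ℂ)).bdd_mul (c := 1) ?_ ?_
    · exact Continuous.aestronglyMeasurable (by fun_prop)
    · exact Filter.Eventually.of_forall fun η => (Complex.norm_exp_ofReal_mul_I _).le
  rw [beamCorrelation_eq, ← integral_sub (hint _ (by fun_prop)) (hint _ (by fun_prop))]
  refine (norm_integral_le_of_norm_le (hWi.const_mul (h * C * |s|))
    (Filter.Eventually.of_forall fun η => ?_)).trans_eq ?_
  · rw [← sub_mul, norm_mul, Complex.norm_real, Real.norm_eq_abs,
      abs_of_nonneg (beamDensity_nonneg η)]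
    have h2 := hb h hh h1 n hn (2 * Real.pi * η)
    have h3 := Complex.norm_exp_mul_I_sub_exp_mul_I_le (s * E / h - s / h *
        (F.sectorPoly h (F.frequency h n)).eval (2 * Real.pi * η))
        ((E - F.centralEnergy h n) / h * s - F.rate * s * (2 * Real.pi * η))
    have h4 : (s * E / h - s / h * (F.sectorPoly h (F.frequency h n)).eval (2 * Real.pi * η)) -
        ((E - F.centralEnergy h n) / h * s - F.rate * s * (2 * Real.pi * η)) =
        -s * ((F.sectorPoly h (F.frequency h n)).eval (2 * Real.pi * η) / h -
          F.centralEnergy h n / h - F.rate * (2 * Real.pi * η)) := by ring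
    rw [h4, abs_mul, abs_neg] at h3
    simp only [hW]
    rw [← Finset.sum_mul, ← mul_assoc (h * C * |s|)]
    refine mul_le_mul_of_nonneg_right (h3.trans ?_) (beamDensity_nonneg η)
    refine (mul_le_mul_of_nonneg_left h2 (abs_nonneg s)).trans_eq ?_
    ring
  · rw [integral_const_mul]; ring

theorem continuous_evolution (h : ℝ) (n : ℤ) : Continuous (F.evolution h n) :=
  continuous_iff_continuousAt.2 fun t => (F.hasDerivAt_evolution h n t).continuousAt

theorem continuous_phasedEvolution (h : ℝ) (n : ℤ) (E : ℝ) :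
    Continuous (F.phasedEvolution h n E) := by
  have := F.continuous_evolution h n
  unfold phasedEvolution
  fun_prop

theorem quasimode_evolution (h : ℝ) (n : ℤ) (c : ℝ → ℝ) (T E : ℝ) :
    quasimode h (F.evolution h n) c T E = ∫ t, (c (t / T) : ℂ) • F.phasedEvolution h n E t := by
  rw [quasimode]
  simp only [phasedEvolution, smul_smul]

theorem exists_norm_sq_quasimode_bound (n₀ : ℕ) {c : ℝ → ℝ} (hc : ContDiff ℝ ∞ c)
    (hsupp : ∀ x, 1 < |x| → c x = 0) : ∃ K : ℝ, 0 ≤ K ∧ ∀ h : ℝ, 0 < h → h ≤ 1 →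
    ∀ n : ℤ, n.natAbs ≤ n₀ → ∀ E T : ℝ, 0 < T →
      |‖quasimode h (F.evolution h n) c T E‖ ^ 2 -
        T * S1 F.rate ((E - F.centralEnergy h n) / h) * l2norm c ^ 2| ≤ K * (1 + h * T ^ 3) := by
  have hcs : HasCompactSupport c := by
    refine HasCompactSupport.of_support_subset_isCompact (isCompact_Icc (a := -1) (b := 1)) ?_
    intro x hx
    by_contra hne
    rw [mem_Icc, ← abs_le, not_le] at hne
    exact hx (hsupp x hne)
  obtain ⟨M, hM⟩ := hc.continuous.bounded_above_of_compact_support hcs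
  obtain ⟨L, hL⟩ := (hc.continuous_deriv (by simp)).bounded_above_of_compact_support hcs.deriv
  have hM0 : 0 ≤ M := (norm_nonneg _).trans (hM 0)
  have hL0 : 0 ≤ L := (norm_nonneg _).trans (hL 0)
  obtain ⟨D, hD, hcorr⟩ := F.exists_correlation_bound n₀
  -- The parameter θ enters the model correlation only through a phase; θ = 0 thus gives a moment
  -- valid for all h, n and E.
  set A := ∫ s, |s| * ‖beamCorrelation F.rate 0 s‖ with hA
  have hA0 : 0 ≤ A := integral_nonneg fun s => by positivity
  refine ⟨2 * M * L * A + 16 * M ^ 2 * D, by positivity, fun h hh h1 n hn E T hT => ?_⟩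
  have hAθ : ∫ s, |s| * ‖beamCorrelation F.rate ((E - F.centralEnergy h n) / h) s‖ = A := by
    simp only [hA, norm_beamCorrelation]
  have key := abs_norm_sq_timeAverage_sub_le (Φ := F.phasedEvolution h n E)
    (g := fun s => ∫ η : ℝ, Complex.exp ((s * E / h - s / h *
        (F.sectorPoly h (F.frequency h n)).eval (2 * Real.pi * η) : ℝ) * Complex.I) *
          (beamDensity η : ℂ))
    (κ := beamCorrelation F.rate ((E - F.centralEnergy h n) / h))
    (S := S1 F.rate ((E - F.centralEnergy h n) / h)) (δ := h * D) (c := c) (M := M) (L := L) (T := T)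
    (F.continuous_phasedEvolution h n E) (fun t t' => F.inner_phasedEvolution h n E t t')
    (integrable_beamCorrelation F.rate_pos _) (integrable_abs_mul_norm_beamCorrelation F.rate_pos _)
    (integral_beamCorrelation F.rate_pos _) (fun s => hcorr h hh h1 n hn E s) hc.continuous hsupp hM
    (fun x y => by
      simpa using Convex.norm_image_sub_le_of_norm_deriv_le (f := c) (s := univ)
        (fun x _ => (hc.differentiable (by simp)).differentiableAt) (fun x _ => hL x) convex_univ
        (mem_univ y) (mem_univ x)) hT
  rw [hAθ] at key
  have hl2 : l2norm c ^ 2 = ∫ x, c x ^ 2 := Real.sq_sqrt (integral_nonneg fun x => sq_nonneg _)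
  rw [F.quasimode_evolution, hl2]
  refine key.trans ?_
  have e1 : 0 ≤ 2 * M * L * A * (h * T ^ 3) := by positivity
  have e2 : 0 ≤ 16 * M ^ 2 * D := by positivity
  linarith

end QuantumNormalForm

/-! ### The action of P - E on time averages -/

/-- A closed subspace is complete, so the Bochner integral can be formed inside it; applied to the
graph, this passes the operator under the time integral. -/
theorem Submodule.integral_prodMk_mem {E : Type*} [NormedAddCommGroup E] [NormedSpace ℂ E]
    [CompleteSpace E] {G : Submodule ℂ (E × E)} (hG : IsClosed (G : Set (E × E))) {f g : ℝ → E}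
    (hf : Integrable f) (hg : Integrable g) (hc : Continuous fun t => (f t, g t))
    (h : ∀ t, (f t, g t) ∈ G) : (∫ t, f t, ∫ t, g t) ∈ G := by
  have : CompleteSpace G := hG.completeSpace_coe
  set a : ℝ → G := fun t => ⟨(f t, g t), h t⟩ with ha
  have hac : Continuous a := hc.subtype_mk h
  have hai : Integrable a := by
    refine (hf.norm.add hg.norm).mono' hac.aestronglyMeasurable (Filter.Eventually.of_forall fun t => ?_)
    change max ‖f t‖ ‖g t‖ ≤ ‖f t‖ + ‖g t‖
    exact max_le (le_add_of_nonneg_right (norm_nonneg _)) (le_add_of_nonneg_left (norm_nonneg _))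
  have h1 := ((ContinuousLinearMap.fst ℂ E E).comp G.subtypeL).integral_comp_comm hai
  have h2 := ((ContinuousLinearMap.snd ℂ E E).comp G.subtypeL).integral_comp_comm hai
  have h3 : (∫ t, f t, ∫ t, g t) = ((∫ t, a t : G) : E × E) := Prod.ext h1 h2
  rw [h3]
  exact Submodule.coe_mem _

/-- A weighted time average of a solution of the Schrödinger equation lies in the domain of the
generator, and `P - E` acts on it by differentiating the weight function. -/
theorem timeAverage_mem_closure {H : Type*} [NormedAddCommGroup H] [NormedSpace ℂ H]
    [CompleteSpace H] {G : Submodule ℂ (H × H)} (hG : IsClosed (G : Set (H × H))) {φ ψ : ℝ → H}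
    (hφ : Continuous φ) (hψ : Continuous ψ) (hmem : ∀ t, (φ t, ψ t) ∈ G) {h : ℝ} (hh : 0 < h)
    (hd : ∀ t, HasDerivAt φ ((-Complex.I / (h : ℂ)) • ψ t) t) {c : ℝ → ℝ} (hc : ContDiff ℝ ∞ c)
    (hcs : HasCompactSupport c) {T : ℝ} (hT : 0 < T) (E : ℝ) :
    (∫ t, ((c (t / T) : ℂ) * Complex.exp (Complex.I * (t * E / h : ℝ))) • φ t,
      (E : ℂ) • (∫ t, ((c (t / T) : ℂ) * Complex.exp (Complex.I * (t * E / h : ℝ))) • φ t) -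
        (Complex.I * (h / T : ℝ)) •
          ∫ t, (((deriv c (t / T) : ℝ) : ℂ) * Complex.exp (Complex.I * (t * E / h : ℝ))) • φ t) ∈ G := by
  set e : ℝ → ℂ := fun t => Complex.exp (Complex.I * (t * E / h : ℝ)) with he
  have hec : Continuous e := by fun_prop
  have hcT : Continuous fun t => c (t / T) := by have := hc.continuous; fun_prop
  have hdc : Continuous (deriv c) := hc.continuous_deriv (by simp)
  have hint : ∀ (b : ℝ → ℝ) (φ : ℝ → H), Continuous b → HasCompactSupport b → Continuous φ →
      Integrable fun t => ((b (t / T) : ℂ) * e t) • φ t := by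
    intro b φ hb hbs hφ
    have hb' : Continuous fun t => b (t / T) := by fun_prop
    refine Continuous.integrable_of_hasCompactSupport (by fun_prop) ?_
    refine HasCompactSupport.smul_right (HasCompactSupport.mul_right ?_)
    exact (hasCompactSupport_comp_div hbs hT).comp_left (g := fun x : ℝ => (x : ℂ))
      Complex.ofReal_zero
  have i1 := hint c _ hc.continuous hcs hφ
  have i2 := hint c _ hc.continuous hcs hψ
  have i3 := hint (deriv c) _ hdc hcs.deriv hφ
  have hmem := Submodule.integral_prodMk_mem hG i1 i2
    (by fun_prop) (fun t => Submodule.smul_mem _ ((c (t / T) : ℂ) * e t) (hmem t))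
  -- The derivative of χ(t/T)e^{itE/h}ψ_t has integral zero. Its three terms are the averages with
  -- weight χ', with factor E, and with P applied; multiplication by -ih solves for the last.
  have hd' : ∀ t, HasDerivAt (fun t => ((c (t / T) : ℂ) * e t) • φ t)
      ((1 / T : ℂ) • ((((deriv c (t / T) : ℝ) : ℂ) * e t) • φ t) +
        ((Complex.I * E / h : ℂ) • (((c (t / T) : ℂ) * e t) • φ t) +
          (-Complex.I / h : ℂ) • (((c (t / T) : ℂ) * e t) • ψ t))) t := by
    intro t
    have d1 : HasDerivAt (fun t => (c (t / T) : ℂ)) ((deriv c (t / T) * (1 / T) : ℝ) : ℂ) t :=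
      HasDerivAt.ofReal_comp (((hc.differentiable (by simp)) _).hasDerivAt.comp t
        ((hasDerivAt_id t).div_const T))
    have d2 : HasDerivAt e (e t * (Complex.I * ((1 * E / h : ℝ) : ℂ))) t :=
      ((HasDerivAt.ofReal_comp (((hasDerivAt_id t).mul_const E).div_const h)).const_mul
        Complex.I).cexp
    refine ((d1.mul d2).smul (hd t)).congr_deriv ?_
    simp only [Pi.mul_apply]
    push_cast
    module
  have h0 := integral_eq_zero_of_hasDerivAt_of_integrable hd'
    ((i3.smul _).add ((i1.smul _).add (i2.smul _))) i1
  have h1 : ∫ t, ((1 / T : ℂ) • ((((deriv c (t / T) : ℝ) : ℂ) * e t) • φ t) +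
        ((Complex.I * E / h : ℂ) • (((c (t / T) : ℂ) * e t) • φ t) +
          (-Complex.I / h : ℂ) • (((c (t / T) : ℂ) * e t) • ψ t))) =
      (1 / T : ℂ) • (∫ t, (((deriv c (t / T) : ℝ) : ℂ) * e t) • φ t) +
        ((Complex.I * E / h : ℂ) • (∫ t, ((c (t / T) : ℂ) * e t) • φ t) +
          (-Complex.I / h : ℂ) • ∫ t, ((c (t / T) : ℂ) * e t) • ψ t) := by
    rw [← integral_smul, ← integral_smul, ← integral_smul]
    exact (integral_add (i3.smul _) ((i1.smul _).add (i2.smul _))).trans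
      (congrArg _ (integral_add (i1.smul _) (i2.smul _)))
  rw [h1] at h0
  generalize (∫ t, ((c (t / T) : ℂ) * e t) • φ t) = A at h0 hmem ⊢
  generalize (∫ t, ((c (t / T) : ℂ) * e t) • ψ t) = B at h0 hmem ⊢
  generalize (∫ t, (((deriv c (t / T) : ℝ) : ℂ) * e t) • φ t) = D at h0 ⊢
  have hh' : (h : ℂ) ≠ 0 := by exact_mod_cast hh.ne'
  have hT' : (T : ℂ) ≠ 0 := by exact_mod_cast hT.ne'
  have h2 : (E : ℂ) • A - (Complex.I * (h / T : ℝ)) • D = B := by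
    have h3 := congrArg (fun x => (-Complex.I * h) • x) h0
    simp only [smul_add, smul_smul, smul_zero] at h3
    have e1 : -Complex.I * h * (Complex.I * E / h) = E := by
      field_simp; linear_combination (-E : ℂ) * Complex.I_sq
    have e2 : -Complex.I * h * (-Complex.I / h) = -1 := by
      field_simp; linear_combination Complex.I_sq
    have e3 : -Complex.I * h * (1 / T) = -(Complex.I * (h / T : ℝ)) := by
      push_cast; ring
    rw [e1, e2, e3] at h3
    rw [← sub_eq_zero, ← h3]
    module
  rw [h2]
  exact hmem

namespace QuantumNormalForm

variable (F : QuantumNormalForm)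

/-- Multiplication by p commutes with the phase, so this curve is the evolution of another Schwartz
amplitude, already known to be differentiable. -/
theorem continuous_operatorEvolution (h : ℝ) (n : ℤ) : Continuous (F.operatorEvolution h n) := by
  set p := F.sectorPoly h (F.frequency h n) with hp
  have h1 : F.operatorEvolution h n = fun t => spectralSector (F.frequency h n)
      (phaseMul p (t / h) (Polynomial.aeval freqMul p (𝓕 (beamProfile h)))) := by
    ext1 t
    rw [operatorEvolution]
    congr 1
    ext η
    rw [aeval_freqMul_apply, phaseMul_apply, phaseMul_apply, aeval_freqMul_apply]
    ring
  rw [h1]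
  have h2 : Continuous fun s => spectralSector (F.frequency h n)
      (phaseMul p s (Polynomial.aeval freqMul p (𝓕 (beamProfile h)))) :=
    continuous_iff_continuousAt.2 fun s =>
      (hasDerivAt_spectralSector_phaseMul (F.frequency h n) p _ s).continuousAt
  exact h2.comp (continuous_id.div_const h)

theorem quasimode_mem_closure {h : ℝ} (hh : 0 < h) (n : ℤ) {c : ℝ → ℝ} (hc : ContDiff ℝ ∞ c)
    (hcs : HasCompactSupport c) {T : ℝ} (hT : 0 < T) (E : ℝ) :
    (quasimode h (F.evolution h n) c T E,
      (E : ℂ) • quasimode h (F.evolution h n) c T E -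
        (Complex.I * (h / T : ℝ)) • quasimode h (F.evolution h n) (deriv c) T E) ∈
      (F.coreGraph h).topologicalClosure :=
  timeAverage_mem_closure (F.coreGraph h).isClosed_topologicalClosure (F.continuous_evolution h n)
    (F.continuous_operatorEvolution h n) (F.evolution_mem_closure hh n) hh
    (F.hasDerivAt_evolution h n) hc hcs hT E

/-- The terms with E cancel, leaving the average with weight χ' and factor h/T. The scalar z covers
both Ψ (z = 1) and its normalization. -/
theorem quasimode_mem_domain {h : ℝ} (hh : 0 < h) (n : ℤ) {c : ℝ → ℝ} (hc : ContDiff ℝ ∞ c)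
    (hcs : HasCompactSupport c) {T : ℝ} (hT : 0 < T) (E : ℝ) (z : ℂ) :
    ∃ hΨ : z • quasimode h (F.evolution h n) c T E ∈ (F.operator h).domain,
      ‖F.operator h ⟨z • quasimode h (F.evolution h n) c T E, hΨ⟩ -
        (E : ℂ) • z • quasimode h (F.evolution h n) c T E‖ =
          ‖z‖ * (h / T * ‖quasimode h (F.evolution h n) (deriv c) T E‖) := by
  obtain ⟨h1, h2⟩ := F.operator_apply_of_mem hh
    (Submodule.smul_mem _ z (F.quasimode_mem_closure hh n hc hcs hT E))
  refine ⟨h1, ?_⟩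
  change F.operator h ⟨z • quasimode h (F.evolution h n) c T E, h1⟩ = z • _ at h2
  rw [h2, smul_sub, smul_comm z, sub_sub_cancel_left, norm_neg, norm_smul, norm_smul, norm_mul,
    Complex.norm_I, one_mul, Complex.norm_real, Real.norm_eq_abs, abs_of_pos (by positivity)]

end QuantumNormalForm

/-! ### Cutoffs and elementary error bounds -/

theorem l2norm_nonneg (c : ℝ → ℝ) : 0 ≤ l2norm c := Real.sqrt_nonneg _

theorem l2norm_sq (c : ℝ → ℝ) : l2norm c ^ 2 = ∫ x, c x ^ 2 :=
  Real.sq_sqrt (integral_nonneg fun _ => sq_nonneg _)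

theorem l2norm_pos {c : ℝ → ℝ} (hc : Continuous c) (hcs : HasCompactSupport c) (h0 : c ≠ 0) :
    0 < l2norm c := by
  obtain ⟨x, hx⟩ := Function.ne_iff.1 h0
  have hs : HasCompactSupport fun x => c x ^ 2 := by
    simp only [sq]; exact hcs.mul_right
  exact Real.sqrt_pos.2 ((hc.pow 2).integral_pos_of_hasCompactSupport_nonneg_nonzero hs
    (fun _ => sq_nonneg _) (x := x) (pow_ne_zero 2 hx))

theorem quasimode_zero (h : ℝ) (ψ : ℝ → ModelL2) (T E : ℝ) : quasimode h ψ 0 T E = 0 := by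
  simp [quasimode]

namespace IsCutoff

variable {χ : ℝ → ℝ}

theorem contDiff (hχ : IsCutoff χ) : ContDiff ℝ ∞ χ := hχ.1

theorem eq_zero (hχ : IsCutoff χ) {x : ℝ} (hx : 1 < |x|) : χ x = 0 := by
  refine image_eq_zero_of_notMem_tsupport fun h => ?_
  exact (abs_lt.2 (hχ.2.1 h)).not_gt hx

theorem hasCompactSupport (hχ : IsCutoff χ) : HasCompactSupport χ :=
  isCompact_Icc.of_isClosed_subset (isClosed_tsupport χ) (hχ.2.1.trans Ioo_subset_Icc_self)

theorem contDiff_deriv (hχ : IsCutoff χ) : ContDiff ℝ ∞ (deriv χ) :=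
  (contDiff_infty_iff_deriv.1 hχ.1).2

theorem deriv_eq_zero (hχ : IsCutoff χ) {x : ℝ} (hx : 1 < |x|) : deriv χ x = 0 := by
  by_contra h
  exact (abs_lt.2 (hχ.2.1 (support_deriv_subset h))).not_gt hx

end IsCutoff

/-- With u = |log h| one has he^u = 1 and u³/3! ≤ e^u. This bounds the error hT³ at logarithmic
times. -/
theorem mul_abs_log_pow_three_le {h : ℝ} (hh : 0 < h) (h1 : h ≤ 1) : h * |Real.log h| ^ 3 ≤ 6 := by
  have h2 : |Real.log h| = -Real.log h := abs_of_nonpos (Real.log_nonpos hh.le h1)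
  have h3 := Real.pow_div_factorial_le_exp (x := |Real.log h|) (abs_nonneg _) 3
  rw [div_le_iff₀ (by positivity)] at h3
  have h4 : h * Real.exp |Real.log h| = 1 := by
    rw [h2, Real.exp_neg, Real.exp_log hh, mul_inv_cancel₀ hh.ne']
  calc h * |Real.log h| ^ 3 ≤ h * (Real.exp |Real.log h| * (3).factorial) :=
        mul_le_mul_of_nonneg_left h3 hh.le
    _ = 6 := by rw [← mul_assoc, h4]; norm_num [Nat.factorial]

theorem mul_pow_three_le_of_le_mul_abs_log {h T a : ℝ} (hh : 0 < h) (h1 : h ≤ 1) (hT : 0 ≤ T)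
    (hTa : T ≤ a * |Real.log h|) : h * T ^ 3 ≤ 6 * |a| ^ 3 := by
  have h2 : T ≤ |a| * |Real.log h| :=
    hTa.trans (mul_le_mul_of_nonneg_right (le_abs_self a) (abs_nonneg _))
  calc h * T ^ 3 ≤ h * (|a| * |Real.log h|) ^ 3 := by gcongr
    _ = h * |Real.log h| ^ 3 * |a| ^ 3 := by ring
    _ ≤ 6 * |a| ^ 3 := by gcongr; exact mul_abs_log_pow_three_le hh h1

/-- Passes from relative errors of squared norms to that of a quotient of norms; the factor 2
reflects 1 + r₁ ≥ 1/2. -/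
theorem Real.abs_sqrt_div_sub_one_le {r₁ r₂ : ℝ} (h₁ : |r₁| ≤ 1 / 2) (h₂ : |r₂| ≤ 1 / 2) :
    |√(1 + r₂) / √(1 + r₁) - 1| ≤ 2 * (|r₁| + |r₂|) := by
  obtain ⟨h3, h4⟩ := abs_le.1 h₁
  obtain ⟨h5, h6⟩ := abs_le.1 h₂
  rw [← Real.sqrt_div (by linarith)]
  set u := (1 + r₂) / (1 + r₁) with hu
  have hu0 : 0 ≤ u := div_nonneg (by linarith) (by linarith)
  have h7 : |√u - 1| ≤ |u - 1| := by
    have : u - 1 = (√u - 1) * (√u + 1) := by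
      have := Real.sq_sqrt hu0
      linear_combination -this
    rw [this, abs_mul, abs_of_nonneg (by positivity : 0 ≤ √u + 1)]
    exact le_mul_of_one_le_right (abs_nonneg _) (by linarith [Real.sqrt_nonneg u])
  refine h7.trans ?_
  have h8 : u - 1 = (r₂ - r₁) / (1 + r₁) := by
    rw [hu]; field_simp [(by linarith : 1 + r₁ ≠ 0)]; ring
  rw [h8, abs_div, abs_of_pos (by linarith : 0 < 1 + r₁), div_le_iff₀ (by linarith)]
  have h9 := abs_sub r₂ r₁
  nlinarith [abs_nonneg r₁, abs_nonneg r₂]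

theorem le_abs_log_of_le_exp_neg {h a : ℝ} (hh : 0 < h) (hle : h ≤ Real.exp (-a)) :
    a ≤ |Real.log h| := by
  have := (Real.log_le_iff_le_exp hh).2 hle
  rw [← abs_neg]
  exact (by linarith : a ≤ -Real.log h).trans (le_abs_self _)

/-! ### Norm asymptotics of the time average and its defect -/

namespace QuantumNormalForm

variable (F : QuantumNormalForm)

/-- The uniform lower bound on S₁ makes the error relative. No sign of the weight is assumed, so the
estimate serves both χ and χ'. A zero weight is treated separately, since its norm cannot be divided
by. -/
theorem exists_norm_sq_quasimode_eq (n₀ : ℕ) (CE : ℝ) {c : ℝ → ℝ} (hc : ContDiff ℝ ∞ c)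
    (hsupp : ∀ x, 1 < |x| → c x = 0) : ∃ K : ℝ, 0 ≤ K ∧ ∀ h : ℝ, 0 < h → h ≤ 1 →
    ∀ n : ℤ, n.natAbs ≤ n₀ → ∀ E : ℝ, |E - F.energy| ≤ CE * h → ∀ T : ℝ, 0 < T →
      ∃ r : ℝ, |r| ≤ K * (1 + h * T ^ 3) / T ∧
        ‖quasimode h (F.evolution h n) c T E‖ ^ 2 =
          T * S1 F.rate ((E - F.centralEnergy h n) / h) * l2norm c ^ 2 * (1 + r) := by
  have hcs : HasCompactSupport c := by
    refine HasCompactSupport.of_support_subset_isCompact (isCompact_Icc (a := -1) (b := 1)) ?_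
    intro x hx
    by_contra hne
    rw [mem_Icc, ← abs_le, not_le] at hne
    exact hx (hsupp x hne)
  rcases eq_or_ne c 0 with rfl | h0
  · refine ⟨0, le_rfl, fun h _ _ n _ E _ T _ => ⟨0, by simp, ?_⟩⟩
    simp [quasimode_zero, l2norm]
  obtain ⟨K, hK, hb⟩ := F.exists_norm_sq_quasimode_bound n₀ hc hsupp
  obtain ⟨Θ, hΘ⟩ := F.exists_theta_bound n₀ CE
  obtain ⟨s, hs, hs'⟩ := S1_bounds F.rate_pos Θ
  have hl := l2norm_pos hc.continuous hcs h0
  refine ⟨K / (s * l2norm c ^ 2), by positivity, fun h hh h1 n hn E hE T hT => ?_⟩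
  have h2 := hb h hh h1 n hn E T hT
  have h3 : s ≤ S1 F.rate ((E - F.centralEnergy h n) / h) := hs' _ (hΘ h hh h1 n hn E hE)
  set S := S1 F.rate ((E - F.centralEnergy h n) / h)
  set X := ‖quasimode h (F.evolution h n) c T E‖ ^ 2
  have hS : 0 < S := hs.trans_le h3
  refine ⟨(X - T * S * l2norm c ^ 2) / (T * S * l2norm c ^ 2), ?_, ?_⟩
  · rw [abs_div, abs_of_pos (by positivity : 0 < T * S * l2norm c ^ 2)]
    calc _ ≤ K * (1 + h * T ^ 3) / (T * s * l2norm c ^ 2) := by gcongr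
      _ = _ := by field_simp
  · field_simp
    ring

theorem exists_norm_sq_quasimode_ehrenfest (n₀ : ℕ) (CE : ℝ) {ε : ℝ} (hε : ε < 1) {c : ℝ → ℝ}
    (hc : ContDiff ℝ ∞ c) (hsupp : ∀ x, 1 < |x| → c x = 0) :
    ∃ K : ℝ, 0 ≤ K ∧ ∀ h : ℝ, 0 < h → h < 1 →
    ∀ n : ℤ, n.natAbs ≤ n₀ → ∀ E : ℝ, |E - F.energy| ≤ CE * h →
      ∃ r : ℝ, |r| ≤ K / |Real.log h| ∧
        ‖quasimode h (F.evolution h n) c (ehrenfestTime F.rate ε h) E‖ ^ 2 =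
          ehrenfestTime F.rate ε h * S1 F.rate ((E - F.centralEnergy h n) / h) *
            l2norm c ^ 2 * (1 + r) := by
  obtain ⟨K, hK, hb⟩ := F.exists_norm_sq_quasimode_eq n₀ CE hc hsupp
  set a : ℝ := (1 - ε) / (2 * F.rate) with ha
  have ha0 : 0 < a := div_pos (by linarith) (mul_pos two_pos F.rate_pos)
  refine ⟨K * (1 + 6 * |a| ^ 3) / a, by positivity, fun h hh h1 n hn E hE => ?_⟩
  have hlog : 0 < |Real.log h| := abs_pos.2 (Real.log_neg hh h1).ne
  have hT : ehrenfestTime F.rate ε h = a * |Real.log h| := by rw [ehrenfestTime, ha]; ring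
  obtain ⟨r, hr, heq⟩ := hb h hh h1.le n hn E hE (ehrenfestTime F.rate ε h) (by rw [hT]; positivity)
  refine ⟨r, hr.trans ?_, heq⟩
  have h3 := mul_pow_three_le_of_le_mul_abs_log hh h1.le (by rw [hT]; positivity) hT.le
  rw [div_div, ← hT]
  have : 0 < ehrenfestTime F.rate ε h := by rw [hT]; positivity
  gcongr

theorem ehrenfestTime_pos {ε h : ℝ} (hε : ε < 1) (hh : 0 < h) (h1 : h < 1) :
    0 < ehrenfestTime F.rate ε h :=
  div_pos (mul_pos (by linarith) (abs_pos.2 (Real.log_neg hh h1).ne))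
    (mul_pos two_pos F.rate_pos)

/-- The square norm of the time average. -/
theorem exists_norm_sq_timeAverage (χ : ℝ → ℝ) (hχ : IsCutoff χ) (C CE : ℝ) (n₀ : ℕ) : ∃ K : ℝ,
    ∀ h : ℝ, 0 < h → h ≤ 1 → ∀ n : ℤ, n.natAbs ≤ n₀ → ∀ E : ℝ, |E - F.energy| ≤ CE * h →
      ∀ T : ℝ, 1 ≤ T → T ≤ C * |Real.log h| → ∀ ψ : ℝ → ModelL2, F.IsEvolution h n ψ →
        ∃ r : ℝ, |r| ≤ K / T ∧ ‖quasimode h ψ χ T E‖ ^ 2 =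
          T * S1 F.rate ((E - F.centralEnergy h n) / h) * l2norm χ ^ 2 * (1 + r) := by
  obtain ⟨K, hK, hb⟩ := F.exists_norm_sq_quasimode_eq n₀ CE hχ.contDiff fun x => hχ.eq_zero
  refine ⟨K * (1 + 6 * |C| ^ 3), fun h hh h1 n hn E hE T hT hTC ψ hψ => ?_⟩
  rw [hψ.eq_evolution F hh]
  obtain ⟨r, hr, heq⟩ := hb h hh h1 n hn E hE T (by linarith)
  refine ⟨r, hr.trans ?_, heq⟩
  have := mul_pow_three_le_of_le_mul_abs_log hh h1 (by linarith) hTC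
  gcongr

/-- The square norm of `(P - E) Ψ` at the Ehrenfest time. -/
theorem exists_norm_sq_defect (χ : ℝ → ℝ) (hχ : IsCutoff χ) (ε : ℝ) (hε : ε < 1) (CE : ℝ) (n₀ : ℕ) :
    ∃ K : ℝ, ∀ h : ℝ, 0 < h → h ≤ 1 / 2 → ∀ n : ℤ, n.natAbs ≤ n₀ →
      ∀ E : ℝ, |E - F.energy| ≤ CE * h → ∀ ψ : ℝ → ModelL2, F.IsEvolution h n ψ →
        ∃ hΨ : quasimode h ψ χ (ehrenfestTime F.rate ε h) E ∈ (F.operator h).domain,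
        ∃ r : ℝ, |r| ≤ K / |Real.log h| ∧
          ‖F.operator h ⟨quasimode h ψ χ (ehrenfestTime F.rate ε h) E, hΨ⟩
              - (E : ℂ) • quasimode h ψ χ (ehrenfestTime F.rate ε h) E‖ ^ 2 =
            h ^ 2 / ehrenfestTime F.rate ε h * S1 F.rate ((E - F.centralEnergy h n) / h)
              * l2norm (deriv χ) ^ 2 * (1 + r) := by
  obtain ⟨K, hK, hb⟩ := F.exists_norm_sq_quasimode_ehrenfest n₀ CE hε hχ.contDiff_deriv
    fun x => hχ.deriv_eq_zero
  refine ⟨K, fun h hh h1 n hn E hE ψ hψ => ?_⟩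
  rw [hψ.eq_evolution F hh]
  have h1' : h < 1 := by linarith
  have hT := F.ehrenfestTime_pos hε hh h1'
  obtain ⟨r, hr, heq⟩ := hb h hh h1' n hn E hE
  have hdom := F.quasimode_mem_domain hh n hχ.contDiff hχ.hasCompactSupport hT E 1
  simp only [one_smul, norm_one, one_mul] at hdom
  obtain ⟨hΨ, hnorm⟩ := hdom
  refine ⟨hΨ, r, hr, ?_⟩
  rw [hnorm, mul_pow, heq]
  field_simp

/-- The width of the normalized time average. -/
theorem exists_norm_normalized_defect (χ : ℝ → ℝ) (hχ : IsCutoff χ) (hχ0 : χ ≠ 0) (ε : ℝ)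
    (hε : ε < 1) (CE : ℝ) (n₀ : ℕ) :
    ∃ K h₀ : ℝ, 0 < h₀ ∧ h₀ ≤ 1 / 2 ∧ ∀ h : ℝ, 0 < h → h ≤ h₀ → ∀ n : ℤ, n.natAbs ≤ n₀ →
      ∀ E : ℝ, |E - F.energy| ≤ CE * h → ∀ ψ : ℝ → ModelL2, F.IsEvolution h n ψ →
        quasimode h ψ χ (ehrenfestTime F.rate ε h) E ≠ 0 ∧
        ∃ hΨ : normalizedQuasimode h ψ χ (ehrenfestTime F.rate ε h) E ∈ (F.operator h).domain,
        ∃ r : ℝ, |r| ≤ K / |Real.log h| ∧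
          ‖F.operator h ⟨normalizedQuasimode h ψ χ (ehrenfestTime F.rate ε h) E, hΨ⟩
              - (E : ℂ) • normalizedQuasimode h ψ χ (ehrenfestTime F.rate ε h) E‖ =
            h / ehrenfestTime F.rate ε h * (l2norm (deriv χ) / l2norm χ) * (1 + r) := by
  obtain ⟨K₁, hK₁, hb₁⟩ := F.exists_norm_sq_quasimode_ehrenfest n₀ CE hε hχ.contDiff
    fun x => hχ.eq_zero
  obtain ⟨K₂, hK₂, hb₂⟩ := F.exists_norm_sq_quasimode_ehrenfest n₀ CE hε hχ.contDiff_deriv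
    fun x => hχ.deriv_eq_zero
  have hl := l2norm_pos hχ.contDiff.continuous hχ.hasCompactSupport hχ0
  -- This h₀ forces |log h| ≥ 2(K₁ + K₂), so both relative errors are at most 1/2 and Ψ cannot
  -- vanish.
  refine ⟨2 * (K₁ + K₂), min (1 / 2) (Real.exp (-(2 * (K₁ + K₂)))), by positivity, min_le_left _ _,
    fun h hh h1 n hn E hE ψ hψ => ?_⟩
  rw [hψ.eq_evolution F hh]
  have h1' : h < 1 := by linarith [h1.trans (min_le_left _ _)]
  have hlog : 0 < |Real.log h| := abs_pos.2 (Real.log_neg hh h1').ne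
  have hK := le_abs_log_of_le_exp_neg hh (h1.trans (min_le_right _ _))
  have hT := F.ehrenfestTime_pos hε hh h1'
  obtain ⟨r₁, hr₁, heq₁⟩ := hb₁ h hh h1' n hn E hE
  obtain ⟨r₂, hr₂, heq₂⟩ := hb₂ h hh h1' n hn E hE
  have hr₁' : |r₁| ≤ 1 / 2 := hr₁.trans (by rw [div_le_iff₀ hlog]; linarith)
  have hr₂' : |r₂| ≤ 1 / 2 := hr₂.trans (by rw [div_le_iff₀ hlog]; linarith)
  have hS : 0 < S1 F.rate ((E - F.centralEnergy h n) / h) := S1_pos F.rate_pos _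
  have e₁ : 0 < 1 + r₁ := by linarith [(abs_le.1 hr₁').1]
  have e₂ : 0 < 1 + r₂ := by linarith [(abs_le.1 hr₂').1]
  set T := ehrenfestTime F.rate ε h
  set S := S1 F.rate ((E - F.centralEnergy h n) / h)
  have n₁ : ‖quasimode h (F.evolution h n) χ T E‖ = √(T * S) * l2norm χ * √(1 + r₁) := by
    rw [← Real.sqrt_sq (norm_nonneg _), heq₁, Real.sqrt_mul (by positivity),
      Real.sqrt_mul (by positivity), Real.sqrt_sq (l2norm_nonneg _)]
  have n₂ : ‖quasimode h (F.evolution h n) (deriv χ) T E‖ =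
      √(T * S) * l2norm (deriv χ) * √(1 + r₂) := by
    rw [← Real.sqrt_sq (norm_nonneg _), heq₂, Real.sqrt_mul (by positivity),
      Real.sqrt_mul (by positivity), Real.sqrt_sq (l2norm_nonneg _)]
  have hpos : 0 < ‖quasimode h (F.evolution h n) χ T E‖ := by rw [n₁]; positivity
  refine ⟨norm_pos_iff.1 hpos, ?_⟩
  obtain ⟨hΨ, hnorm⟩ := F.quasimode_mem_domain hh n hχ.contDiff hχ.hasCompactSupport hT E
    ((‖quasimode h (F.evolution h n) χ T E‖⁻¹ : ℝ) : ℂ)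
  -- The factors √(T S₁) of numerator and denominator cancel; only the quotient of the error factors
  -- remains.
  refine ⟨hΨ, √(1 + r₂) / √(1 + r₁) - 1, ?_, ?_⟩
  · refine (Real.abs_sqrt_div_sub_one_le hr₁' hr₂').trans ?_
    rw [mul_div_assoc, add_div]
    linarith
  · refine hnorm.trans ?_
    rw [Complex.norm_real, norm_inv, norm_norm, n₁, n₂]
    have : 0 < √(1 + r₁) := Real.sqrt_pos.2 e₁
    have : 0 < √(T * S) := Real.sqrt_pos.2 (by positivity)
    field_simp
    ring

end QuantumNormalForm

/-! ### The sharp lower bound for the ratio -/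

theorem cos_pi_mul_div_two_pos {t : ℝ} (ht : t ∈ Ioo (-1 : ℝ) 1) :
    0 < Real.cos (Real.pi * t / 2) := by
  have := Real.pi_pos
  exact Real.cos_pos_of_mem_Ioo ⟨by nlinarith [ht.1], by nlinarith [ht.2]⟩

namespace IsCutoff

variable {χ : ℝ → ℝ}

/-- The sharp Poincaré inequality on `(-1, 1)`. -/
theorem mul_l2norm_le (hχ : IsCutoff χ) : Real.pi / 2 * l2norm χ ≤ l2norm (deriv χ) := by
  -- The factor -(π/2)tan(πt/2) is the logarithmic derivative of the ground state cos(πt/2), so χ' +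
  -- (π/2)u vanishes exactly on multiples of it. Its singularities at ±1 are harmless, as χ vanishes
  -- near them.
  set u : ℝ → ℝ := fun t => Real.tan (Real.pi * t / 2) * χ t with hu
  have hdχ : ∀ t, HasDerivAt χ (deriv χ t) t := fun t =>
    (hχ.contDiff.differentiable (by simp) t).hasDerivAt
  have hdu : ∀ t, HasDerivAt u (Real.pi / 2 * (1 + Real.tan (Real.pi * t / 2) ^ 2) * χ t +
      Real.tan (Real.pi * t / 2) * deriv χ t) t := by
    intro t
    by_cases ht : t ∈ tsupport χ
    · have hcos := (cos_pi_mul_div_two_pos (hχ.2.1 ht)).ne'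
      have h1 : HasDerivAt (fun t : ℝ => Real.pi * t / 2) (Real.pi * 1 / 2) t :=
        ((hasDerivAt_id t).const_mul Real.pi).div_const 2
      refine (((Real.hasDerivAt_tan hcos).comp t h1).mul (hdχ t)).congr_deriv ?_
      rw [← Real.inv_one_add_tan_sq hcos]
      simp only [Function.comp_apply]
      field_simp
    · have h0 : χ =ᶠ[nhds t] 0 := notMem_tsupport_iff_eventuallyEq.1 ht
      have h1 : u =ᶠ[nhds t] fun _ => 0 := h0.mono fun s hs => by simp [hu, hs]
      rw [h0.eq_of_nhds, h0.deriv_eq]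
      simpa using (hasDerivAt_const t (0 : ℝ)).congr_of_eventuallyEq h1
  have hcχ := hχ.contDiff.continuous
  have hcd := hχ.contDiff_deriv.continuous
  have hcu : Continuous u := continuous_iff_continuousAt.2 fun t => (hdu t).continuousAt
  have hs := hχ.hasCompactSupport
  have hsu : HasCompactSupport u := hs.mul_left
  have i1 : Integrable fun t => χ t ^ 2 := by
    simp only [sq]; exact (hcχ.mul hcχ).integrable_of_hasCompactSupport hs.mul_right
  have i2 : Integrable fun t => deriv χ t ^ 2 := by
    simp only [sq]; exact (hcd.mul hcd).integrable_of_hasCompactSupport hs.deriv.mul_right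
  have i3 : Integrable fun t => (deriv χ t + Real.pi / 2 * u t) ^ 2 := by
    have hc : HasCompactSupport fun t => deriv χ t + Real.pi / 2 * u t := hs.deriv.add hsu.mul_left
    simp only [sq]
    exact Continuous.integrable_of_hasCompactSupport (by fun_prop) hc.mul_right
  -- The completed square differs from χ'² - (π/2)²χ² by an exact derivative of a compactly
  -- supported function. Integration leaves ‖χ'‖² - (π/2)²‖χ‖² equal to the integral of a square.
  have hd : ∀ t, HasDerivAt (fun t => Real.pi / 2 * (u t * χ t))
      ((deriv χ t + Real.pi / 2 * u t) ^ 2 - deriv χ t ^ 2 + (Real.pi / 2) ^ 2 * χ t ^ 2) t := by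
    intro t
    refine (((hdu t).mul (hdχ t)).const_mul (Real.pi / 2)).congr_deriv ?_
    simp only [hu]
    ring
  have h0 := integral_eq_zero_of_hasDerivAt_of_integrable hd ((i3.sub i2).add (i1.const_mul _))
    (((hcu.mul hcχ).integrable_of_hasCompactSupport hsu.mul_right).const_mul _)
  have h1 : ∫ t, ((deriv χ t + Real.pi / 2 * u t) ^ 2 - deriv χ t ^ 2 +
      (Real.pi / 2) ^ 2 * χ t ^ 2) = (∫ t, (deriv χ t + Real.pi / 2 * u t) ^ 2) -
        (∫ t, deriv χ t ^ 2) + (Real.pi / 2) ^ 2 * ∫ t, χ t ^ 2 := by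
    rw [← integral_const_mul, ← integral_sub i3 i2]
    exact integral_add (i3.sub i2) (i1.const_mul _)
  rw [h1] at h0
  have h2 : 0 ≤ ∫ t, (deriv χ t + Real.pi / 2 * u t) ^ 2 := integral_nonneg fun _ => sq_nonneg _
  refine abs_le_of_sq_le_sq' ?_ (l2norm_nonneg _) |>.2
  rw [mul_pow, l2norm_sq, l2norm_sq]
  linarith

theorem comp_mul_left (hχ : IsCutoff χ) {a : ℝ} (ha : 1 ≤ a) : IsCutoff fun t => χ (a * t) := by
  have ha0 : 0 < a := by linarith
  refine ⟨hχ.contDiff.comp (contDiff_const.mul contDiff_id), fun t ht => ?_, fun t => hχ.2.2 _⟩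
  have h1 : a * t ∈ tsupport χ := by
    have hc : Continuous fun t : ℝ => a * t := by fun_prop
    exact closure_minimal (t := (fun t : ℝ => a * t) ⁻¹' tsupport χ)
      (fun s hs => subset_tsupport χ hs) ((isClosed_tsupport χ).preimage hc) ht
  obtain ⟨h2, h3⟩ := hχ.2.1 h1
  constructor <;> nlinarith

end IsCutoff

/-- Both norms acquire the same factor a^{-1/2} from the substitution, and the chain rule
contributes one more factor a to the numerator. -/
theorem l2norm_deriv_div_l2norm_comp_mul_left (χ : ℝ → ℝ) {a : ℝ} (ha : 0 < a) :
    l2norm (deriv fun t => χ (a * t)) / l2norm (fun t => χ (a * t)) =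
      a * (l2norm (deriv χ) / l2norm χ) := by
  have h1 : ∀ f : ℝ → ℝ, l2norm (fun t => f (a * t)) = √a⁻¹ * l2norm f := by
    intro f
    rw [l2norm, l2norm, Measure.integral_comp_mul_left (fun x => f x ^ 2) a, smul_eq_mul,
      abs_of_pos (by positivity), Real.sqrt_mul (by positivity)]
  have h2 : (deriv fun t => χ (a * t)) = fun t => a * deriv χ (a * t) := by
    ext t
    rw [deriv_comp_mul_left, smul_eq_mul]
  have h3 : ∀ f : ℝ → ℝ, l2norm (fun t => a * f t) = a * l2norm f := by
    intro f
    simp only [l2norm, mul_pow]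
    rw [integral_const_mul, Real.sqrt_mul (by positivity), Real.sqrt_sq ha.le]
  rw [h2, h3 fun t => deriv χ (a * t), h1, h1]
  have : 0 < √a⁻¹ := Real.sqrt_pos.2 (by positivity)
  rw [mul_left_comm, mul_div_mul_left _ _ this.ne', mul_div_assoc]

/-! ### Nearly optimal cutoffs -/

/-- The function equal to `y` for `y ≥ 2δ` and to `0` for `y ≤ δ`. -/
def truncation (δ y : ℝ) : ℝ := y * Real.smoothTransition (y / δ - 1)

theorem truncation_of_le {δ y : ℝ} (hδ : 0 < δ) (hy : y ≤ δ) : truncation δ y = 0 := by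
  rw [truncation, Real.smoothTransition.zero_of_nonpos, mul_zero]
  rw [sub_nonpos, div_le_one hδ]; exact hy

theorem truncation_of_ge {δ y : ℝ} (hδ : 0 < δ) (hy : 2 * δ ≤ y) : truncation δ y = y := by
  rw [truncation, Real.smoothTransition.one_of_one_le, mul_one]
  have : 2 ≤ y / δ := by rwa [le_div_iff₀ hδ]
  linarith

theorem contDiff_truncation (δ : ℝ) : ContDiff ℝ ∞ (truncation δ) :=
  contDiff_id.mul (Real.smoothTransition.contDiff.comp ((contDiff_id.div_const δ).sub contDiff_const))

theorem truncation_mem_Icc {δ y : ℝ} (hδ : 0 < δ) (hy : y ≤ 1) : truncation δ y ∈ Icc (0 : ℝ) 1 := by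
  rcases le_total y δ with h | h
  · rw [truncation_of_le hδ h]; simp
  · have h1 := Real.smoothTransition.nonneg (y / δ - 1)
    have h2 := Real.smoothTransition.le_one (y / δ - 1)
    have h3 : 0 ≤ y := hδ.le.trans h
    exact ⟨mul_nonneg h3 h1, mul_le_one₀ hy h1 h2⟩

/-- With z = y/δ - 1 the derivative depends on z alone, and its nonconstant part lives on 0 ≤ z ≤ 1.
The bound is thus independent of δ, as dominated convergence requires. -/
theorem exists_abs_deriv_truncation_le : ∃ B : ℝ, ∀ δ y : ℝ, |deriv (truncation δ) y| ≤ B := by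
  have hsm : ContDiff ℝ ∞ Real.smoothTransition := Real.smoothTransition.contDiff
  obtain ⟨B, hB⟩ := (isCompact_Icc (a := (0 : ℝ)) (b := 1)).exists_bound_of_continuousOn
    (f := fun z => (z + 1) * deriv Real.smoothTransition z)
    (Continuous.continuousOn (by have := hsm.continuous_deriv (by simp); fun_prop))
  have hB0 : 0 ≤ B := (norm_nonneg _).trans (hB 0 (by simp))
  have hB' : ∀ z, |(z + 1) * deriv Real.smoothTransition z| ≤ B := by
    intro z
    by_cases hz : z ∈ Icc (0 : ℝ) 1
    · exact hB z hz
    · have h0 : deriv Real.smoothTransition z = 0 := by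
        rw [mem_Icc, not_and_or, not_le, not_le] at hz
        rcases hz with hz | hz
        · have : Real.smoothTransition =ᶠ[nhds z] fun _ => 0 :=
            (gt_mem_nhds hz).mono fun s hs => Real.smoothTransition.zero_of_nonpos (le_of_lt hs)
          rw [this.deriv_eq, deriv_const]
        · have : Real.smoothTransition =ᶠ[nhds z] fun _ => 1 :=
            (lt_mem_nhds hz).mono fun s hs => Real.smoothTransition.one_of_one_le (le_of_lt hs)
          rw [this.deriv_eq, deriv_const]
      rw [h0, mul_zero, abs_zero]
      exact hB0
  refine ⟨1 + B, fun δ y => ?_⟩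
  have hd : HasDerivAt (truncation δ) (1 * Real.smoothTransition (y / δ - 1) +
      y * (deriv Real.smoothTransition (y / δ - 1) * (1 / δ))) y :=
    (hasDerivAt_id y).mul (((hsm.differentiable (by simp)) _).hasDerivAt.comp y
      (((hasDerivAt_id y).div_const δ).sub_const 1))
  rw [hd.deriv]
  have e : y * (deriv Real.smoothTransition (y / δ - 1) * (1 / δ)) =
      (y / δ - 1 + 1) * deriv Real.smoothTransition (y / δ - 1) := by ring
  rw [e, one_mul]
  refine (abs_add_le _ _).trans (add_le_add ?_ (hB' _))
  rw [abs_of_nonneg (Real.smoothTransition.nonneg _)]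
  exact Real.smoothTransition.le_one _

/-- A bump function equal to `1` on `[-1, 1]` and supported in `(-2, 2)`. -/
def unitBump : ContDiffBump (0 : ℝ) := ⟨1, 2, one_pos, one_lt_two⟩

/-- A cutoff that approximates `cos(πt/2)` on `(-1, 1)`. -/
def cosCutoff (δ t : ℝ) : ℝ := unitBump t * truncation δ (Real.cos (Real.pi * t / 2))

theorem cosCutoff_of_mem {δ t : ℝ} (ht : t ∈ Icc (-1 : ℝ) 1) :
    cosCutoff δ t = truncation δ (Real.cos (Real.pi * t / 2)) := by
  have : t ∈ Metric.closedBall (0 : ℝ) unitBump.rIn := by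
    rw [mem_closedBall_zero_iff]; exact abs_le.2 ht
  rw [cosCutoff, unitBump.one_of_mem_closedBall this, one_mul]

/-- The cosine is nonpositive for 1 ≤ |t| ≤ 2, where the truncation removes it; farther out the bump
removes the other periods. -/
theorem cosCutoff_ne_zero {δ t : ℝ} (hδ : 0 < δ) (ht : cosCutoff δ t ≠ 0) :
    t ∈ Icc (-1 : ℝ) 1 ∧ δ ≤ Real.cos (Real.pi * t / 2) := by
  have hpi := Real.pi_pos
  have h1 : unitBump t ≠ 0 := left_ne_zero_of_mul ht
  have h2 : truncation δ (Real.cos (Real.pi * t / 2)) ≠ 0 := right_ne_zero_of_mul ht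
  have h3 : δ ≤ Real.cos (Real.pi * t / 2) := by
    by_contra hlt
    exact h2 (truncation_of_le hδ (not_le.1 hlt).le)
  refine ⟨?_, h3⟩
  have h4 : |t| < 2 := by
    have : t ∈ Function.support unitBump := h1
    rw [unitBump.support_eq, mem_ball_zero_iff] at this
    exact this
  by_contra hne
  rw [mem_Icc, ← abs_le, not_le] at hne
  have h5 : Real.cos (Real.pi * |t| / 2) ≤ 0 :=
    Real.cos_nonpos_of_pi_div_two_le_of_le (by nlinarith) (by nlinarith)
  have h6 : Real.cos (Real.pi * |t| / 2) = Real.cos (Real.pi * t / 2) := by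
    rw [← Real.cos_abs (Real.pi * t / 2), abs_div, abs_mul, abs_of_pos hpi, abs_two]
  linarith

theorem isCutoff_cosCutoff {δ : ℝ} (hδ : 0 < δ) : IsCutoff (cosCutoff δ) := by
  refine ⟨?_, ?_, fun t => ?_⟩
  · exact unitBump.contDiff.mul ((contDiff_truncation δ).comp
      (Real.contDiff_cos.comp ((contDiff_const.mul contDiff_id).div_const 2)))
  · have hcl : IsClosed {t : ℝ | t ∈ Icc (-1 : ℝ) 1 ∧ δ ≤ Real.cos (Real.pi * t / 2)} :=
      isClosed_Icc.inter (isClosed_le (f := fun _ : ℝ => δ)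
        (g := fun t : ℝ => Real.cos (Real.pi * t / 2)) continuous_const (by fun_prop))
    refine (closure_minimal (fun t ht => cosCutoff_ne_zero hδ ht) hcl).trans ?_
    rintro t ⟨⟨h1, h2⟩, h3⟩
    refine ⟨lt_of_le_of_ne h1 ?_, lt_of_le_of_ne h2 ?_⟩
    · rintro rfl
      have : Real.pi * -1 / 2 = -(Real.pi / 2) := by ring
      rw [this, Real.cos_neg, Real.cos_pi_div_two] at h3
      linarith
    · rintro rfl
      rw [mul_one, Real.cos_pi_div_two] at h3
      linarith
  · have h1 := truncation_mem_Icc hδ (Real.cos_le_one (Real.pi * t / 2))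
    exact ⟨mul_nonneg unitBump.nonneg h1.1, mul_le_one₀ unitBump.le_one h1.1 h1.2⟩

theorem cosCutoff_eventuallyEq {δ t : ℝ} (hδ : 0 < δ) (ht : t ∈ Ioo (-1 : ℝ) 1)
    (hcos : 2 * δ < Real.cos (Real.pi * t / 2)) :
    cosCutoff δ =ᶠ[nhds t] fun s => Real.cos (Real.pi * s / 2) := by
  have h1 : ∀ᶠ s in nhds t, 2 * δ < Real.cos (Real.pi * s / 2) :=
    (isOpen_lt (f := fun _ : ℝ => 2 * δ) (g := fun s : ℝ => Real.cos (Real.pi * s / 2))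
      continuous_const (by fun_prop)).mem_nhds hcos
  filter_upwards [h1, Ioo_mem_nhds ht.1 ht.2] with s h2 h3
  rw [cosCutoff_of_mem ⟨h3.1.le, h3.2.le⟩, truncation_of_ge hδ h2.le]

theorem hasDerivAt_cos_pi_mul_div_two (t : ℝ) : HasDerivAt (fun s => Real.cos (Real.pi * s / 2))
    (-Real.sin (Real.pi * t / 2) * (Real.pi / 2)) t := by
  have h1 : HasDerivAt (fun t : ℝ => Real.pi * t / 2) (Real.pi * 1 / 2) t :=
    ((hasDerivAt_id t).const_mul Real.pi).div_const 2
  rw [mul_one] at h1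
  exact h1.cos

theorem exists_abs_deriv_cosCutoff_le : ∃ B : ℝ, ∀ δ t : ℝ, 0 < δ → |deriv (cosCutoff δ) t| ≤ B := by
  obtain ⟨B, hB⟩ := exists_abs_deriv_truncation_le
  have hB0 : 0 ≤ B := (abs_nonneg _).trans (hB 1 1)
  have hpi := Real.pi_pos
  refine ⟨B * (Real.pi / 2), fun δ t hδ => ?_⟩
  by_cases ht : t ∈ Ioo (-1 : ℝ) 1
  · have h1 : cosCutoff δ =ᶠ[nhds t] fun s => truncation δ (Real.cos (Real.pi * s / 2)) := by
      filter_upwards [Ioo_mem_nhds ht.1 ht.2] with s h3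
      exact cosCutoff_of_mem ⟨h3.1.le, h3.2.le⟩
    have h2 := ((((contDiff_truncation δ).differentiable (by simp)) _).hasDerivAt.comp t
      (hasDerivAt_cos_pi_mul_div_two t)).congr_of_eventuallyEq h1
    rw [h2.deriv, abs_mul, abs_mul, abs_neg, abs_of_pos (by positivity : 0 < Real.pi / 2)]
    refine mul_le_mul (hB _ _) ?_ (by positivity) hB0
    exact mul_le_of_le_one_left (by positivity) (Real.abs_sin_le_one _)
  · have : deriv (cosCutoff δ) t = 0 := by
      by_contra h
      exact ht ((isCutoff_cosCutoff hδ).2.1 (support_deriv_subset h))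
    rw [this, abs_zero]
    positivity

theorem integral_Ioo_cos_sq : ∫ t in Ioo (-1 : ℝ) 1, Real.cos (Real.pi * t / 2) ^ 2 = 1 := by
  have hd : ∀ t ∈ uIcc (-1 : ℝ) 1, HasDerivAt
      (fun t => t / 2 + Real.sin (Real.pi * t) / (2 * Real.pi)) (Real.cos (Real.pi * t / 2) ^ 2) t := by
    intro t _
    refine (((hasDerivAt_id t).div_const 2).add
      ((((hasDerivAt_id t).const_mul Real.pi).sin).div_const (2 * Real.pi))).congr_deriv ?_
    have h1 : Real.pi * t = 2 * (Real.pi * t / 2) := by ring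
    simp only [id_eq]
    rw [Real.cos_sq, ← h1]
    field_simp
  rw [← integral_Ioc_eq_integral_Ioo, ← intervalIntegral.integral_of_le (by norm_num),
    intervalIntegral.integral_eq_sub_of_hasDerivAt hd
      (Continuous.intervalIntegrable (by fun_prop) _ _)]
  simp
  norm_num

theorem integral_Ioo_deriv_cos_sq : ∫ t in Ioo (-1 : ℝ) 1,
    (-Real.sin (Real.pi * t / 2) * (Real.pi / 2)) ^ 2 = (Real.pi / 2) ^ 2 := by
  have h1 : ∀ t : ℝ, (-Real.sin (Real.pi * t / 2) * (Real.pi / 2)) ^ 2 =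
      (Real.pi / 2) ^ 2 * (1 - Real.cos (Real.pi * t / 2) ^ 2) := fun t => by
    rw [Real.cos_sq']; ring
  have h2 : IntegrableOn (fun t : ℝ => Real.cos (Real.pi * t / 2) ^ 2) (Ioo (-1) 1) :=
    (Continuous.integrableOn_Icc (by fun_prop)).mono_set Ioo_subset_Icc_self
  have h3 : IntegrableOn (fun _ : ℝ => (1 : ℝ)) (Ioo (-1) 1) := integrableOn_const (by simp)
  simp_rw [h1]
  rw [integral_const_mul, integral_sub h3 h2, integral_Ioo_cos_sq]
  simp

theorem IsCutoff.l2norm_eq_sqrt_setIntegral {χ : ℝ → ℝ} (hχ : IsCutoff χ) :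
    l2norm χ = √(∫ t in Ioo (-1 : ℝ) 1, χ t ^ 2) ∧
      l2norm (deriv χ) = √(∫ t in Ioo (-1 : ℝ) 1, deriv χ t ^ 2) := by
  constructor
  · rw [l2norm, setIntegral_eq_integral_of_forall_compl_eq_zero]
    intro t ht
    rw [image_eq_zero_of_notMem_tsupport fun h => ht (hχ.2.1 h), sq, zero_mul]
  · rw [l2norm, setIntegral_eq_integral_of_forall_compl_eq_zero]
    intro t ht
    rw [sq_eq_zero_iff]
    by_contra h
    exact ht (hχ.2.1 (support_deriv_subset h))

/-- At each t in (-1, 1) the cutoff eventually agrees with the cosine in a neighbourhood, so values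
and derivatives converge pointwise; dominated convergence applies to both integrals. -/
theorem tendsto_l2norm_cosCutoff :
    Filter.Tendsto (fun n : ℕ => l2norm (deriv (cosCutoff (1 / ((n : ℝ) + 2)))) /
      l2norm (cosCutoff (1 / ((n : ℝ) + 2)))) Filter.atTop (nhds (Real.pi / 2)) := by
  set δ : ℕ → ℝ := fun n => 1 / ((n : ℝ) + 2) with hδ
  have hδ0 : ∀ n, 0 < δ n := fun n => by positivity
  have hδt : Filter.Tendsto δ Filter.atTop (nhds 0) :=
    (Filter.tendsto_atTop_add_const_right _ 2 tendsto_natCast_atTop_atTop).const_div_atTop 1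
  have hev : ∀ t ∈ Ioo (-1 : ℝ) 1, ∀ᶠ n in Filter.atTop,
      cosCutoff (δ n) =ᶠ[nhds t] fun s => Real.cos (Real.pi * s / 2) := by
    intro t ht
    have h1 : ∀ᶠ n in Filter.atTop, δ n < Real.cos (Real.pi * t / 2) / 2 :=
      hδt.eventually (gt_mem_nhds (half_pos (cos_pi_mul_div_two_pos ht)))
    filter_upwards [h1] with n hn
    exact cosCutoff_eventuallyEq (hδ0 n) ht (by linarith)
  have hfin : ∀ B : ℝ, Integrable (fun _ : ℝ => B) (volume.restrict (Ioo (-1 : ℝ) 1)) := fun B =>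
    integrableOn_const (by simp)
  obtain ⟨B, hB⟩ := exists_abs_deriv_cosCutoff_le
  have h1 : Filter.Tendsto (fun n => ∫ t in Ioo (-1 : ℝ) 1, cosCutoff (δ n) t ^ 2) Filter.atTop
      (nhds 1) := by
    rw [show nhds (1 : ℝ) = nhds (∫ t in Ioo (-1 : ℝ) 1, Real.cos (Real.pi * t / 2) ^ 2) by
      rw [integral_Ioo_cos_sq]]
    refine tendsto_integral_of_dominated_convergence (F := fun n t => cosCutoff (δ n) t ^ 2)
      (fun _ => 1)
      (fun n => ((isCutoff_cosCutoff (hδ0 n)).contDiff.continuous.pow 2).aestronglyMeasurable)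
      (hfin 1) (fun n => Filter.Eventually.of_forall fun t => ?_)
      ((ae_restrict_mem measurableSet_Ioo).mono fun t ht => ?_)
    · obtain ⟨h2, h3⟩ := (isCutoff_cosCutoff (hδ0 n)).2.2 t
      rw [Real.norm_eq_abs, abs_of_nonneg (sq_nonneg _)]
      exact pow_le_one₀ h2 h3
    · exact tendsto_const_nhds.congr' ((hev t ht).mono fun n hn => by
        change _ = cosCutoff (δ n) t ^ 2
        rw [hn.eq_of_nhds])
  have h2 : Filter.Tendsto (fun n => ∫ t in Ioo (-1 : ℝ) 1, deriv (cosCutoff (δ n)) t ^ 2)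
      Filter.atTop (nhds ((Real.pi / 2) ^ 2)) := by
    rw [← integral_Ioo_deriv_cos_sq]
    refine tendsto_integral_of_dominated_convergence (fun _ => B ^ 2)
      (fun n => ((isCutoff_cosCutoff (hδ0 n)).contDiff_deriv.continuous.pow 2).aestronglyMeasurable)
      (hfin _) (fun n => Filter.Eventually.of_forall fun t => ?_)
      ((ae_restrict_mem measurableSet_Ioo).mono fun t ht => ?_)
    · rw [Real.norm_eq_abs, abs_of_nonneg (sq_nonneg _), ← sq_abs]
      exact pow_le_pow_left₀ (abs_nonneg _) (hB _ t (hδ0 n)) 2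
    · exact tendsto_const_nhds.congr' ((hev t ht).mono fun n hn => by
        change _ = deriv (cosCutoff (δ n)) t ^ 2
        rw [hn.deriv_eq, (hasDerivAt_cos_pi_mul_div_two t).deriv])
  have h3 := (h2.sqrt.div h1.sqrt (by simp))
  rw [Real.sqrt_sq (by positivity), Real.sqrt_one, div_one] at h3
  refine h3.congr fun n => ?_
  obtain ⟨e1, e2⟩ := (isCutoff_cosCutoff (hδ0 n)).l2norm_eq_sqrt_setIntegral
  change _ = l2norm (deriv (cosCutoff (δ n))) / l2norm (cosCutoff (δ n))
  rw [e1, e2]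
  rfl

theorem cosCutoff_one_div_ne_zero (n : ℕ) : cosCutoff (1 / ((n : ℝ) + 2)) ≠ 0 := by
  refine Function.ne_iff.2 ⟨0, ?_⟩
  -- The shift by 2 in δ = 1/(n + 2) ensures 2δ ≤ 1 = cos 0, so the truncation leaves the value 1 at
  -- the origin for every n.
  have h1 : 2 * (1 / ((n : ℝ) + 2)) ≤ 1 := by
    rw [mul_one_div, div_le_one (by positivity)]; linarith [n.cast_nonneg (α := ℝ)]
  rw [cosCutoff_of_mem (by simp), mul_zero, zero_div, Real.cos_zero,
    truncation_of_ge (by positivity) h1]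
  simp

/-- The optimal ratio over all cutoffs. -/
theorem isGLB_l2norm_deriv_div_l2norm :
    IsGLB {ρ : ℝ | ∃ χ : ℝ → ℝ, IsCutoff χ ∧ χ ≠ 0 ∧ ρ = l2norm (deriv χ) / l2norm χ}
      (Real.pi / 2) := by
  constructor
  · rintro ρ ⟨χ, hχ, h0, rfl⟩
    rw [le_div_iff₀ (l2norm_pos hχ.contDiff.continuous hχ.hasCompactSupport h0)]
    exact hχ.mul_l2norm_le
  · intro b hb
    exact ge_of_tendsto' tendsto_l2norm_cosCutoff fun n =>
      hb ⟨_, isCutoff_cosCutoff (by positivity), cosCutoff_one_div_ne_zero n, rfl⟩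

/-- Every ratio above the optimal one is attained. -/
theorem exists_isCutoff_ratio_eq {R : ℝ} (hR : Real.pi / 2 < R) :
    ∃ χ : ℝ → ℝ, IsCutoff χ ∧ χ ≠ 0 ∧ l2norm (deriv χ) / l2norm χ = R := by
  -- A cutoff with ratio ρ below R is compressed by R/ρ ≥ 1, which keeps its support in (-1, 1) and
  -- raises the ratio to exactly R.
  obtain ⟨ρ, ⟨χ, hχ, h0, rfl⟩, hle, hlt⟩ := isGLB_l2norm_deriv_div_l2norm.exists_between hR
  set ρ := l2norm (deriv χ) / l2norm χ
  have hρ : 0 < ρ := by linarith [Real.pi_pos]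
  have ha : 1 ≤ R / ρ := by rw [one_le_div hρ]; exact hlt.le
  refine ⟨_, hχ.comp_mul_left ha, ?_, ?_⟩
  · obtain ⟨x, hx⟩ := Function.ne_iff.1 h0
    refine Function.ne_iff.2 ⟨x / (R / ρ), ?_⟩
    have hne : R / ρ ≠ 0 := by positivity
    change χ (R / ρ * (x / (R / ρ))) ≠ 0
    rwa [mul_div_cancel₀ x hne]
  · rw [l2norm_deriv_div_l2norm_comp_mul_left χ (by positivity)]
    exact div_mul_cancel₀ R hρ.ne'

end

/-! ### Conclusion -/

theorem mainTheorem4 (F : QuantumNormalForm) :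
    -- the evolved states are well defined
    (∀ h : ℝ, 0 < h → h ≤ 1 → ∀ n : ℤ, ∃! ψ : ℝ → ModelL2, F.IsEvolution h n ψ) ∧
    -- the function `S₁` is positive
    (∀ q θ : ℝ, 0 < q → 0 < S1 q θ) ∧
    -- the square norm of the time average
    (∀ χ : ℝ → ℝ, IsCutoff χ → ∀ (C CE : ℝ) (n₀ : ℕ), ∃ K : ℝ,
      ∀ h : ℝ, 0 < h → h ≤ 1 →
      ∀ n : ℤ, n.natAbs ≤ n₀ →
      ∀ E : ℝ, |E - F.energy| ≤ CE * h →
      ∀ T : ℝ, 1 ≤ T → T ≤ C * |Real.log h| →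
      ∀ ψ : ℝ → ModelL2, F.IsEvolution h n ψ →
        ∃ r : ℝ, |r| ≤ K / T ∧
          ‖quasimode h ψ χ T E‖ ^ 2 =
            T * S1 F.rate ((E - F.centralEnergy h n) / h) * l2norm χ ^ 2 * (1 + r)) ∧
    -- the square norm of `(P - E) Ψ` at the Ehrenfest time
    (∀ χ : ℝ → ℝ, IsCutoff χ → ∀ ε : ℝ, 0 < ε → ε < 1 → ∀ (CE : ℝ) (n₀ : ℕ), ∃ K : ℝ,
      ∀ h : ℝ, 0 < h → h ≤ 1 / 2 →
      ∀ n : ℤ, n.natAbs ≤ n₀ →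
      ∀ E : ℝ, |E - F.energy| ≤ CE * h →
      ∀ ψ : ℝ → ModelL2, F.IsEvolution h n ψ →
        ∃ hΨ : quasimode h ψ χ (ehrenfestTime F.rate ε h) E ∈ (F.operator h).domain,
        ∃ r : ℝ, |r| ≤ K / |Real.log h| ∧
          ‖F.operator h ⟨quasimode h ψ χ (ehrenfestTime F.rate ε h) E, hΨ⟩
              - (E : ℂ) • quasimode h ψ χ (ehrenfestTime F.rate ε h) E‖ ^ 2 =
            h ^ 2 / ehrenfestTime F.rate ε h * S1 F.rate ((E - F.centralEnergy h n) / h)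
              * l2norm (deriv χ) ^ 2 * (1 + r)) ∧
    -- the width of the normalized time average
    (∀ χ : ℝ → ℝ, IsCutoff χ → χ ≠ 0 → ∀ ε : ℝ, 0 < ε → ε < 1 → ∀ (CE : ℝ) (n₀ : ℕ),
      ∃ K h₀ : ℝ, 0 < h₀ ∧ h₀ ≤ 1 / 2 ∧
      ∀ h : ℝ, 0 < h → h ≤ h₀ →
      ∀ n : ℤ, n.natAbs ≤ n₀ →
      ∀ E : ℝ, |E - F.energy| ≤ CE * h →
      ∀ ψ : ℝ → ModelL2, F.IsEvolution h n ψ →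
        quasimode h ψ χ (ehrenfestTime F.rate ε h) E ≠ 0 ∧
        ∃ hΨ : normalizedQuasimode h ψ χ (ehrenfestTime F.rate ε h) E ∈ (F.operator h).domain,
        ∃ r : ℝ, |r| ≤ K / |Real.log h| ∧
          ‖F.operator h ⟨normalizedQuasimode h ψ χ (ehrenfestTime F.rate ε h) E, hΨ⟩
              - (E : ℂ) • normalizedQuasimode h ψ χ (ehrenfestTime F.rate ε h) E‖ =
            h / ehrenfestTime F.rate ε h * (l2norm (deriv χ) / l2norm χ) * (1 + r)) ∧
    -- the optimal ratio over all weight functions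
    IsGLB {ρ : ℝ | ∃ χ : ℝ → ℝ, IsCutoff χ ∧ χ ≠ 0 ∧ ρ = l2norm (deriv χ) / l2norm χ}
      (Real.pi / 2) ∧
    -- the width for a nearly optimal weight function
    (∀ ε : ℝ, 0 < ε → ε < 1 / 2 → ∃ χ : ℝ → ℝ, IsCutoff χ ∧ χ ≠ 0 ∧
      l2norm (deriv χ) / l2norm χ ≤ Real.pi / 2 * (1 + ε) ∧
      ∀ (CE : ℝ) (n₀ : ℕ), ∃ K h₀ : ℝ, 0 < h₀ ∧ h₀ ≤ 1 / 2 ∧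
      ∀ h : ℝ, 0 < h → h ≤ h₀ →
      ∀ n : ℤ, n.natAbs ≤ n₀ →
      ∀ E : ℝ, |E - F.energy| ≤ CE * h →
      ∀ ψ : ℝ → ModelL2, F.IsEvolution h n ψ →
        quasimode h ψ χ (ehrenfestTime F.rate ε h) E ≠ 0 ∧
        ∃ hΨ : normalizedQuasimode h ψ χ (ehrenfestTime F.rate ε h) E ∈ (F.operator h).domain,
          (∃ r : ℝ, |r| ≤ K / |Real.log h| ∧
            ‖F.operator h ⟨normalizedQuasimode h ψ χ (ehrenfestTime F.rate ε h) E, hΨ⟩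
                - (E : ℂ) • normalizedQuasimode h ψ χ (ehrenfestTime F.rate ε h) E‖ =
              Real.pi * F.rate * (1 + 2 * ε) * (h / |Real.log h|) * (1 + r)) ∧
          ‖F.operator h ⟨normalizedQuasimode h ψ χ (ehrenfestTime F.rate ε h) E, hΨ⟩
              - (E : ℂ) • normalizedQuasimode h ψ χ (ehrenfestTime F.rate ε h) E‖ ≤
            Real.pi * F.rate * (1 + 3 * ε) * (h / |Real.log h|)) := by
  refine ⟨fun h hh _ n => F.existsUnique_evolution hh n, fun q θ hq => S1_pos hq θ,
    F.exists_norm_sq_timeAverage, fun χ hχ ε _ hε => F.exists_norm_sq_defect χ hχ ε hε,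
    fun χ hχ h0 ε _ hε => F.exists_norm_normalized_defect χ hχ h0 ε hε,
    isGLB_l2norm_deriv_div_l2norm, fun ε h0 hε => ?_⟩
  have hpi := Real.pi_pos
  -- The factor 1 - ε cancels the one in the Ehrenfest time, leaving exactly 1 + 2ε. As (1 - ε)(1 +
  -- 2ε) = 1 + ε - 2ε², the ratio exceeds π/2 precisely because ε < 1/2, and it stays below (π/2)(1
  -- + ε).
  obtain ⟨χ, hχ, hχ0, hratio⟩ := exists_isCutoff_ratio_eq
    (R := Real.pi / 2 * ((1 - ε) * (1 + 2 * ε))) (lt_mul_of_one_lt_right (by positivity) (by nlinarith))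
  refine ⟨χ, hχ, hχ0, ?_, fun CE n₀ => ?_⟩
  · rw [hratio]
    exact mul_le_mul_of_nonneg_left (by nlinarith) (by positivity)
  obtain ⟨K, h₀, hh₀, hh₀', hb⟩ :=
    F.exists_norm_normalized_defect χ hχ hχ0 ε (by linarith) CE n₀
  -- The second bound on h gives (1 + 2ε)|K|/|log h| ≤ ε, so the relative error fits into the gap
  -- between 1 + 2ε and 1 + 3ε. The absolute value is taken because K has no known sign.
  refine ⟨K, min h₀ (Real.exp (-((1 + 2 * ε) * |K| / ε))), by positivity,
    (min_le_left _ _).trans hh₀', fun h hh h1 n hn E hE ψ hψ => ?_⟩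
  obtain ⟨hne, hΨ, r, hr, heq⟩ := hb h hh (h1.trans (min_le_left _ _)) n hn E hE ψ hψ
  have hlog : 0 < |Real.log h| :=
    abs_pos.2 (Real.log_neg hh (by linarith [h1.trans (min_le_left _ _)])).ne
  have hK := le_abs_log_of_le_exp_neg hh (h1.trans (min_le_right _ _))
  have hrate := F.rate_pos
  change 0 < F.rate at hrate
  have hε' : 0 < 1 - ε := by linarith
  have hfactor : h / ehrenfestTime F.rate ε h * (l2norm (deriv χ) / l2norm χ) =
      Real.pi * F.rate * (1 + 2 * ε) * (h / |Real.log h|) := by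
    rw [hratio, ehrenfestTime]
    field_simp
  rw [hfactor] at heq
  refine ⟨hne, hΨ, ⟨r, hr, heq⟩, heq.le.trans ?_⟩
  have hr2 : (1 + 2 * ε) * r ≤ ε := by
    have h2 : r ≤ |K| / |Real.log h| := (le_abs_self r).trans
      (hr.trans (div_le_div_of_nonneg_right (le_abs_self K) hlog.le))
    rw [div_le_iff₀ h0] at hK
    calc (1 + 2 * ε) * r ≤ (1 + 2 * ε) * (|K| / |Real.log h|) := by gcongr
      _ = (1 + 2 * ε) * |K| / |Real.log h| := by ring
      _ ≤ ε := by rw [div_le_iff₀ hlog]; linarith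
  calc Real.pi * F.rate * (1 + 2 * ε) * (h / |Real.log h|) * (1 + r) =
        Real.pi * F.rate * (h / |Real.log h|) * (1 + 2 * ε + (1 + 2 * ε) * r) := by ring
    _ ≤ Real.pi * F.rate * (h / |Real.log h|) * (1 + 3 * ε) := by
        refine mul_le_mul_of_nonneg_left ?_ (by positivity)
        linarith
    _ = Real.pi * F.rate * (1 + 3 * ε) * (h / |Real.log h|) := by ring
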